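/- In the p-Partial Cover problem the input consists of a ground set of $n$ elements, a collection of $m$ subsets $S_1,\dots,S_m$ of it, and an integer $p\ge 0$; the goal is to find a smallest sub-collection of these sets whose union contains at least $p$ elements, or to report that there is none. There is a constant $C>0$ such that for every fixed $\varepsilon>0$ there is a randomized algorithm which, on every instance with $m\ge 1$ and for all outcomes of its coin tosses, halts within time $O_\varepsilon\bigl((2+\varepsilon)^p\, m^{C/\min(\varepsilon,1)}\bigr)$ (so $(2+\varepsilon)^p\, m^{O(1/\varepsilon)}$ for $\varepsilon\le 1$), and which outputs a correct answer with probability at least $2/3$. For $m=0$ the same holds with $m$ replaced by $1$ in the bound. Here time is counted on a word RAM (unit-cost arithmetic, bitwise operations, comparisons, indirect addressing and fair coin tosses) whose words have $w$ bits, for any $w\ge c_\varepsilon\lceil\log_2(n+m+p+2)\rceil$, where $c_\varepsilon$ depends only on $\varepsilon$. The input is given in memory as $n$, $m$, $p$, followed for each set by its cardinality and the list of its elements in increasing order. -/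

import Mathlib

open MeasureTheory

/-! ### The partial cover problem -/

/-- An instance: a ground set of `n` elements, an indexed collection of `m` subsets of it,
and the number `p` of elements that have to be covered. -/
structure PartialCoverInstance where
  n : ℕ
  m : ℕ
  p : ℕ
  sets : Fin m → Finset (Fin n)

namespace PartialCoverInstance

/-- The sub-collection `J` covers at least `p` elements. -/
def IsPartialCover (I : PartialCoverInstance) (J : Finset (Fin I.m)) : Prop :=
  I.p ≤ (J.biUnion I.sets).card

/-- `J` is a partial cover with the fewest sets. -/
def IsOptimal (I : PartialCoverInstance) (J : Finset (Fin I.m)) : Prop :=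
  I.IsPartialCover J ∧ ∀ J' : Finset (Fin I.m), I.IsPartialCover J' → J.card ≤ J'.card

/-- The input as a sequence of machine words: `n, m, p`, and then for every set its cardinality
followed by its elements in increasing order. -/
def encode (I : PartialCoverInstance) : List ℕ :=
  [I.n, I.m, I.p] ++
    (List.finRange I.m).flatMap fun i =>
      (I.sets i).card :: ((I.sets i).sort (· ≤ ·)).map fun u : Fin I.n => (u : ℕ)

/-- The contents `out` of the output array answer the instance: cell `0` tells whether a partial
cover exists, and if so, cell `i + 1` tells whether the `i`-th set belongs to the smallest
sub-collection that was found. -/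
def IsAnswer (I : PartialCoverInstance) (out : ℕ → ℕ) : Prop :=
  ((∃ J, I.IsPartialCover J) →
      out 0 = 1 ∧ I.IsOptimal (Finset.univ.filter fun i : Fin I.m => out (i + 1) = 1)) ∧
    ((¬ ∃ J, I.IsPartialCover J) → out 0 = 0)

end PartialCoverInstance

/-! ### Randomized word RAM programs

Structured programs over registers and a constant number of randomly accessible arrays, whose
cells hold `w`-bit words. Every operation on words, every access to a register or to an array
cell, every test and every toss of a coin takes one unit of time. -/

namespace WordRAM

/-- The binary operations on words. -/
inductive BinOp where
  | add | sub | mul | div | mod | and | or | xor | shl | shr | lt | eq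

/-- Results are reduced modulo `2 ^ w`; subtraction is truncated at `0`. -/
def BinOp.eval (w : ℕ) : BinOp → ℕ → ℕ → ℕ
  | .add, x, y => (x + y) % 2 ^ w
  | .sub, x, y => (x - y) % 2 ^ w
  | .mul, x, y => (x * y) % 2 ^ w
  | .div, x, y => (x / y) % 2 ^ w
  | .mod, x, y => (x % y) % 2 ^ w
  | .and, x, y => (x &&& y) % 2 ^ w
  | .or, x, y => (x ||| y) % 2 ^ w
  | .xor, x, y => (x ^^^ y) % 2 ^ w
  | .shl, x, y => (x <<< y) % 2 ^ w
  | .shr, x, y => (x >>> y) % 2 ^ w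
  | .lt, x, y => (if x < y then 1 else 0) % 2 ^ w
  | .eq, x, y => (if x = y then 1 else 0) % 2 ^ w

/-- Expressions: constants, registers, array cells (`load a e` is cell `e` of array `a`; the
array is named by the program text), operations. -/
inductive Expr where
  | const (k : ℕ)
  | reg (x : ℕ)
  | load (a : ℕ) (e : Expr)
  | bin (o : BinOp) (e₁ e₂ : Expr)

/-- Programs. `flip x` puts a fresh random bit into register `x`; tests succeed on nonzero words. -/
inductive Program where
  | skip
  | assign (x : ℕ) (e : Expr)
  | store (a : ℕ) (e₁ e₂ : Expr)
  | flip (x : ℕ)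
  | seq (P Q : Program)
  | ite (e : Expr) (P Q : Program)
  | while (e : Expr) (P : Program)

/-- A machine state; `coins` is the sequence of the outcomes of the coin tosses still to come. -/
structure State where
  regs : ℕ → ℕ
  mem : ℕ → ℕ → ℕ
  coins : ℕ → Bool

def Expr.eval (w : ℕ) (s : State) : Expr → ℕ
  | .const k => k % 2 ^ w
  | .reg x => s.regs x
  | .load a e => s.mem a (e.eval w s)
  | .bin o e₁ e₂ => o.eval w (e₁.eval w s) (e₂.eval w s)

/-- The time it takes to evaluate an expression. -/
def Expr.cost : Expr → ℕ
  | .const _ => 1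
  | .reg _ => 1
  | .load _ e => e.cost + 1
  | .bin _ e₁ e₂ => e₁.cost + e₂.cost + 1

/-- `Exec w P s t s'`: with word length `w`, the program `P` started in state `s` halts after
exactly `t` units of time in state `s'`. -/
inductive Exec (w : ℕ) : Program → State → ℕ → State → Prop where
  | skip (s : State) : Exec w .skip s 1 s
  | assign (x : ℕ) (e : Expr) (s : State) :
      Exec w (.assign x e) s (e.cost + 1)
        { s with regs := Function.update s.regs x (e.eval w s) }
  | store (a : ℕ) (e₁ e₂ : Expr) (s : State) :
      Exec w (.store a e₁ e₂) s (e₁.cost + e₂.cost + 1)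
        { s with
          mem := Function.update s.mem a
            (Function.update (s.mem a) (e₁.eval w s) (e₂.eval w s)) }
  | flip (x : ℕ) (s : State) :
      Exec w (.flip x) s 1
        { s with
          regs := Function.update s.regs x ((s.coins 0).toNat)
          coins := fun i => s.coins (i + 1) }
  | seq {P Q : Program} {s s' s'' : State} {t t' : ℕ} :
      Exec w P s t s' → Exec w Q s' t' s'' → Exec w (.seq P Q) s (t + t') s''
  | ite_true {e : Expr} {P Q : Program} {s s' : State} {t : ℕ} :
      e.eval w s ≠ 0 → Exec w P s t s' → Exec w (.ite e P Q) s (e.cost + 1 + t) s'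
  | ite_false {e : Expr} {P Q : Program} {s s' : State} {t : ℕ} :
      e.eval w s = 0 → Exec w Q s t s' → Exec w (.ite e P Q) s (e.cost + 1 + t) s'
  | while_true {e : Expr} {P : Program} {s s' s'' : State} {t t' : ℕ} :
      e.eval w s ≠ 0 → Exec w P s t s' → Exec w (.while e P) s' t' s'' →
        Exec w (.while e P) s (e.cost + 1 + t + t') s''
  | while_false {e : Expr} {P : Program} {s : State} :
      e.eval w s = 0 → Exec w (.while e P) s (e.cost + 1) s

/-- The initial state: the input is in array `0`, everything else is zero. -/
def State.init (input : List ℕ) (coins : ℕ → Bool) : State where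
  regs := fun _ => 0
  mem := fun a i => if a = 0 then input.getD i 0 else 0
  coins := coins

/-- The output is left in array `1`. -/
def State.output (s : State) : ℕ → ℕ := s.mem 1

/-- The distribution of an infinite sequence of independent fair coin tosses. -/
noncomputable def fairCoins : Measure (ℕ → Bool) :=
  Measure.infinitePi fun _ : ℕ => (PMF.uniformOfFintype Bool).toMeasure

end WordRAM

/-! ### Symbolic execution of programs -/

namespace WordRAM

namespace State

/-- Overwrite a register. -/
def setReg (s : State) (x v : ℕ) : State := { s with regs := Function.update s.regs x v }

/-- Overwrite an array cell. -/
def setMem (s : State) (a i v : ℕ) : State :=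
  { s with mem := Function.update s.mem a (Function.update (s.mem a) i v) }

@[simp] theorem setReg_regs (s : State) (x v y : ℕ) :
    (s.setReg x v).regs y = if y = x then v else s.regs y := by
  simp [setReg, Function.update_apply]

@[simp] theorem setReg_mem (s : State) (x v : ℕ) : (s.setReg x v).mem = s.mem := rfl

@[simp] theorem setReg_coins (s : State) (x v : ℕ) : (s.setReg x v).coins = s.coins := rfl

@[simp] theorem setMem_regs (s : State) (a i v : ℕ) : (s.setMem a i v).regs = s.regs := rfl

@[simp] theorem setMem_coins (s : State) (a i v : ℕ) : (s.setMem a i v).coins = s.coins := rfl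

@[simp] theorem setMem_mem (s : State) (a i v b : ℕ) :
    (s.setMem a i v).mem b = if b = a then Function.update (s.mem a) i v else s.mem b := by
  by_cases h : b = a
  · subst h; simp [setMem]
  · simp [setMem, h]

end State

namespace Expr

instance : Add Expr := ⟨.bin .add⟩
instance : Sub Expr := ⟨.bin .sub⟩
instance : Mul Expr := ⟨.bin .mul⟩
instance : Div Expr := ⟨.bin .div⟩
instance : Mod Expr := ⟨.bin .mod⟩

/-- The test `e₁ < e₂`. -/
def less (e₁ e₂ : Expr) : Expr := .bin .lt e₁ e₂

/-- The test `e₁ = e₂`. -/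
def same (e₁ e₂ : Expr) : Expr := .bin .eq e₁ e₂

section
variable (w : ℕ) (s : State) (e₁ e₂ : Expr) (k a : ℕ)

theorem eval_const : (Expr.const k).eval w s = k % 2 ^ w := rfl
theorem eval_reg : (Expr.reg k).eval w s = s.regs k := rfl
theorem eval_load : (Expr.load a e₁).eval w s = s.mem a (e₁.eval w s) := rfl
theorem eval_add : (e₁ + e₂).eval w s = (e₁.eval w s + e₂.eval w s) % 2 ^ w := rfl
theorem eval_sub : (e₁ - e₂).eval w s = (e₁.eval w s - e₂.eval w s) % 2 ^ w := rfl
theorem eval_mul : (e₁ * e₂).eval w s = (e₁.eval w s * e₂.eval w s) % 2 ^ w := rfl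
theorem eval_div : (e₁ / e₂).eval w s = (e₁.eval w s / e₂.eval w s) % 2 ^ w := rfl
theorem eval_mod : (e₁ % e₂).eval w s = (e₁.eval w s % e₂.eval w s) % 2 ^ w := rfl
theorem eval_less :
    (e₁.less e₂).eval w s = (if e₁.eval w s < e₂.eval w s then 1 else 0) % 2 ^ w := rfl
theorem eval_same :
    (e₁.same e₂).eval w s = (if e₁.eval w s = e₂.eval w s then 1 else 0) % 2 ^ w := rfl

theorem cost_const : (Expr.const k).cost = 1 := rfl
theorem cost_reg : (Expr.reg k).cost = 1 := rfl
theorem cost_load : (Expr.load a e₁).cost = e₁.cost + 1 := rfl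
theorem cost_add : (e₁ + e₂).cost = e₁.cost + e₂.cost + 1 := rfl
theorem cost_sub : (e₁ - e₂).cost = e₁.cost + e₂.cost + 1 := rfl
theorem cost_mul : (e₁ * e₂).cost = e₁.cost + e₂.cost + 1 := rfl
theorem cost_div : (e₁ / e₂).cost = e₁.cost + e₂.cost + 1 := rfl
theorem cost_mod : (e₁ % e₂).cost = e₁.cost + e₂.cost + 1 := rfl
theorem cost_less : (e₁.less e₂).cost = e₁.cost + e₂.cost + 1 := rfl
theorem cost_same : (e₁.same e₂).cost = e₁.cost + e₂.cost + 1 := rfl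

end

theorem eval_less_ne_zero {w : ℕ} (hw : 0 < w) (s : State) (e₁ e₂ : Expr) :
    (e₁.less e₂).eval w s ≠ 0 ↔ e₁.eval w s < e₂.eval w s := by
  have : 1 < 2 ^ w := Nat.one_lt_two_pow hw.ne'
  rw [eval_less]
  split_ifs with h <;> simp [h, Nat.mod_eq_of_lt this]

theorem eval_same_ne_zero {w : ℕ} (hw : 0 < w) (s : State) (e₁ e₂ : Expr) :
    (e₁.same e₂).eval w s ≠ 0 ↔ e₁.eval w s = e₂.eval w s := by
  have : 1 < 2 ^ w := Nat.one_lt_two_pow hw.ne'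
  rw [eval_same]
  split_ifs with h <;> simp [h, Nat.mod_eq_of_lt this]

end Expr

/-- Started in state `s` at time `τ`, the program `P` halts, at a time and in a state related
by `Q`. -/
def Reaches (w : ℕ) (P : Program) (τ : ℕ) (Q : ℕ → State → Prop) (s : State) : Prop :=
  ∃ t s', Exec w P s t s' ∧ Q (τ + t) s'

namespace Reaches

variable {w : ℕ} {P P' : Program} {τ : ℕ} {Q Q' : ℕ → State → Prop} {s : State}

theorem mono (h : Reaches w P τ Q s) (hQ : ∀ τ' s', Q τ' s' → Q' τ' s') :
    Reaches w P τ Q' s := by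
  obtain ⟨t, s', h₁, h₂⟩ := h
  exact ⟨t, s', h₁, hQ _ _ h₂⟩

theorem skip (h : Q (τ + 1) s) : Reaches w .skip τ Q s := ⟨_, _, .skip s, h⟩

theorem assign {x : ℕ} {e : Expr} (h : Q (τ + (e.cost + 1)) (s.setReg x (e.eval w s))) :
    Reaches w (.assign x e) τ Q s := ⟨_, _, .assign x e s, h⟩

theorem store {a : ℕ} {e₁ e₂ : Expr}
    (h : Q (τ + (e₁.cost + e₂.cost + 1)) (s.setMem a (e₁.eval w s) (e₂.eval w s))) :
    Reaches w (.store a e₁ e₂) τ Q s := ⟨_, _, .store a e₁ e₂ s, h⟩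

theorem flip {x : ℕ}
    (h : Q (τ + 1) { (s.setReg x (s.coins 0).toNat) with coins := fun i => s.coins (i + 1) }) :
    Reaches w (.flip x) τ Q s := ⟨_, _, .flip x s, h⟩

theorem seq (h : Reaches w P τ (fun τ' s' => Reaches w P' τ' Q s') s) :
    Reaches w (.seq P P') τ Q s := by
  obtain ⟨t, s', h₁, t', s'', h₂, h₃⟩ := h
  exact ⟨_, _, .seq h₁ h₂, by rwa [← add_assoc]⟩

theorem ite {e : Expr} (h₁ : e.eval w s ≠ 0 → Reaches w P (τ + (e.cost + 1)) Q s)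
    (h₂ : e.eval w s = 0 → Reaches w P' (τ + (e.cost + 1)) Q s) :
    Reaches w (.ite e P P') τ Q s := by
  by_cases h : e.eval w s = 0
  · obtain ⟨t, s', h₃, h₄⟩ := h₂ h
    exact ⟨_, _, .ite_false h h₃, by rwa [← add_assoc]⟩
  · obtain ⟨t, s', h₃, h₄⟩ := h₁ h
    exact ⟨_, _, .ite_true h h₃, by rwa [← add_assoc]⟩

/-- A loop whose body runs exactly `N` times, for at most `c` time units each time. -/
theorem whileLoop {e : Expr} (N c : ℕ) (Inv : ℕ → State → Prop) (h₀ : Inv 0 s)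
    (hbody : ∀ k < N, ∀ s τ, Inv k s → e.eval w s ≠ 0 ∧
      Reaches w P τ (fun τ' s' => τ' ≤ τ + c ∧ Inv (k + 1) s') s)
    (hend : ∀ s, Inv N s → e.eval w s = 0)
    (hQ : ∀ τ' s', τ' ≤ τ + (N * (c + e.cost + 1) + e.cost + 1) → Inv N s' → Q τ' s') :
    Reaches w (.while e P) τ Q s := by
  -- Induction on the number `r` of iterations still to come.
  have key : ∀ r k s, k + r = N → Inv k s → ∃ t s', Exec w (.while e P) s t s' ∧
      t ≤ r * (c + e.cost + 1) + e.cost + 1 ∧ Inv N s' := by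
    intro r
    induction r with
    | zero =>
      intro k s hk h
      obtain rfl : k = N := by omega
      exact ⟨_, _, .while_false (hend s h), by simp, h⟩
    | succ r ih =>
      intro k s hk h
      obtain ⟨h₁, t, s', h₂, h₃, h₄⟩ := hbody k (by omega) s 0 h
      obtain ⟨t', s'', h₅, h₆, h₇⟩ := ih (k + 1) s' (by omega) h₄
      refine ⟨_, _, .while_true h₁ h₂ h₅, ?_, h₇⟩
      rw [Nat.succ_mul]
      omega
  obtain ⟨t, s', h₁, h₂, h₃⟩ := key N 0 s (by simp) h₀
  exact ⟨t, s', h₁, hQ _ _ (by omega) h₃⟩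

end Reaches

/-- The loop `for x = 0, 1, …, e - 1 do P`. -/
def Program.loop (x : ℕ) (e : Expr) (P : Program) : Program :=
  .seq (.assign x (.const 0))
    (.while ((Expr.reg x).less e) (.seq P (.assign x (.reg x + .const 1))))

/-- The bound `N < 2 ^ w` lets the counter reach `N` without wrapping around. The invariant for `k +
1` is demanded after the counter has been advanced, so that it may speak about all registers. -/
theorem Reaches.loop {w : ℕ} {P : Program} {τ : ℕ} {Q : ℕ → State → Prop} {s : State}
    {x : ℕ} {e : Expr} (N c : ℕ) (Inv : ℕ → State → Prop) (hw : 0 < w) (hN : N < 2 ^ w)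
    (h₀ : Inv 0 (s.setReg x 0)) (he : ∀ k s, Inv k s → e.eval w s = N)
    (hbody : ∀ k < N, ∀ s τ, Inv k s → s.regs x = k → Reaches w P τ
      (fun τ' s' => τ' ≤ τ + c ∧ s'.regs x = k ∧ Inv (k + 1) (s'.setReg x (k + 1))) s)
    (hQ : ∀ τ' s', τ' ≤ τ + (N * (c + e.cost + 7) + e.cost + 5) → Inv N s' → Q τ' s') :
    Reaches w (.loop x e P) τ Q s := by
  apply Reaches.seq
  apply Reaches.assign
  rw [show (Expr.const 0).eval w s = 0 from Nat.zero_mod _]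
  -- The increment of the counter accounts for the 4 additional units.
  apply Reaches.whileLoop N (c + 4) fun k s => Inv k s ∧ s.regs x = k
  · exact ⟨h₀, by simp⟩
  · rintro k hk s τ ⟨h₁, h₂⟩
    refine ⟨?_, ?_⟩
    · rw [Expr.eval_less_ne_zero hw, he k s h₁]
      simpa [Expr.eval_reg, h₂] using hk
    · apply Reaches.seq
      refine (hbody k hk s τ h₁ h₂).mono ?_
      rintro τ' s' ⟨h₃, h₄, h₅⟩
      apply Reaches.assign
      have : 1 < 2 ^ w := Nat.one_lt_two_pow hw.ne'
      rw [Expr.eval_add, Expr.eval_reg, Expr.eval_const, Nat.mod_eq_of_lt this, h₄,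
        Nat.mod_eq_of_lt (by omega)]
      refine ⟨?_, h₅, by simp⟩
      simp only [Expr.cost_add, Expr.cost_reg, Expr.cost_const]
      omega
  · rintro s ⟨h₁, h₂⟩
    by_contra h
    rw [← ne_eq, Expr.eval_less_ne_zero hw, he N s h₁] at h
    simp [Expr.eval_reg, h₂] at h
  · rintro τ' s' h₁ ⟨h₂, h₃⟩
    refine hQ _ _ ?_ h₂
    simp only [Expr.cost_less, Expr.cost_reg, Expr.cost_const] at h₁
    refine h₁.trans ?_
    have : N * (c + 4 + (1 + e.cost + 1) + 1) = N * (c + e.cost + 7) := by ring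
    rw [this]
    omega

/-- The registers below `c` and the arrays below `d` are the same in both states. -/
structure Frame (c d : ℕ) (s s' : State) : Prop where
  regs : ∀ r < c, s'.regs r = s.regs r
  mem : ∀ a < d, s'.mem a = s.mem a

namespace Frame

variable {c c' d d' : ℕ} {s s' s'' : State}

theorem refl (c d : ℕ) (s : State) : Frame c d s s := ⟨fun _ _ => rfl, fun _ _ => rfl⟩

theorem trans (h : Frame c d s s') (h' : Frame c' d' s' s'') (hc : c ≤ c') (hd : d ≤ d') :
    Frame c d s s'' :=
  ⟨fun r hr => (h'.regs r (hr.trans_le hc)).trans (h.regs r hr),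
    fun a ha => (h'.mem a (ha.trans_le hd)).trans (h.mem a ha)⟩

theorem mono (h : Frame c d s s') (hc : c' ≤ c) (hd : d' ≤ d) : Frame c' d' s s' :=
  ⟨fun r hr => h.regs r (hr.trans_le hc), fun a ha => h.mem a (ha.trans_le hd)⟩

theorem setReg (h : Frame c d s s') (x v : ℕ) (hx : c ≤ x) : Frame c d s (s'.setReg x v) :=
  ⟨fun r hr => by simp [(hr.trans_le hx).ne, h.regs r hr], fun a ha => h.mem a ha⟩

theorem setMem (h : Frame c d s s') (a i v : ℕ) (hx : d ≤ a) : Frame c d s (s'.setMem a i v) :=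
  ⟨fun r hr => h.regs r hr, fun b hb => by simp [(hb.trans_le hx).ne, h.mem b hb]⟩

end Frame

end WordRAM

/-! ### The algorithm

Registers: `0` number of sets `m`, `1` target `p`, `2` range of the random weights, `3` price of
a set, `4` price of a pair, `5` degree bound, `6` success flag, `7` least weight, `8` number of
the run, `9` carry, `10` set, `11` position in the set; the others are for local use.

Arrays: `0` input, `1` output, `2` random weights, `3` lengths of the truncated sets, `4` their
elements (`p` cells for every set), `5` representative positions of the elements, `6` parities of
the numbers of configurations, `7` the current set of labels, `8` and `9` polynomials. -/

namespace WordRAM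

namespace PartialCover

/-- Append a random bit to the number in register `9` and double register `10`. -/
def drawBit : Program :=
  .seq (.flip 11) (.seq (.assign 9 (.reg 9 + .reg 9 + .reg 11)) (.assign 10 (.reg 10 + .reg 10)))

/-- Draw the random weight with the number in register `8`. -/
def drawWeight : Program :=
  .seq (.assign 9 (.const 0)) (.seq (.assign 10 (.const 1))
    (.seq (.while ((Expr.reg 10).less (.reg 2)) drawBit) (.store 2 (.reg 8) (.reg 9))))

/-- The number of random weights. -/
def numWeights : Expr := .reg 0 * .reg 1 * (.reg 1 + .const 1)

/-- The range is the least power of two that is at least three times the number of weights: a power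
of two can be sampled exactly with fair coins, and the factor 3 bounds the failure probability of
isolation by 1/3. -/
def drawWeights : Program :=
  .seq (.assign 2 (.const 1))
    (.seq (.while ((Expr.reg 2).less (.const 3 * numWeights)) (.assign 2 (.reg 2 + .reg 2)))
      (.loop 8 numWeights drawWeight))

/-- Copy an element of the current set. -/
def readElement : Program :=
  .seq (.assign 13 (.reg 10 * .reg 1 + .reg 11))
    (.seq (.store 4 (.reg 13) (.load 0 (.reg 9 + .const 1 + .reg 11)))
      (.store 5 (.load 4 (.reg 13)) (.reg 13)))

/-- At most `p` elements are copied, but the input pointer skips the whole set; thus the time does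
not depend on the cardinality. -/
def readSet : Program :=
  .seq (.assign 12 (.load 0 (.reg 9)))
    (.seq (.ite ((Expr.reg 12).less (.reg 1)) (.store 3 (.reg 10) (.reg 12))
        (.store 3 (.reg 10) (.reg 1)))
      (.seq (.loop 11 (.load 3 (.reg 10)) readElement)
        (.assign 9 (.reg 9 + .const 1 + .reg 12))))

def readInput : Program :=
  .seq (.assign 9 (.const 3)) (.loop 10 (.reg 0) readSet)

/-- Each price dominates what is below it: the `2 * p` random weights of a configuration sum to less
than the price of a set, and at most `m` sets plus these weights cost less than one pair. So
configurations with `p` pairs stay below the degree bound, and `p + 1` pairs reach it. -/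
def setPrices : Program :=
  .seq (.assign 3 ((.const 2 * .reg 1 + .const 1) * .reg 2))
    (.seq (.assign 4 ((.reg 0 + .const 1) * .reg 3))
      (.assign 5 ((.reg 1 + .const 1) * .reg 4)))

def setup : Program :=
  .seq (.assign 0 (.load 0 (.const 1))) (.seq (.assign 1 (.load 0 (.const 2)))
    (.seq drawWeights (.seq readInput setPrices)))

/-- Array `9` at cell `15` gets the contribution of label `16`. -/
def addLabel : Program :=
  .ite (.load 7 (.reg 16))
    (.seq (.assign 17 (.reg 12 + .load 2 (.reg 13 + .reg 16)))
      (.ite ((Expr.reg 15).less (.reg 17)) .skip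
        (.store 9 (.reg 15) (.load 9 (.reg 15) + .load 9 (.reg 15 - .reg 17)))))
    .skip

/-- The cells are treated from the top down, which allows multiplication in place: the lower cells
that are read still hold the old polynomial. -/
def addLabels : Program :=
  .seq (.assign 15 (.reg 5 - .reg 14 - .const 1)) (.loop 16 (.reg 1) addLabel)

/-- Multiply array `9` by the factor of element `11` of set `10`. -/
def mulElement : Program :=
  .seq (.assign 12
      (.reg 4 + .load 2 ((.reg 10 * .reg 1 + .reg 11) * (.reg 1 + .const 1) + .reg 1)))
    (.seq (.assign 13 (.load 5 (.load 4 (.reg 10 * .reg 1 + .reg 11)) * (.reg 1 + .const 1)))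
      (.loop 14 (.reg 5) addLabels))

/-- Multiply array `8` by the factor of set `10`. -/
def mulSet : Program :=
  .ite ((Expr.reg 10 + .const 1).same (.reg 8)) .skip
    (.seq (.loop 14 (.reg 5) (.store 9 (.reg 14) (.load 8 (.reg 14))))
      (.seq (.loop 11 (.load 3 (.reg 10)) mulElement)
        (.loop 14 (.reg 5) (.ite ((Expr.reg 14).less (.reg 3)) .skip
          (.store 8 (.reg 14) (.load 8 (.reg 14) + .load 9 (.reg 14 - .reg 3)))))))

/-- Compute the product over all sets but the excluded one in array `8`. -/
def mulSets : Program :=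
  .seq (.loop 14 (.reg 5) (.store 8 (.reg 14) (.const 0)))
    (.seq (.store 8 (.const 0) (.const 1)) (.loop 10 (.reg 0) mulSet))

/-- Increment the binary counter in array `7`, the carry goes to register `9`. -/
def nextLabels : Program :=
  .seq (.assign 9 (.const 1))
    (.loop 14 (.reg 1) (.seq (.assign 15 (.load 7 (.reg 14) + .reg 9))
      (.seq (.store 7 (.reg 14) (.reg 15 % .const 2)) (.assign 9 (.reg 15 / .const 2)))))

def addProduct : Program :=
  .seq mulSets
    (.seq (.loop 14 (.reg 5) (.store 6 (.reg 14) (.load 6 (.reg 14) + .load 8 (.reg 14))))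
      nextLabels)

/-- Compute in array `6` the sum of the products over all sets of labels. -/
def sumProducts : Program :=
  .seq (.loop 14 (.reg 5) (.store 6 (.reg 14) (.const 0)))
    (.seq (.loop 14 (.reg 1) (.store 7 (.reg 14) (.const 0)))
      (.seq (.assign 9 (.const 0)) (.while ((Expr.reg 9).same (.const 0)) addProduct)))

/-- Find the least cell of array `6` with an odd entry. -/
def findLeast : Program :=
  .loop 14 (.reg 5) (.seq (.assign 15 (.reg 5 - .reg 14 - .const 1))
    (.ite (.load 6 (.reg 15) % .const 2) (.seq (.assign 7 (.reg 15)) (.assign 6 (.const 1)))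
      .skip))

/-- Run `0` excludes no set and finds the least degree; run `k` excludes set `k - 1` and outputs `1`
exactly if the coefficient at that degree has become even. -/
def run : Program :=
  .seq sumProducts (.ite (Expr.same (.reg 8) (.const 0)) findLeast
    (.store 1 (.reg 8) (.const 1 - .load 6 (.reg 7) % .const 2)))

def program : Program :=
  .seq setup (.seq (.loop 8 (.reg 0 + .const 1) run) (.store 1 (.const 0) (.reg 6)))

end PartialCover

end WordRAM

/-! ### The polynomials computed by the algorithm -/

namespace WordRAM

namespace PartialCover

open Polynomial

/-- The data on which the polynomials depend: the number `m` of sets, the target `p`, the prices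
`M` of a set and `B` of a pair, the degree bound `D`, the random weights, and the sets as lists. -/
structure Table where
  m : ℕ
  p : ℕ
  M : ℕ
  B : ℕ
  D : ℕ
  wt : ℕ → ℕ
  len : ℕ → ℕ
  el : ℕ → ℕ
  rep : ℕ → ℕ

namespace Table

variable (T : Table)

/-- The weight of the pair at position `a` with label `l`. -/
def cost (a l : ℕ) : ℕ :=
  T.B + T.wt (a * (T.p + 1) + T.p) + T.wt (T.rep (T.el a) * (T.p + 1) + l)

/-- The factor of the pair at position `a`, for the set of labels with nonzero `χ`. -/
noncomputable def pairFactor (χ : ℕ → ℕ) (a : ℕ) : (ZMod 2)[X] :=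
  1 + ∑ l ∈ Finset.range T.p, if χ l ≠ 0 then X ^ T.cost a l else 0

/-- In the expansion, the summand `1` leaves the set out; the other summand pays `M` for it and lets
every one of its pairs be omitted or labelled. -/
noncomputable def setFactor (χ : ℕ → ℕ) (i : ℕ) : (ZMod 2)[X] :=
  1 + X ^ T.M * ∏ j ∈ Finset.range (T.len i), T.pairFactor χ (i * T.p + j)

/-- The product of the factors of all sets except for set `k - 1`. -/
noncomputable def product (χ : ℕ → ℕ) (k : ℕ) : (ZMod 2)[X] :=
  ∏ i ∈ Finset.range T.m, if i + 1 = k then 1 else T.setFactor χ i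

/-- The sum of the products over all sets of labels. -/
noncomputable def total (k : ℕ) : (ZMod 2)[X] :=
  ∑ x ∈ Finset.range (2 ^ T.p), T.product (fun l => x / 2 ^ l % 2) k

/-- The table is stored in the registers and arrays of the machine. -/
structure Stored (s : State) : Prop where
  reg_m : s.regs 0 = T.m
  reg_p : s.regs 1 = T.p
  reg_M : s.regs 3 = T.M
  reg_B : s.regs 4 = T.B
  reg_D : s.regs 5 = T.D
  mem_wt : s.mem 2 = T.wt
  mem_len : s.mem 3 = T.len
  mem_el : s.mem 4 = T.el
  mem_rep : s.mem 5 = T.rep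

/-- No computation with the table overflows. -/
structure Fits (w : ℕ) : Prop where
  w_pos : 0 < w
  B_pos : 0 < T.B
  D_pos : 0 < T.D
  D_lt : T.D < 2 ^ w
  m_lt : T.m + 1 < 2 ^ w
  p_lt : T.p + 1 < 2 ^ w
  len_le : ∀ i < T.m, T.len i ≤ T.p
  cost_lt : ∀ x y, T.B + T.wt x + T.wt y < 2 ^ w
  pair_lt : ∀ i < T.m, ∀ j < T.len i, (i * T.p + j) * (T.p + 1) + T.p < 2 ^ w
  rep_lt : ∀ i < T.m, ∀ j < T.len i, T.rep (T.el (i * T.p + j)) * (T.p + 1) + T.p < 2 ^ w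

variable {T}

theorem Stored.of_frame {s s' : State} {c d : ℕ} (h : T.Stored s) (hf : Frame c d s s')
    (hc : 6 ≤ c) (hd : 6 ≤ d) : T.Stored s' where
  reg_m := (hf.regs 0 (by omega)).trans h.reg_m
  reg_p := (hf.regs 1 (by omega)).trans h.reg_p
  reg_M := (hf.regs 3 (by omega)).trans h.reg_M
  reg_B := (hf.regs 4 (by omega)).trans h.reg_B
  reg_D := (hf.regs 5 (by omega)).trans h.reg_D
  mem_wt := (hf.mem 2 (by omega)).trans h.mem_wt
  mem_len := (hf.mem 3 (by omega)).trans h.mem_len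
  mem_el := (hf.mem 4 (by omega)).trans h.mem_el
  mem_rep := (hf.mem 5 (by omega)).trans h.mem_rep

end Table

/-- The entries of array `a` below `D` are congruent modulo `2` to the coefficients of `F`. -/
def HasCoeffs (s : State) (a D : ℕ) (F : (ZMod 2)[X]) : Prop :=
  ∀ v < D, (s.mem a v : ZMod 2) = F.coeff v

/-- Word arithmetic may overflow in the coefficient arrays, but only parities matter, and these
survive reduction modulo `2 ^ w`. -/
theorem cast_mod_two_pow {w : ℕ} (hw : 0 < w) (x : ℕ) : ((x % 2 ^ w : ℕ) : ZMod 2) = x := by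
  rw [ZMod.natCast_eq_natCast_iff]
  exact (Nat.mod_modEq x (2 ^ w)).of_dvd (dvd_pow_self 2 hw.ne')

theorem coeff_mul_pairFactor (T : Table) (χ : ℕ → ℕ) (a v : ℕ) (F : (ZMod 2)[X]) :
    (F * T.pairFactor χ a).coeff v = F.coeff v + ∑ l ∈ Finset.range T.p,
      if χ l ≠ 0 ∧ T.cost a l ≤ v then F.coeff (v - T.cost a l) else 0 := by
  rw [Table.pairFactor, mul_add, mul_one, coeff_add, Finset.mul_sum, finsetSum_coeff]
  congr 1
  refine Finset.sum_congr rfl fun l _ => ?_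
  by_cases h : χ l = 0
  · simp [h]
  · simp [h, coeff_mul_X_pow']

/-! ### Multiplication by the factor of one set -/

section inner

variable {w : ℕ} {T : Table} {s : State} {τ : ℕ}

theorem reaches_addLabels (hT : T.Fits w) (hs : T.Stored s) {c r : ℕ} (hc : s.regs 12 = c)
    (hr : s.regs 13 = r) (hq : s.regs 14 < T.D) (hc₀ : 0 < c) (hrw : r + T.p < 2 ^ w)
    (hcw : ∀ x, c + T.wt x < 2 ^ w) :
    Reaches w addLabels τ (fun τ' s' => τ' ≤ τ + (T.p * 33 + 12) ∧ Frame 15 9 s s' ∧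
      (∀ u, u ≠ T.D - s.regs 14 - 1 → s'.mem 9 u = s.mem 9 u) ∧
      ((s'.mem 9 (T.D - s.regs 14 - 1) : ℕ) : ZMod 2) = s.mem 9 (T.D - s.regs 14 - 1) +
        ∑ l ∈ Finset.range T.p, if s.mem 7 l ≠ 0 ∧ c + T.wt (r + l) ≤ T.D - s.regs 14 - 1 then
          (s.mem 9 (T.D - s.regs 14 - 1 - (c + T.wt (r + l))) : ZMod 2) else 0) s := by
  have hDw := hT.D_lt
  have hpw := hT.p_lt
  have h1w : 1 < 2 ^ w := by omega
  apply Reaches.seq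
  apply Reaches.assign
  have hv : (Expr.reg 5 - Expr.reg 14 - Expr.const 1).eval w s = T.D - s.regs 14 - 1 := by
    simp only [Expr.eval_sub, Expr.eval_reg, Expr.eval_const, hs.reg_D]
    rw [Nat.mod_eq_of_lt h1w, Nat.mod_eq_of_lt (a := T.D - s.regs 14) (by omega),
      Nat.mod_eq_of_lt (by omega)]
  rw [hv]
  set v := T.D - s.regs 14 - 1 with hvdef
  apply Reaches.loop T.p 25 (fun k s' => Frame 15 9 s s' ∧ s'.regs 15 = v ∧
      (∀ u, u ≠ v → s'.mem 9 u = s.mem 9 u) ∧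
      ((s'.mem 9 v : ℕ) : ZMod 2) = s.mem 9 v +
        ∑ l ∈ Finset.range k, if s.mem 7 l ≠ 0 ∧ c + T.wt (r + l) ≤ v then
          (s.mem 9 (v - (c + T.wt (r + l))) : ZMod 2) else 0) hT.w_pos (by omega)
  · exact ⟨((Frame.refl 15 9 s).setReg 15 _ (by omega)).setReg 16 _ (by omega), by simp, by simp,
      by simp⟩
  · rintro k s' ⟨hf, -⟩
    rw [Expr.eval_reg, hf.regs 1 (by omega), hs.reg_p]
  · rintro k hk s' τ' ⟨hf, h15, hu, hsum⟩ h16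
    have h7 : (Expr.load 7 (.reg 16)).eval w s' = s.mem 7 k := by
      rw [Expr.eval_load, Expr.eval_reg, h16, hf.mem 7 (by omega)]
    apply Reaches.ite
    · intro h
      rw [h7] at h
      apply Reaches.seq
      apply Reaches.assign
      have hd : (Expr.reg 12 + Expr.load 2 (.reg 13 + .reg 16)).eval w s' = c + T.wt (r + k) := by
        simp only [Expr.eval_add, Expr.eval_reg, Expr.eval_load, h16, hf.regs 12 (by omega),
          hf.regs 13 (by omega), hf.mem 2 (by omega), hs.mem_wt, hc, hr]
        rw [Nat.mod_eq_of_lt (a := r + k) (by omega), Nat.mod_eq_of_lt (hcw _)]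
      rw [hd]
      have hlt := Expr.eval_less_ne_zero hT.w_pos (s'.setReg 17 (c + T.wt (r + k)))
        (.reg 15) (.reg 17)
      simp only [Expr.eval_reg, State.setReg_regs, h15] at hlt
      norm_num at hlt
      apply Reaches.ite
      · intro h'
        have h' := hlt.1 h'
        apply Reaches.skip
        refine ⟨?_, by simpa using h16, ?_, by simpa using h15, by simpa using hu, ?_⟩
        · simp only [Expr.cost_load, Expr.cost_reg, Expr.cost_add, Expr.cost_less]; omega
        · exact (hf.setReg _ _ (by omega)).setReg _ _ (by omega)
        · simp [Finset.sum_range_succ, hsum, h'.not_ge]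
      · intro h'
        have h' : c + T.wt (r + k) ≤ v := by
          by_contra hcon; exact hlt.2 (by omega) h'
        have hvD : v < T.D := by omega
        apply Reaches.store
        simp only [Expr.eval_reg, Expr.eval_add, Expr.eval_sub, Expr.eval_load,
          State.setReg_regs, State.setReg_mem, h15, if_true]
        norm_num
        -- Since `c` is positive, the cell that is read lies strictly below `v` and has not been
        -- modified.
        rw [Nat.mod_eq_of_lt (a := v - (c + T.wt (r + k))) (by omega), hu (v - _) (by omega)]
        refine ⟨?_, h16, ?_, h15, ?_, ?_⟩
        · simp only [Expr.cost_load, Expr.cost_reg, Expr.cost_add, Expr.cost_less, Expr.cost_sub]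
          omega
        · exact ((hf.setReg _ _ (by omega)).setMem _ _ _ (by omega)).setReg _ _ (by omega)
        · intro u huv
          simpa [huv] using hu u huv
        · rw [cast_mod_two_pow hT.w_pos, Nat.cast_add, hsum, Finset.sum_range_succ,
            if_pos (c := ¬s.mem 7 k = 0 ∧ _) ⟨h, h'⟩, add_assoc]
    · intro h
      rw [h7] at h
      apply Reaches.skip
      refine ⟨?_, h16, hf.setReg _ _ (by omega), by simpa using h15, by simpa using hu, ?_⟩
      · simp only [Expr.cost_load, Expr.cost_reg]; omega
      · simp [Finset.sum_range_succ, hsum, h]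
  · rintro τ' s' hτ ⟨hf, h15, hu, hsum⟩
    refine ⟨?_, hf, hu, hsum⟩
    simp only [Expr.cost_reg, Expr.cost_sub, Expr.cost_const] at hτ
    omega

theorem reaches_mulElement (hT : T.Fits w) (hs : T.Stored s) (hi : s.regs 10 < T.m)
    (hj : s.regs 11 < T.len (s.regs 10)) {F : (ZMod 2)[X]} (hF : HasCoeffs s 9 T.D F) :
    Reaches w mulElement τ (fun τ' s' => τ' ≤ τ + (T.D * (T.p * 33 + 20) + 40) ∧
      Frame 12 9 s s' ∧ HasCoeffs s' 9 T.D
        (F * T.pairFactor (s.mem 7) (s.regs 10 * T.p + s.regs 11))) s := by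
  have hDw := hT.D_lt
  have hpw := hT.p_lt
  have h1w : 1 < 2 ^ w := by omega
  have hB := hT.B_pos
  have hpair := hT.pair_lt _ hi _ hj
  have hrep := hT.rep_lt _ hi _ hj
  set i := s.regs 10 with hidef
  set j := s.regs 11 with hjdef
  have hmul : i * T.p + j ≤ (i * T.p + j) * (T.p + 1) := Nat.le_mul_of_pos_right _ (by omega)
  have ha : (Expr.reg 10 * Expr.reg 1 + Expr.reg 11).eval w s = i * T.p + j := by
    simp only [Expr.eval_add, Expr.eval_mul, Expr.eval_reg, hs.reg_p, ← hidef, ← hjdef]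
    rw [Nat.mod_eq_of_lt (a := i * T.p) (by omega), Nat.mod_eq_of_lt (by omega)]
  have hp1 : (Expr.reg 1 + Expr.const 1).eval w s = T.p + 1 := by
    simp only [Expr.eval_add, Expr.eval_const, Expr.eval_reg, hs.reg_p]
    rw [Nat.mod_eq_of_lt h1w, Nat.mod_eq_of_lt (by omega)]
  apply Reaches.seq
  apply Reaches.assign
  rw [Expr.eval_add, Expr.eval_reg, Expr.eval_load, Expr.eval_add, Expr.eval_mul, ha, hp1,
    Expr.eval_reg, hs.reg_p, hs.reg_B, hs.mem_wt, Nat.mod_eq_of_lt (a := _ * _) (by omega),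
    Nat.mod_eq_of_lt hpair, Nat.mod_eq_of_lt ((Nat.le_add_right _ _).trans_lt (hT.cost_lt _ 0))]
  set c := T.B + T.wt ((i * T.p + j) * (T.p + 1) + T.p) with hcdef
  apply Reaches.seq
  apply Reaches.assign
  have ha' : (Expr.reg 10 * Expr.reg 1 + Expr.reg 11).eval w (s.setReg 12 c) = i * T.p + j := by
    rw [← ha]; simp [Expr.eval_add, Expr.eval_mul, Expr.eval_reg]
  have hp1' : (Expr.reg 1 + Expr.const 1).eval w (s.setReg 12 c) = T.p + 1 := by
    rw [← hp1]; simp [Expr.eval_add, Expr.eval_const, Expr.eval_reg]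
  rw [Expr.eval_mul, Expr.eval_load, Expr.eval_load, ha', hp1', State.setReg_mem, hs.mem_el,
    hs.mem_rep, Nat.mod_eq_of_lt (a := _ * _) (by omega)]
  set r := T.rep (T.el (i * T.p + j)) * (T.p + 1) with hrdef
  -- After `q` rounds the top `q` cells hold the new coefficients and all lower cells the old ones.
  apply Reaches.loop T.D (T.p * 33 + 12) (fun q s' => Frame 12 9 s s' ∧ s'.regs 12 = c ∧
      s'.regs 13 = r ∧ (∀ u < T.D - q, s'.mem 9 u = s.mem 9 u) ∧
      ∀ u < T.D, T.D - q ≤ u → (s'.mem 9 u : ZMod 2) =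
        (F * T.pairFactor (s.mem 7) (i * T.p + j)).coeff u) hT.w_pos hDw
  · refine ⟨?_, by simp, by simp, by simp, fun u h₁ h₂ => by omega⟩
    exact (((Frame.refl 12 9 s).setReg 12 _ (by omega)).setReg 13 _ (by omega)).setReg 14 _
      (by omega)
  · rintro k s' ⟨hf, -⟩
    rw [Expr.eval_reg, hf.regs 5 (by omega), hs.reg_D]
  · rintro k hk s' τ' ⟨hf, h12, h13, hlow, hhigh⟩ h14
    refine (reaches_addLabels hT (hs.of_frame hf (by omega) (by omega)) h12 h13 (by omega)
      (by omega) (by omega) (fun x => hT.cost_lt _ x)).mono ?_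
    rw [h14]
    rintro τ'' s'' ⟨hτ, hf', hne, heq⟩
    refine ⟨hτ, (hf'.regs 14 (by omega)).trans h14,
      (hf.trans hf' (by omega) (by omega)).setReg _ _ (by omega), ?_, ?_, ?_, ?_⟩
    · simpa using (hf'.regs 12 (by omega)).trans h12
    · simpa using (hf'.regs 13 (by omega)).trans h13
    · intro u hu
      simpa using (hne u (by omega)).trans (hlow u (by omega))
    · intro u hu hu'
      rw [State.setReg_mem]
      by_cases huv : u = T.D - k - 1
      · rw [← huv] at heq
        rw [heq, coeff_mul_pairFactor, hlow u (by omega), hF u hu]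
        congr 1
        refine Finset.sum_congr rfl fun l _ => ?_
        rw [hf.mem 7 (by omega), show T.cost (i * T.p + j) l = c + T.wt (r + l) from rfl]
        refine if_congr Iff.rfl ?_ rfl
        rw [hlow _ (by omega), hF _ (by omega)]
      · rw [hne u huv]
        exact hhigh u hu (by omega)
  · rintro τ' s' hτ ⟨hf, -, -, -, hhigh⟩
    refine ⟨?_, hf, fun v hv => hhigh v hv (by omega)⟩
    simp only [Expr.cost_reg, Expr.cost_add, Expr.cost_mul, Expr.cost_load,
      Expr.cost_const] at hτ
    rw [show T.p * 33 + 20 = T.p * 33 + 12 + 1 + 7 by ring]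
    omega

/-- A loop that rewrites the entries of one array one by one. -/
theorem reaches_loop_array (hT : T.Fits w) {P : Program} {N a c d : ℕ} {x : ℕ} {e : Expr}
    (hN : N < 2 ^ w) (hd : d ≤ a) (hcx : c ≤ x)
    (he : ∀ s', Frame c d s s' → e.eval w s' = N) (f : ℕ → ZMod 2) (n : ℕ)
    (hP : ∀ q < N, ∀ s' τ, Frame c d s s' → s'.regs x = q →
      (∀ b, b ≠ a → s'.mem b = s.mem b) → s'.mem a q = s.mem a q → Reaches w P τ
        (fun τ' s'' => τ' ≤ τ + n ∧ s''.regs = s'.regs ∧ (∀ b, b ≠ a → s''.mem b = s'.mem b) ∧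
          (∀ u, u ≠ q → s''.mem a u = s'.mem a u) ∧ (s''.mem a q : ZMod 2) = f q) s') :
    Reaches w (.loop x e P) τ (fun τ' s' => τ' ≤ τ + (N * (n + e.cost + 7) + e.cost + 5) ∧
      Frame c d s s' ∧ (∀ b, b ≠ a → s'.mem b = s.mem b) ∧
        (∀ u, N ≤ u → s'.mem a u = s.mem a u) ∧ ∀ u < N, (s'.mem a u : ZMod 2) = f u) s := by
  apply Reaches.loop N n (fun q s' => Frame c d s s' ∧ (∀ b, b ≠ a → s'.mem b = s.mem b) ∧
    (∀ u, q ≤ u → s'.mem a u = s.mem a u) ∧ ∀ u < q, (s'.mem a u : ZMod 2) = f u) hT.w_pos hN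
  · exact ⟨(Frame.refl c d s).setReg _ _ hcx, by simp, by simp, by simp⟩
  · rintro k s' ⟨hf, -⟩
    exact he s' hf
  · rintro k hk s' τ' ⟨hf, hb, hlow, hhigh⟩ hx
    refine (hP k hk s' τ' hf hx hb (hlow k le_rfl)).mono ?_
    rintro τ'' s'' ⟨hτ, hr, hb', hne, heq⟩
    refine ⟨hτ, by rw [hr, hx], ⟨fun r hr' => ?_, fun b hb'' => ?_⟩, fun b hb'' => ?_,
      fun u hu => ?_, fun u hu => ?_⟩
    · have : r ≠ x := by omega
      simp [this, hr, hf.regs r hr']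
    · exact (hb' b (by omega)).trans (hf.mem b hb'')
    · exact (hb' b hb'').trans (hb b hb'')
    · exact (hne u (by omega)).trans (hlow u (by omega))
    · rw [State.setReg_mem]
      by_cases huk : u = k
      · rw [huk, heq]
      · rw [hne u huk, hhigh u (by omega)]
  · rintro τ' s' hτ ⟨hf, hb, hlow, hhigh⟩
    exact ⟨hτ, hf, hb, hlow, hhigh⟩

/-- Array `9` receives a copy of `F` and is multiplied by the factors of the pairs; adding it to
array `8`, shifted by `M`, gives `F + X ^ M * F * ∏`. -/
theorem reaches_mulSet (hT : T.Fits w) (hs : T.Stored s) (hi : s.regs 10 < T.m)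
    {F : (ZMod 2)[X]} (hF : HasCoeffs s 8 T.D F) :
    Reaches w mulSet τ
      (fun τ' s' => τ' ≤ τ + (T.p * (T.D * (T.p * 33 + 20) + 49) + T.D * 36 + 40) ∧
      Frame 11 8 s s' ∧ HasCoeffs s' 8 T.D
        (F * if s.regs 10 + 1 = s.regs 8 then 1 else T.setFactor (s.mem 7) (s.regs 10))) s := by
  have hDw := hT.D_lt
  have hmw := hT.m_lt
  have hpw := hT.p_lt
  have h1w : 1 < 2 ^ w := by omega
  set i := s.regs 10 with hidef
  have hcond := Expr.eval_same_ne_zero hT.w_pos s (.reg 10 + .const 1) (.reg 8)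
  rw [Expr.eval_add, Expr.eval_reg, Expr.eval_const, Expr.eval_reg, Nat.mod_eq_of_lt h1w,
    ← hidef, Nat.mod_eq_of_lt (by omega)] at hcond
  apply Reaches.ite
  · intro h
    rw [hcond] at h
    apply Reaches.skip
    refine ⟨?_, Frame.refl _ _ _, ?_⟩
    · simp only [Expr.cost_same, Expr.cost_reg, Expr.cost_add, Expr.cost_const]
      omega
    · simpa [h] using hF
  · intro h
    have h : i + 1 ≠ s.regs 8 := fun h' => hcond.2 h' h
    rw [if_neg h]
    apply Reaches.seq
    refine (reaches_loop_array (c := 11) (d := 9) (a := 9) hT hDw (by omega) (by omega) ?_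
      (fun v => F.coeff v) 4 ?_).mono ?_
    · intro s' hf
      rw [Expr.eval_reg, hf.regs 5 (by omega), hs.reg_D]
    · intro q hq s' τ' hf hx hb hmem
      apply Reaches.store
      simp only [Expr.cost_load, Expr.cost_reg, Expr.eval_load, Expr.eval_reg, hx]
      refine ⟨by omega, by simp, fun b hb => by simp [hb], fun u hu => by simp [hu], ?_⟩
      simp [hf.mem 8 (by omega), hF q hq]
    rintro τ₁ s₁ ⟨hτ₁, hf₁, hb₁, -, hF₁⟩
    apply Reaches.seq
    have hs₁ := hs.of_frame hf₁ (by omega) (by omega)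
    have hlen := hT.len_le i hi
    refine Reaches.loop (T.len i) (T.D * (T.p * 33 + 20) + 40) (fun k s' => Frame 11 9 s s' ∧
      HasCoeffs s' 9 T.D (F * ∏ j ∈ Finset.range k, T.pairFactor (s.mem 7) (i * T.p + j)))
      hT.w_pos (by omega) ⟨hf₁.setReg _ _ (by omega), by simpa [HasCoeffs] using hF₁⟩ ?_ ?_ ?_
    · rintro k s' ⟨hf, -⟩
      rw [Expr.eval_load, Expr.eval_reg, hf.regs 10 (by omega), hf.mem 3 (by omega), hs.mem_len]
    · rintro k hk s' τ' ⟨hf, hc⟩ h11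
      refine (reaches_mulElement hT (hs.of_frame hf (by omega) (by omega)) ?_ ?_ hc).mono ?_
      · rw [hf.regs 10 (by omega)]; exact hi
      · rw [hf.regs 10 (by omega), h11]; exact hk
      · rintro τ'' s'' ⟨hτ, hf', hc'⟩
        refine ⟨hτ, (hf'.regs 11 (by omega)).trans h11,
          (hf.trans hf' (by omega) (by omega)).setReg _ _ (by omega), ?_⟩
        rw [hf.mem 7 (by omega), hf.regs 10 (by omega), ← hidef, h11] at hc'
        rw [Finset.prod_range_succ, ← mul_assoc]
        exact hc'
    · rintro τ₂ s₂ hτ₂ ⟨hf₂, hF₂⟩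
      refine (reaches_loop_array (c := 11) (d := 8) (a := 8) hT hDw (by omega) (by omega) ?_
        (fun v => (F * T.setFactor (s.mem 7) i).coeff v) 16 ?_).mono ?_
      · intro s' hf
        rw [Expr.eval_reg, hf.regs 5 (by omega), hf₂.regs 5 (by omega), hs.reg_D]
      · intro q hq s' τ' hf hx hb hmem
        have hM : s'.regs 3 = T.M := by
          rw [hf.regs 3 (by omega), hf₂.regs 3 (by omega), hs.reg_M]
        have hlt := Expr.eval_less_ne_zero hT.w_pos s' (.reg 14) (.reg 3)
        simp only [Expr.eval_reg, hM, hx] at hlt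
        have hco : (F * T.setFactor (s.mem 7) i).coeff q = F.coeff q + if T.M ≤ q then
            (F * ∏ j ∈ Finset.range (T.len i),
              T.pairFactor (s.mem 7) (i * T.p + j)).coeff (q - T.M) else 0 := by
          rw [Table.setFactor, mul_add, mul_one, coeff_add, ← mul_assoc, mul_right_comm,
            coeff_mul_X_pow']
        have h8 : (s'.mem 8 q : ZMod 2) = F.coeff q := by
          rw [hmem, hf₂.mem 8 (by omega)]
          exact hF q hq
        apply Reaches.ite
        · intro h'
          have h' := hlt.1 h'
          apply Reaches.skip
          refine ⟨?_, rfl, fun b _ => rfl, fun u _ => rfl, ?_⟩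
          · simp only [Expr.cost_less, Expr.cost_reg]; omega
          · rw [hco, if_neg (by omega), add_zero, h8]
        · intro h'
          have h' : T.M ≤ q := by by_contra hcon; exact hlt.2 (by omega) h'
          apply Reaches.store
          simp only [Expr.cost_load, Expr.cost_reg, Expr.cost_less, Expr.cost_add, Expr.cost_sub,
            Expr.eval_load, Expr.eval_reg, Expr.eval_add, Expr.eval_sub, hx, hM]
          refine ⟨by omega, by simp, fun b hb => by simp [hb], fun u hu => by simp [hu], ?_⟩
          rw [State.setMem_mem, if_pos rfl, Function.update_self, cast_mod_two_pow hT.w_pos,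
            Nat.cast_add, h8, hco, if_pos h', Nat.mod_eq_of_lt (by omega), hb 9 (by omega),
            hF₂ _ (by omega)]
      · rintro τ₃ s₃ ⟨hτ₃, hf₃, -, -, hF₃⟩
        refine ⟨?_, (hf₂.mono le_rfl (by omega)).trans hf₃ le_rfl le_rfl, hF₃⟩
        have h₁ : T.len i * (T.D * (T.p * 33 + 20) + 40 + (1 + 1) + 7) ≤
          T.p * (T.D * (T.p * 33 + 20) + 49) := Nat.mul_le_mul_right _ hlen
        simp only [Expr.cost_load, Expr.cost_reg, Expr.cost_same, Expr.cost_add,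
          Expr.cost_const] at hτ₁ hτ₂ hτ₃
        omega

end inner

open Polynomial

/-! ### Products over all sets and their sum over all sets of labels -/

section outer

variable {w : ℕ} {T : Table} {s : State} {τ : ℕ}

/-- A bound for the time that `mulSet` takes. -/
def mulSetTime (T : Table) : ℕ := T.p * (T.D * (T.p * 33 + 20) + 49) + T.D * 36 + 40

theorem reaches_mulSets (hT : T.Fits w) (hs : T.Stored s) :
    Reaches w mulSets τ
      (fun τ' s' => τ' ≤ τ + (T.m * (mulSetTime T + 8) + T.D * 11 + 15) ∧
        Frame 10 8 s s' ∧ HasCoeffs s' 8 T.D (T.product (s.mem 7) (s.regs 8))) s := by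
  have hDw := hT.D_lt
  have hD := hT.D_pos
  have hmw := hT.m_lt
  have h1w : 1 < 2 ^ w := by omega
  apply Reaches.seq
  refine (reaches_loop_array (c := 10) (d := 8) (a := 8) hT hDw (by omega) (by omega) ?_
    (fun v => 0) 3 ?_).mono ?_
  · intro s' hf
    rw [Expr.eval_reg, hf.regs 5 (by omega), hs.reg_D]
  · intro q hq s' τ' hf hx hb hmem
    apply Reaches.store
    simp only [Expr.cost_const, Expr.cost_reg, Expr.eval_const, Expr.eval_reg, hx]
    exact ⟨by omega, by simp, fun b hb => by simp [hb], fun u hu => by simp [hu], by simp⟩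
  rintro τ₁ s₁ ⟨hτ₁, hf₁, -, -, hF₁⟩
  apply Reaches.seq
  apply Reaches.store
  rw [Expr.eval_const, Expr.eval_const, Nat.zero_mod, Nat.mod_eq_of_lt h1w]
  refine Reaches.loop T.m (mulSetTime T) (fun k s' => Frame 10 8 s s' ∧
    HasCoeffs s' 8 T.D (∏ i ∈ Finset.range k,
      if i + 1 = s.regs 8 then 1 else T.setFactor (s.mem 7) i)) hT.w_pos (by omega)
    ⟨(hf₁.setMem _ _ _ (by omega)).setReg _ _ (by omega), ?_⟩ ?_ ?_ ?_
  · intro v hv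
    rcases eq_or_ne v 0 with rfl | h
    · simp
    · simpa [h, coeff_one] using hF₁ v hv
  · rintro k s' ⟨hf, -⟩
    rw [Expr.eval_reg, hf.regs 0 (by omega), hs.reg_m]
  · rintro k hk s' τ' ⟨hf, hc⟩ h10
    refine (reaches_mulSet hT (hs.of_frame hf (by omega) (by omega)) (by omega) hc).mono ?_
    rintro τ'' s'' ⟨hτ, hf', hc'⟩
    refine ⟨hτ, (hf'.regs 10 (by omega)).trans h10,
      (hf.trans hf' (by omega) (by omega)).setReg _ _ (by omega), ?_⟩
    rw [hf.mem 7 (by omega), hf.regs 8 (by omega), h10] at hc'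
    rw [Finset.prod_range_succ]
    exact hc'
  · rintro τ₂ s₂ hτ₂ ⟨hf₂, hF₂⟩
    refine ⟨?_, hf₂, hF₂⟩
    simp only [Expr.cost_reg, Expr.cost_const] at hτ₁ hτ₂
    have : T.m * (mulSetTime T + 1 + 7) = T.m * (mulSetTime T + 8) := rfl
    omega

/-- Incrementing the binary counter. -/
theorem reaches_nextLabels (hT : T.Fits w) (hs : T.Stored s) {x : ℕ} (hx : x < 2 ^ T.p)
    (h7 : ∀ l < T.p, s.mem 7 l = x / 2 ^ l % 2) :
    Reaches w nextLabels τ (fun τ' s' => τ' ≤ τ + (T.p * 22 + 10) ∧ Frame 9 7 s s' ∧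
      s'.regs 9 = (x + 1) / 2 ^ T.p ∧ ∀ l < T.p, s'.mem 7 l = (x + 1) / 2 ^ l % 2) s := by
  have hpw := hT.p_lt
  have hmw := hT.m_lt
  have h1w : 1 < 2 ^ w := by omega
  have h2w : 2 ≤ 2 ^ w := h1w
  apply Reaches.seq
  apply Reaches.assign
  rw [Expr.eval_const, Nat.mod_eq_of_lt h1w]
  -- For `p = 0` words of a single bit are not excluded, and in these the constant `2` would be `0`;
  -- but then the loop body is never executed.
  rcases Nat.eq_zero_or_pos T.p with hp | hp
  · refine Reaches.loop 0 0 (fun k s' => Frame 9 7 s s' ∧ s'.regs 9 = 1) hT.w_pos (by omega)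
      ⟨((Frame.refl 9 7 s).setReg 9 _ (by omega)).setReg 14 _ (by omega), by simp⟩ ?_ ?_ ?_
    · rintro k s' ⟨hf, -⟩
      rw [Expr.eval_reg, hf.regs 1 (by omega), hs.reg_p, hp]
    · intro k hk; omega
    · rintro τ' s' hτ ⟨hf, h⟩
      rw [hp] at hx ⊢
      simp only [Expr.cost_const, Expr.cost_reg] at hτ
      refine ⟨by omega, hf, ?_, by simp⟩
      rw [h, pow_zero, Nat.div_one]
      rw [pow_zero] at hx
      omega
  have h4w : 4 ≤ 2 ^ w := by
    have : 2 ^ 2 ≤ 2 ^ w := by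
      apply Nat.pow_le_pow_right (by omega)
      by_contra hcon
      have : w = 1 := by have := hT.w_pos; omega
      subst this
      omega
    omega
  -- The carry is exactly the difference between `(x + 1) / 2 ^ k` and `x / 2 ^ k`.
  refine Reaches.loop T.p 14 (fun k s' => Frame 9 7 s s' ∧
    s'.regs 9 + x / 2 ^ k = (x + 1) / 2 ^ k ∧ s'.regs 9 ≤ 1 ∧
    (∀ l < k, s'.mem 7 l = (x + 1) / 2 ^ l % 2) ∧
    ∀ l < T.p, k ≤ l → s'.mem 7 l = x / 2 ^ l % 2) hT.w_pos (by omega) ?_ ?_ ?_ ?_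
  · refine ⟨((Frame.refl 9 7 s).setReg 9 _ (by omega)).setReg 14 _ (by omega), ?_, by simp,
      by simp, fun l hl _ => by simpa using h7 l hl⟩
    simp [add_comm]
  · rintro k s' ⟨hf, -⟩
    rw [Expr.eval_reg, hf.regs 1 (by omega), hs.reg_p]
  · rintro k hk s' τ' ⟨hf, h9, h9', hlow, hhigh⟩ h14
    have hk7 := hhigh k hk le_rfl
    set c := s'.regs 9 with hc
    set b := x / 2 ^ k with hb
    apply Reaches.seq
    apply Reaches.assign
    rw [Expr.eval_add, Expr.eval_load, Expr.eval_reg, Expr.eval_reg, ← hc, h14, hk7,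
      Nat.mod_eq_of_lt (a := b % 2 + c) (by omega)]
    apply Reaches.seq
    apply Reaches.store
    apply Reaches.assign
    have h2 : 2 % 2 ^ w = 2 := Nat.mod_eq_of_lt (by omega)
    simp only [Expr.eval_mod, Expr.eval_div, Expr.eval_reg, Expr.eval_const,
      State.setReg_regs, State.setMem_regs, h2, if_true, Expr.cost_load, Expr.cost_add,
      Expr.cost_reg, Expr.cost_div, Expr.cost_mod, Expr.cost_const]
    rw [Nat.mod_eq_of_lt (a := (b % 2 + c) % 2) (by omega),
      Nat.mod_eq_of_lt (a := (b % 2 + c) / 2) (by omega)]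
    refine ⟨by omega, by simpa using h14, ?_, ?_, ?_, ?_, ?_⟩
    · exact (((hf.setReg _ _ (by omega)).setMem _ _ _ (by omega)).setReg _ _ (by omega)).setReg
        _ _ (by omega)
    · norm_num
      rw [pow_succ, ← Nat.div_div_eq_div_mul, ← Nat.div_div_eq_div_mul, ← hb, ← h9]
      omega
    · norm_num
      omega
    · intro l hl
      simp only [State.setReg_mem, State.setMem_mem, if_true, h14]
      norm_num
      by_cases hlk : l = k
      · subst hlk
        rw [Function.update_self, ← h9]
        omega
      · simpa [h14, hlk] using hlow l (by omega)
    · intro l hl hl'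
      have : l ≠ k := by omega
      simpa [h14, this] using hhigh l hl (by omega)
  · rintro τ' s' hτ ⟨hf, h9, -, hlow, -⟩
    simp only [Expr.cost_const, Expr.cost_reg] at hτ
    refine ⟨by omega, hf, ?_, hlow⟩
    rwa [Nat.div_eq_of_lt hx, add_zero] at h9

/-- The cells of array `7` from `p` on are left unspecified; this lemma makes them irrelevant. -/
theorem product_congr {χ χ' : ℕ → ℕ} (h : ∀ l < T.p, χ l = χ' l) (k : ℕ) :
    T.product χ k = T.product χ' k := by
  have : T.pairFactor χ = T.pairFactor χ' := by
    ext1 a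
    unfold Table.pairFactor
    congr 1
    exact Finset.sum_congr rfl fun l hl => by rw [h l (Finset.mem_range.1 hl)]
  simp only [Table.product, Table.setFactor, this]

/-- A bound for the time that `addProduct` takes. -/
def addProductTime (T : Table) : ℕ :=
  T.m * (mulSetTime T + 8) + T.D * 26 + T.p * 22 + 40

theorem reaches_addProduct (hT : T.Fits w) (hs : T.Stored s) {x : ℕ} (hx : x < 2 ^ T.p)
    (h7 : ∀ l < T.p, s.mem 7 l = x / 2 ^ l % 2) {F : (ZMod 2)[X]} (hF : HasCoeffs s 6 T.D F) :
    Reaches w addProduct τ (fun τ' s' => τ' ≤ τ + addProductTime T ∧ Frame 9 6 s s' ∧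
      s'.regs 9 = (x + 1) / 2 ^ T.p ∧ (∀ l < T.p, s'.mem 7 l = (x + 1) / 2 ^ l % 2) ∧
      HasCoeffs s' 6 T.D (F + T.product (fun l => x / 2 ^ l % 2) (s.regs 8))) s := by
  have hDw := hT.D_lt
  apply Reaches.seq
  refine (reaches_mulSets hT hs).mono ?_
  rintro τ₁ s₁ ⟨hτ₁, hf₁, hF₁⟩
  rw [product_congr h7] at hF₁
  apply Reaches.seq
  refine (reaches_loop_array (c := 9) (d := 6) (a := 6) hT hDw (by omega) (by omega) ?_
    (fun v => (F + T.product (fun l => x / 2 ^ l % 2) (s.regs 8)).coeff v) 7 ?_).mono ?_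
  · intro s' hf
    rw [Expr.eval_reg, hf.regs 5 (by omega), hf₁.regs 5 (by omega), hs.reg_D]
  · intro q hq s' τ' hf hx hb hmem
    apply Reaches.store
    simp only [Expr.cost_load, Expr.cost_add, Expr.cost_reg, Expr.eval_load, Expr.eval_add,
      Expr.eval_reg, hx]
    refine ⟨by omega, by simp, fun b hb => by simp [hb], fun u hu => by simp [hu], ?_⟩
    rw [State.setMem_mem, if_pos rfl, Function.update_self, cast_mod_two_pow hT.w_pos,
      Nat.cast_add, coeff_add, hmem, hb 8 (by omega), hF₁ q hq, hf₁.mem 6 (by omega), hF q hq]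
  rintro τ₂ s₂ ⟨hτ₂, hf₂, hb₂, -, hF₂⟩
  have hf₁₂ := (hf₁.mono (by omega : 9 ≤ 10) (by omega : 6 ≤ 8)).trans hf₂ le_rfl le_rfl
  refine (reaches_nextLabels hT (hs.of_frame hf₁₂ (by omega) (by omega)) hx fun l hl => ?_).mono ?_
  · rw [hb₂ 7 (by omega), hf₁.mem 7 (by omega), h7 l hl]
  rintro τ₃ s₃ ⟨hτ₃, hf₃, h9, h7'⟩
  refine ⟨?_, hf₁₂.trans hf₃ (by omega) (by omega), h9, h7', fun v hv => ?_⟩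
  · simp only [Expr.cost_reg] at hτ₂
    unfold addProductTime
    omega
  · rw [hf₃.mem 6 (by omega)]
    exact hF₂ v hv

/-- A bound for the time that `sumProducts` takes. -/
def sumProductsTime (T : Table) : ℕ :=
  2 ^ T.p * (addProductTime T + 4) + T.D * 11 + T.p * 11 + 20

theorem reaches_sumProducts (hT : T.Fits w) (hs : T.Stored s) :
    Reaches w sumProducts τ (fun τ' s' => τ' ≤ τ + sumProductsTime T ∧ Frame 9 6 s s' ∧
      HasCoeffs s' 6 T.D (T.total (s.regs 8))) s := by
  have hDw := hT.D_lt
  have hpw := hT.p_lt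
  have h1w : 1 < 2 ^ w := by omega
  apply Reaches.seq
  refine (reaches_loop_array (c := 9) (d := 6) (a := 6) hT hDw (by omega) (by omega) ?_
    (fun v => 0) 3 ?_).mono ?_
  · intro s' hf
    rw [Expr.eval_reg, hf.regs 5 (by omega), hs.reg_D]
  · intro q hq s' τ' hf hx hb hmem
    apply Reaches.store
    simp only [Expr.cost_const, Expr.cost_reg, Expr.eval_const, Expr.eval_reg, hx]
    exact ⟨by omega, by simp, fun b hb => by simp [hb], fun u hu => by simp [hu], by simp⟩
  rintro τ₁ s₁ ⟨hτ₁, hf₁, -, -, hF₁⟩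
  have hs₁ := hs.of_frame hf₁ (by omega) (by omega)
  apply Reaches.seq
  refine Reaches.loop T.p 3 (fun k s' => Frame 9 6 s s' ∧ s'.mem 6 = s₁.mem 6 ∧
    ∀ l < k, s'.mem 7 l = 0) hT.w_pos (by omega)
    ⟨hf₁.setReg _ _ (by omega), rfl, by simp⟩ ?_ ?_ ?_
  · rintro k s' ⟨hf, -⟩
    rw [Expr.eval_reg, hf.regs 1 (by omega), hs.reg_p]
  · rintro k hk s' τ' ⟨hf, h6, h7⟩ h14
    apply Reaches.store
    simp only [Expr.cost_const, Expr.cost_reg, Expr.eval_const, Expr.eval_reg, h14]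
    refine ⟨by omega, by simpa using h14, (hf.setMem _ _ _ (by omega)).setReg _ _ (by omega),
      by simpa using h6, fun l hl => ?_⟩
    by_cases hlk : l = k
    · simp [hlk]
    · simpa [hlk] using h7 l (by omega)
  rintro τ₂ s₂ hτ₂ ⟨hf₂, h6, h7⟩
  apply Reaches.seq
  apply Reaches.assign
  rw [Expr.eval_const, Nat.zero_mod]
  have hcond (s' : State) : ((Expr.reg 9).same (.const 0)).eval w s' ≠ 0 ↔ s'.regs 9 = 0 := by
    rw [Expr.eval_same_ne_zero hT.w_pos, Expr.eval_reg, Expr.eval_const, Nat.zero_mod]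
  -- The carry out of the counter is `x / 2 ^ p`, which first becomes nonzero after all `2 ^ p` sets
  -- of labels have been processed.
  refine Reaches.whileLoop (2 ^ T.p) (addProductTime T) (fun x s' => Frame 9 6 s s' ∧
    s'.regs 9 = x / 2 ^ T.p ∧ (∀ l < T.p, s'.mem 7 l = x / 2 ^ l % 2) ∧
    HasCoeffs s' 6 T.D (∑ y ∈ Finset.range x, T.product (fun l => y / 2 ^ l % 2) (s.regs 8)))
    ⟨hf₂.setReg _ _ (by omega), by simp, fun l hl => by simpa using h7 l hl, ?_⟩ ?_ ?_ ?_
  · intro v hv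
    simpa [h6] using hF₁ v hv
  · rintro x hx s' τ' ⟨hf, h9, h7, hF⟩
    refine ⟨?_, ?_⟩
    · rw [hcond, h9, Nat.div_eq_of_lt hx]
    · refine (reaches_addProduct hT (hs.of_frame hf (by omega) (by omega)) hx h7 hF).mono ?_
      rintro τ'' s'' ⟨hτ, hf', h9', h7', hF'⟩
      refine ⟨hτ, hf.trans hf' le_rfl le_rfl, h9', h7', ?_⟩
      rw [Finset.sum_range_succ, ← hf.regs 8 (by omega)]
      rwa [hf.regs 8 (by omega)] at hF' ⊢
  · rintro s' ⟨-, h9, -⟩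
    by_contra h
    rw [← ne_eq, hcond, h9, Nat.div_self (by positivity)] at h
    omega
  · rintro τ₃ s₃ hτ₃ ⟨hf₃, -, -, hF₃⟩
    refine ⟨?_, hf₃, hF₃⟩
    simp only [Expr.cost_reg, Expr.cost_const, Expr.cost_same] at hτ₁ hτ₂ hτ₃
    unfold sumProductsTime
    have : 2 ^ T.p * (addProductTime T + (1 + 1 + 1) + 1) = 2 ^ T.p * (addProductTime T + 4) :=
      rfl
    omega

end outer

open Polynomial

/-- `v` is the least degree below `D` at which `F` has a nonzero coefficient. -/
def IsLeastDegree (D : ℕ) (F : (ZMod 2)[X]) (v : ℕ) : Prop :=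
  v < D ∧ F.coeff v ≠ 0 ∧ ∀ u < v, F.coeff u = 0

/-! ### Least degree and the test of each set -/

section runs

variable {w : ℕ} {T : Table} {s : State} {τ : ℕ}

theorem mod_two_eq_zero_iff {x : ℕ} {c : ZMod 2} (h : (x : ZMod 2) = c) : x % 2 = 0 ↔ c = 0 := by
  rw [← h, ZMod.natCast_eq_zero_iff, Nat.dvd_iff_mod_eq_zero]

theorem eval_load_mod_two (hw : 2 < 2 ^ w) (a r : ℕ) :
    (Expr.load a (.reg r) % .const 2).eval w s = s.mem a (s.regs r) % 2 := by
  rw [Expr.eval_mod, Expr.eval_load, Expr.eval_reg, Expr.eval_const, Nat.mod_eq_of_lt hw,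
    Nat.mod_eq_of_lt (by omega)]

/-- The loop descends and every odd entry overwrites the previous find, so the least one survives.
-/
theorem reaches_findLeast (hT : T.Fits w) (hw : 2 < 2 ^ w) (hs : T.Stored s) (h6 : s.regs 6 = 0)
    {F : (ZMod 2)[X]} (hF : HasCoeffs s 6 T.D F) :
    Reaches w findLeast τ (fun τ' s' => τ' ≤ τ + (T.D * 30 + 6) ∧ T.Stored s' ∧
      s'.mem 1 = s.mem 1 ∧ s'.regs 8 = s.regs 8 ∧
      ((∀ v < T.D, F.coeff v = 0) → s'.regs 6 = 0) ∧
      ∀ v, IsLeastDegree T.D F v → s'.regs 6 = 1 ∧ s'.regs 7 = v) s := by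
  have hDw := hT.D_lt
  have h1w : 1 < 2 ^ w := by omega
  refine Reaches.loop T.D 22 (fun q s' => Frame 6 10 s s' ∧ s'.regs 8 = s.regs 8 ∧
    ((∀ v < T.D, T.D - q ≤ v → F.coeff v = 0) → s'.regs 6 = 0) ∧
    ∀ v < T.D, T.D - q ≤ v → F.coeff v ≠ 0 → (∀ u < v, T.D - q ≤ u → F.coeff u = 0) →
      s'.regs 6 = 1 ∧ s'.regs 7 = v) hT.w_pos hDw
    ⟨(Frame.refl 6 10 s).setReg _ _ (by omega), by simp, by simp [h6],
      fun v hv hv' => by omega⟩ ?_ ?_ ?_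
  · rintro k s' ⟨hf, -⟩
    rw [Expr.eval_reg, hf.regs 5 (by omega), hs.reg_D]
  · rintro k hk s' τ' ⟨hf, h8, hnone, hleast⟩ h14
    apply Reaches.seq
    apply Reaches.assign
    rw [Expr.eval_sub, Expr.eval_sub, Expr.eval_reg, Expr.eval_reg, Expr.eval_const,
      Nat.mod_eq_of_lt h1w, hf.regs 5 (by omega), hs.reg_D, h14,
      Nat.mod_eq_of_lt (a := T.D - k) (by omega), Nat.mod_eq_of_lt (by omega)]
    have hco := mod_two_eq_zero_iff (hF (T.D - k - 1) (by omega))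
    have hev : (Expr.load 6 (.reg 15) % .const 2).eval w (s'.setReg 15 (T.D - k - 1)) =
        s.mem 6 (T.D - k - 1) % 2 := by
      rw [eval_load_mod_two hw]
      simp [hf.mem 6]
    apply Reaches.ite
    · intro h
      rw [hev, ne_eq, hco] at h
      apply Reaches.seq
      apply Reaches.assign
      apply Reaches.assign
      simp only [Expr.eval_const, Expr.eval_reg, Nat.mod_eq_of_lt h1w, Expr.cost_sub,
        Expr.cost_reg, Expr.cost_const, Expr.cost_load, Expr.cost_mod]
      refine ⟨by omega, by simpa using h14, ?_, by simpa using h8, fun hn => ?_, ?_⟩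
      · exact (((hf.setReg _ _ (by omega)).setReg _ _ (by omega)).setReg _ _ (by omega)).setReg _ _
          (by omega)
      · exact absurd (hn (T.D - k - 1) (by omega) (by omega)) h
      · intro v hv hv' hvc hvm
        obtain rfl : v = T.D - k - 1 := by
          by_contra hne
          exact h (hvm (T.D - k - 1) (by omega) (by omega))
        simp
    · intro h
      rw [hev, hco] at h
      apply Reaches.skip
      simp only [Expr.cost_sub,
        Expr.cost_reg, Expr.cost_const, Expr.cost_load, Expr.cost_mod]
      refine ⟨by omega, by simpa using h14, ?_, by simpa using h8, fun hn => ?_, ?_⟩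
      · exact (hf.setReg _ _ (by omega)).setReg _ _ (by omega)
      · simpa using hnone fun v hv hv' => hn v hv (by omega)
      · intro v hv hv' hvc hvm
        have hne : v ≠ T.D - k - 1 := by rintro rfl; exact hvc h
        simpa using hleast v hv (by omega) hvc fun u hu hu' => hvm u hu (by omega)
  · rintro τ' s' hτ ⟨hf, h8, hnone, hleast⟩
    simp only [Expr.cost_reg] at hτ
    refine ⟨by omega, hs.of_frame hf (by omega) (by omega), hf.mem 1 (by omega), h8,
      fun hn => hnone fun v hv _ => hn v hv, fun v hv => ?_⟩
    exact hleast v hv.1 (by omega) hv.2.1 fun u hu _ => hv.2.2 u hu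

theorem Table.Stored.setReg (hs : T.Stored s) (x v : ℕ) (hx : 6 ≤ x) : T.Stored (s.setReg x v) :=
  hs.of_frame ((Frame.refl 6 6 s).setReg x v hx) le_rfl le_rfl

theorem Table.Stored.setMem_one (hs : T.Stored s) (i v : ℕ) : T.Stored (s.setMem 1 i v) :=
  { hs with
    mem_wt := by simpa using hs.mem_wt
    mem_len := by simpa using hs.mem_len
    mem_el := by simpa using hs.mem_el
    mem_rep := by simpa using hs.mem_rep }

/-- A bound for the time of all runs. -/
def runsTime (T : Table) : ℕ := (T.m + 1) * (sumProductsTime T + T.D * 30 + 40) + 12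

/-- The runs of the algorithm on a stored table. -/
theorem reaches_runs (hT : T.Fits w) (hw : 2 < 2 ^ w) (hs : T.Stored s) (h6 : s.regs 6 = 0) :
    Reaches w (.seq (.loop 8 (.reg 0 + .const 1) run) (.store 1 (.const 0) (.reg 6))) τ
      (fun τ' s' => τ' ≤ τ + runsTime T ∧
      ((∀ v < T.D, (T.total 0).coeff v = 0) → s'.mem 1 0 = 0) ∧
      ∀ v, IsLeastDegree T.D (T.total 0) v → s'.mem 1 0 = 1 ∧
        ∀ i < T.m, s'.mem 1 (i + 1) = 1 ↔ (T.total (i + 1)).coeff v = 0) s := by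
  have hmw := hT.m_lt
  have h1w : 1 < 2 ^ w := by omega
  apply Reaches.seq
  -- The least degree is available only from run `1` on, and after `k` runs the output cells `1, …,
  -- k - 1` are final.
  refine Reaches.loop (T.m + 1) (sumProductsTime T + T.D * 30 + 25) (fun k s' => T.Stored s' ∧
    (k = 0 → s'.regs 6 = 0) ∧
    ((∀ v < T.D, (T.total 0).coeff v = 0) → s'.regs 6 = 0) ∧
    ∀ v, IsLeastDegree T.D (T.total 0) v → (k ≠ 0 → s'.regs 6 = 1 ∧ s'.regs 7 = v) ∧
      ∀ i, i + 1 < k → (s'.mem 1 (i + 1) = 1 ↔ (T.total (i + 1)).coeff v = 0)) hT.w_pos hmw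
    ⟨hs.setReg _ _ (by omega), by simp [h6], by simp [h6], by simp⟩ ?_ ?_ ?_
  · rintro k s' ⟨hs', -⟩
    rw [Expr.eval_add, Expr.eval_reg, Expr.eval_const, Nat.mod_eq_of_lt h1w, hs'.reg_m,
      Nat.mod_eq_of_lt hmw]
  · rintro k hk s' τ' ⟨hs', hzero, hnone, hleast⟩ h8
    apply Reaches.seq
    refine (reaches_sumProducts hT hs').mono ?_
    rintro τ₁ s₁ ⟨hτ₁, hf₁, hF₁⟩
    rw [h8] at hF₁
    have hs₁ := hs'.of_frame hf₁ (by omega) (by omega)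
    have h8₁ : s₁.regs 8 = k := (hf₁.regs 8 (by omega)).trans h8
    have hcond : ((Expr.reg 8).same (.const 0)).eval w s₁ ≠ 0 ↔ k = 0 := by
      rw [Expr.eval_same_ne_zero hT.w_pos, Expr.eval_reg, Expr.eval_const, Nat.zero_mod, h8₁]
    apply Reaches.ite
    · intro h
      rw [hcond] at h
      subst h
      refine (reaches_findLeast hT hw hs₁ ((hf₁.regs 6 (by omega)).trans (hzero rfl)) hF₁).mono ?_
      rintro τ₂ s₂ ⟨hτ₂, hs₂, -, h8₂, hnone₂, hleast₂⟩
      refine ⟨?_, h8₂.trans h8₁, hs₂.setReg _ _ (by omega), by simp, by simpa using hnone₂,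
        fun v hv => ⟨fun _ => by simpa using hleast₂ v hv, fun i hi => by omega⟩⟩
      simp only [Expr.cost_same, Expr.cost_reg, Expr.cost_const] at hτ₂
      omega
    · intro h
      have h : k ≠ 0 := fun h' => hcond.2 h' h
      apply Reaches.store
      rw [Expr.eval_reg, Expr.eval_sub, Expr.eval_const, Nat.mod_eq_of_lt h1w,
        eval_load_mod_two hw, h8₁, Nat.mod_eq_of_lt (by omega)]
      refine ⟨?_, by simpa using h8₁, (hs₁.setMem_one _ _).setReg _ _ (by omega), by simp,
        fun hn => ?_, fun v hv => ⟨fun _ => ?_, fun i hi => ?_⟩⟩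
      · simp only [Expr.cost_same, Expr.cost_reg, Expr.cost_const, Expr.cost_sub, Expr.cost_load,
          Expr.cost_mod]
        omega
      · simpa [hf₁.regs 6] using hnone hn
      · simpa [hf₁.regs 6, hf₁.regs 7] using (hleast v hv).1 h
      · have h7 : s₁.regs 7 = v := (hf₁.regs 7 (by omega)).trans ((hleast v hv).1 h).2
        by_cases hik : i + 1 = k
        · rw [State.setReg_mem, State.setMem_mem, if_pos rfl, hik, Function.update_self, h7,
            ← mod_two_eq_zero_iff (hF₁ v hv.1)]
          omega
        · simpa [hik, hf₁.mem 1] using (hleast v hv).2 i (by omega)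
  · rintro τ₁ s₁ hτ₁ ⟨hs₁, -, hnone, hleast⟩
    apply Reaches.store
    rw [Expr.eval_const, Nat.zero_mod, Expr.eval_reg]
    refine ⟨?_, fun hn => by simpa using hnone hn, fun v hv => ⟨?_, fun i hi => ?_⟩⟩
    · simp only [Expr.cost_reg, Expr.cost_const, Expr.cost_add] at hτ₁ ⊢
      unfold runsTime
      have : (T.m + 1) * (sumProductsTime T + T.D * 30 + 25 + (1 + 1 + 1) + 7) ≤
        (T.m + 1) * (sumProductsTime T + T.D * 30 + 40) := Nat.mul_le_mul_left _ (by omega)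
      omega
    · simpa using ((hleast v hv).1 (by omega)).1
    · simpa using (hleast v hv).2 i (by omega)

end runs

end PartialCover

end WordRAM

/-! ### Random weights and input -/

namespace WordRAM

namespace PartialCover

/-- The number whose binary digits are `b` coins from position `o` on. -/
def coinValue (coins : ℕ → Bool) (o : ℕ) : ℕ → ℕ
  | 0 => 0
  | b + 1 => coinValue coins o b + coinValue coins o b + (coins (o + b)).toNat

theorem coinValue_lt (coins : ℕ → Bool) (o b : ℕ) : coinValue coins o b < 2 ^ b := by
  induction b with
  | zero => simp [coinValue]
  | succ b ih =>
    have := Bool.toNat_le (coins (o + b))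
    rw [coinValue, pow_succ]
    omega

/-! ### Drawing the random weights -/

section setup

variable {w : ℕ} {s : State} {τ : ℕ} {coins : ℕ → Bool}

theorem reaches_drawWeight {b o : ℕ} (hb : 2 ^ b < 2 ^ w) (h2 : s.regs 2 = 2 ^ b)
    (hc : ∀ i, s.coins i = coins (o + i)) :
    Reaches w drawWeight τ (fun τ' s' => τ' ≤ τ + (b * 15 + 11) ∧ Frame 9 2 s s' ∧
      (∀ i, s'.coins i = coins (o + b + i)) ∧ (∀ a, a ≠ 2 → s'.mem a = s.mem a) ∧
      s'.mem 2 = Function.update (s.mem 2) (s.regs 8) (coinValue coins o b)) s := by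
  have hw : 0 < w := (Nat.zero_le b).trans_lt ((Nat.pow_lt_pow_iff_right (by omega)).1 hb)
  have h1w : 1 < 2 ^ w := Nat.one_lt_two_pow hw.ne'
  apply Reaches.seq
  apply Reaches.assign
  apply Reaches.seq
  apply Reaches.assign
  rw [Expr.eval_const, Expr.eval_const, Nat.zero_mod, Nat.mod_eq_of_lt h1w]
  apply Reaches.seq
  have hcond (s' : State) (t : ℕ) (h : s'.regs 10 = 2 ^ t) (h2' : s'.regs 2 = 2 ^ b) :
      ((Expr.reg 10).less (.reg 2)).eval w s' ≠ 0 ↔ t < b := by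
    rw [Expr.eval_less_ne_zero hw, Expr.eval_reg, Expr.eval_reg, h, h2',
      Nat.pow_lt_pow_iff_right (by omega)]
  refine Reaches.whileLoop b 11 (fun t s' => Frame 9 2 s s' ∧ s'.mem = s.mem ∧
    s'.regs 10 = 2 ^ t ∧ s'.regs 9 = coinValue coins o t ∧ ∀ i, s'.coins i = coins (o + t + i))
    ⟨((Frame.refl 9 2 s).setReg _ _ (by omega)).setReg _ _ (by omega), rfl, by simp,
      by simp [coinValue], by simpa using hc⟩ ?_ ?_ ?_
  · rintro t ht s' τ' ⟨hf, hm, h10, h9, hc'⟩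
    refine ⟨(hcond s' t h10 ((hf.regs 2 (by omega)).trans h2)).2 ht, ?_⟩
    have hlt := coinValue_lt coins o t
    have hbit := Bool.toNat_le (coins (o + t))
    have hpow : 2 ^ (t + 1) ≤ 2 ^ b := Nat.pow_le_pow_right (by omega) ht
    rw [pow_succ] at hpow
    apply Reaches.seq
    apply Reaches.flip
    apply Reaches.seq
    apply Reaches.assign
    apply Reaches.assign
    have hc0 : s'.coins 0 = coins (o + t) := hc' 0
    simp only [Expr.eval_add, Expr.eval_reg, State.setReg_regs, Expr.cost_add, Expr.cost_reg]
    norm_num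
    rw [h9, h10, hc0, Nat.mod_eq_of_lt (by omega), Nat.mod_eq_of_lt (by omega)]
    refine ⟨?_, hm, ?_, ?_, ?_⟩
    · refine Frame.setReg (Frame.setReg ?_ _ _ (by omega)) _ _ (by omega)
      exact ⟨(hf.setReg 11 _ (by omega)).regs, hf.mem⟩
    · rw [pow_succ]; omega
    · rw [coinValue]
    · intro i
      rw [hc' (i + 1)]
      congr 1
      omega
  · rintro s' ⟨hf, -, h10, -⟩
    by_contra h
    exact absurd ((hcond s' b h10 ((hf.regs 2 (by omega)).trans h2)).1 h) (lt_irrefl _)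
  · rintro τ' s' hτ ⟨hf, hm, h10, h9, hc'⟩
    apply Reaches.store
    simp only [Expr.cost_less, Expr.cost_reg, Expr.cost_const, Expr.eval_reg] at hτ ⊢
    refine ⟨by omega, hf.setMem _ _ _ (by omega), by simpa using hc', fun a ha => ?_, ?_⟩
    · simp [ha, hm]
    · simp [hm, h9, hf.regs 8]

theorem eval_numWeights {m p : ℕ} (h0 : s.regs 0 = m) (h1 : s.regs 1 = p)
    (hw : 0 < w) (hG : m * p * (p + 1) < 2 ^ w) (hp : p + 1 < 2 ^ w) :
    numWeights.eval w s = m * p * (p + 1) := by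
  have h1w : 1 < 2 ^ w := Nat.one_lt_two_pow hw.ne'
  have : m * p ≤ m * p * (p + 1) := Nat.le_mul_of_pos_right _ (by omega)
  rw [numWeights, Expr.eval_mul, Expr.eval_mul, Expr.eval_add, Expr.eval_const, Expr.eval_reg,
    Expr.eval_reg, h0, h1, Nat.mod_eq_of_lt h1w, Nat.mod_eq_of_lt (a := m * p) (by omega),
    Nat.mod_eq_of_lt hp, Nat.mod_eq_of_lt hG]

/-- Weight `k` consumes the block of `b` coins from `k * b` on, whatever their outcomes; the weights
are therefore an explicit function of the coins, with disjoint blocks for different weights. -/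
theorem reaches_drawWeights {m p G b : ℕ} (h0 : s.regs 0 = m) (h1 : s.regs 1 = p)
    (hGdef : G = m * p * (p + 1)) (hbdef : b = Nat.clog 2 (3 * G)) (hG : 3 * G < 2 ^ w)
    (hb : 2 ^ b < 2 ^ w) (hp : p + 1 < 2 ^ w) (hw : 3 < 2 ^ w) (hc : s.coins = coins)
    (hm : s.mem 2 = fun _ => 0) :
    Reaches w drawWeights τ
      (fun τ' s' => τ' ≤ τ + (G * (b * 15 + 25) + b * 16 + 40) ∧
      (∀ r < 8, r ≠ 2 → s'.regs r = s.regs r) ∧ s'.regs 2 = 2 ^ b ∧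
      (∀ a, a ≠ 2 → s'.mem a = s.mem a) ∧
      s'.mem 2 = fun k => if k < G then coinValue coins (k * b) b else 0) s := by
  have hw0 : 0 < w := by
    rcases Nat.eq_zero_or_pos w with h | h
    · simp [h] at hw
    · exact h
  apply Reaches.seq
  apply Reaches.assign
  rw [Expr.eval_const, Nat.mod_eq_of_lt (by omega)]
  apply Reaches.seq
  have hcond (s' : State) (t : ℕ) (h : s'.regs 2 = 2 ^ t)
      (hr : ∀ r < 8, r ≠ 2 → s'.regs r = s.regs r) :
      ((Expr.reg 2).less (.const 3 * numWeights)).eval w s' ≠ 0 ↔ t < b := by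
    rw [Expr.eval_less_ne_zero hw0, Expr.eval_reg, h, Expr.eval_mul, Expr.eval_const,
      eval_numWeights ((hr 0 (by omega) (by omega)).trans h0)
        ((hr 1 (by omega) (by omega)).trans h1) hw0 (by omega) hp, Nat.mod_eq_of_lt hw, ← hGdef,
      Nat.mod_eq_of_lt hG, hbdef, Nat.lt_clog_iff_pow_lt (by omega)]
  refine Reaches.whileLoop b 4 (fun t s' => s'.mem = s.mem ∧ s'.coins = s.coins ∧
    s'.regs 2 = 2 ^ t ∧ ∀ r < 8, r ≠ 2 → s'.regs r = s.regs r)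
    ⟨rfl, rfl, by simp, fun r _ hr => by simp [hr]⟩ ?_ ?_ ?_
  · rintro t ht s' τ' ⟨hm', hc', h2, hr⟩
    refine ⟨(hcond s' t h2 hr).2 ht, ?_⟩
    have hpow : 2 ^ (t + 1) ≤ 2 ^ b := Nat.pow_le_pow_right (by omega) ht
    rw [pow_succ] at hpow
    apply Reaches.assign
    rw [Expr.eval_add, Expr.eval_reg, h2, Nat.mod_eq_of_lt (by omega)]
    refine ⟨by simp only [Expr.cost_add, Expr.cost_reg]; omega, hm', hc', ?_,
      fun r hr' hr'' => by simp [hr'', hr r hr' hr'']⟩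
    rw [pow_succ, State.setReg_regs, if_pos rfl]
    omega
  · rintro s' ⟨-, -, h2, hr⟩
    by_contra h
    exact absurd ((hcond s' b h2 hr).1 h) (lt_irrefl _)
  rintro τ₁ s₁ hτ₁ ⟨hm₁, hc₁, h2₁, hr₁⟩
  refine Reaches.loop G (b * 15 + 11) (fun k s' => Frame 8 2 s₁ s' ∧
    (∀ i, s'.coins i = coins (k * b + i)) ∧ (∀ a, a ≠ 2 → s'.mem a = s.mem a) ∧
    s'.mem 2 = fun l => if l < k then coinValue coins (l * b) b else 0) hw0 (by omega)
    ⟨(Frame.refl 8 2 s₁).setReg _ _ (by omega), by simp [hc₁, hc], by simp [hm₁],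
      by simp [hm₁, hm]⟩ ?_ ?_ ?_
  · rintro k s' ⟨hf, -⟩
    rw [eval_numWeights ((hf.regs 0 (by omega)).trans ((hr₁ 0 (by omega) (by omega)).trans h0))
      ((hf.regs 1 (by omega)).trans ((hr₁ 1 (by omega) (by omega)).trans h1)) hw0 (by omega) hp,
      hGdef]
  · rintro k hk s' τ' ⟨hf, hc', hm', hw'⟩ h8
    refine (reaches_drawWeight hb ((hf.regs 2 (by omega)).trans h2₁) hc').mono ?_
    rintro τ'' s'' ⟨hτ, hf', hc'', hm'', hw''⟩
    refine ⟨hτ, (hf'.regs 8 (by omega)).trans h8,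
      (hf.trans hf' (by omega) (by omega)).setReg _ _ (by omega), fun i => ?_,
      fun a ha => (hm'' a ha).trans (hm' a ha), ?_⟩
    · rw [State.setReg_coins, hc'', Nat.succ_mul]
    · rw [State.setReg_mem, hw'', hw', h8]
      ext l
      by_cases hl : l = k
      · simp [hl]
      · have : l < k + 1 ↔ l < k := by omega
        simp [hl, this]
  · rintro τ₂ s₂ hτ₂ ⟨hf, -, hm', hw'⟩
    refine ⟨?_, fun r hr hr' => (hf.regs r hr).trans (hr₁ r hr hr'), (hf.regs 2 (by omega)).trans
      h2₁, hm', hw'⟩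
    simp only [Expr.cost_less, Expr.cost_reg, Expr.cost_const, Expr.cost_mul,
      numWeights, Expr.cost_add] at hτ₁ hτ₂
    have : G * (b * 15 + 11 + (1 + 1 + 1 + (1 + 1 + 1) + 1) + 7) = G * (b * 15 + 25) := rfl
    omega

end setup

/-! ### Reading the sets -/

section read

variable (m p : ℕ) (L : ℕ → List ℕ)

/-- The length of the `i`-th list after truncation to `p` entries. -/
def truncLen (i : ℕ) : ℕ := min (L i).length p

/-- The entry at position `a`, where the `i`-th list occupies the positions from `i * p` on. -/
def entry (a : ℕ) : ℕ := (L (a / p)).getD (a % p) 0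

/-- The position `a` holds an entry of one of the first `m` lists. -/
def IsPair (a : ℕ) : Prop := a / p < m ∧ a % p < truncLen p L (a / p)

variable {m p L}

theorem IsPair.p_pos {a : ℕ} (h : IsPair m p L a) : 0 < p := by
  by_contra hp
  obtain rfl : p = 0 := by omega
  have := h.2
  simp [truncLen] at this

theorem mul_add_div_mod {i j : ℕ} (hj : j < p) : (i * p + j) / p = i ∧ (i * p + j) % p = j := by
  constructor
  · rw [Nat.add_comm, Nat.add_mul_div_right _ _ (by omega), Nat.div_eq_of_lt hj, zero_add]
  · rw [Nat.add_comm, Nat.add_mul_mod_self_right, Nat.mod_eq_of_lt hj]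

theorem lt_of_lt_truncLen {i j : ℕ} (hj : j < truncLen p L i) : j < p :=
  hj.trans_le (min_le_right _ _)

theorem isPair_mul_add {i j : ℕ} (hi : i < m) (hj : j < truncLen p L i) :
    IsPair m p L (i * p + j) := by
  obtain ⟨h₁, h₂⟩ := mul_add_div_mod (i := i) (lt_of_lt_truncLen hj)
  rw [IsPair, h₁, h₂]
  exact ⟨hi, hj⟩

theorem entry_mul_add {i j : ℕ} (hj : j < p) : entry p L (i * p + j) = (L i).getD j 0 := by
  obtain ⟨h₁, h₂⟩ := mul_add_div_mod (i := i) hj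
  rw [entry, h₁, h₂]

theorem IsPair.lt {a : ℕ} (h : IsPair m p L a) : a < m * p :=
  (Nat.div_lt_iff_lt_mul h.p_pos).1 h.1

variable (m p L)

/-- The entries before position `c` have been copied, and array `5` holds the last copied
position of each of them. -/
def ReadUpTo (c : ℕ) (s : State) : Prop :=
  ∀ a, IsPair m p L a → a < c → s.mem 4 a = entry p L a ∧ IsPair m p L (s.mem 5 (entry p L a)) ∧
    s.mem 5 (entry p L a) < c ∧ entry p L (s.mem 5 (entry p L a)) = entry p L a ∧
      a ≤ s.mem 5 (entry p L a)

variable {m p L} {w : ℕ} {s : State} {τ : ℕ} {addr : ℕ → ℕ}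

/-- The position just copied exceeds all earlier ones, so overwriting the representative of its
element keeps the representative maximal. Cells of array `5` for elements not yet met are never
inspected. -/
theorem reaches_readElement {i j : ℕ} (hi : i < m) (hj : j < truncLen p L i) (h1 : s.regs 1 = p)
    (h9 : s.regs 9 = addr i) (h10 : s.regs 10 = i) (h11 : s.regs 11 = j)
    (hin : s.mem 0 (addr i + 1 + j) = (L i).getD j 0) (hread : ReadUpTo m p L (i * p + j) s)
    (haw : addr i + 1 + j < 2 ^ w) (hpw : i * p + j < 2 ^ w) :
    Reaches w readElement τ (fun τ' s' => τ' ≤ τ + 20 ∧ Frame 13 4 s s' ∧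
      ReadUpTo m p L (i * p + (j + 1)) s') s := by
  have hjp := lt_of_lt_truncLen hj
  have hpair := isPair_mul_add hi hj
  apply Reaches.seq
  apply Reaches.assign
  rw [Expr.eval_add, Expr.eval_mul, Expr.eval_reg, Expr.eval_reg, Expr.eval_reg, h1, h10, h11,
    Nat.mod_eq_of_lt (a := i * p) (by omega), Nat.mod_eq_of_lt hpw]
  apply Reaches.seq
  apply Reaches.store
  have hsrc : (Expr.load 0 (.reg 9 + .const 1 + .reg 11)).eval w (s.setReg 13 (i * p + j)) =
      entry p L (i * p + j) := by
    simp only [Expr.eval_add, Expr.eval_reg, Expr.eval_const, Expr.eval_load, State.setReg_regs,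
      State.setReg_mem]
    norm_num
    rw [h9, h11, Nat.mod_eq_of_lt haw, hin, entry_mul_add hjp]
  rw [hsrc]
  apply Reaches.store
  simp only [Expr.eval_reg, Expr.eval_load, State.setReg_regs, State.setMem_regs, if_true,
    State.setMem_mem, State.setReg_mem, Function.update_self, Expr.cost_reg, Expr.cost_load,
    Expr.cost_add, Expr.cost_mul, Expr.cost_const]
  refine ⟨by omega, ?_, ?_⟩
  · exact (((Frame.refl 13 4 s).setReg _ _ (by omega)).setMem _ _ _ (by omega)).setMem _ _ _
      (by omega)
  · intro a ha hac
    simp only [State.setMem_mem, State.setReg_mem]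
    norm_num
    by_cases hae : entry p L a = entry p L (i * p + j)
    · rw [hae, Function.update_self]
      refine ⟨?_, hpair, by omega, rfl, by omega⟩
      by_cases h : a = i * p + j
      · rw [h, Function.update_self]
      · rw [Function.update_of_ne h, ← hae]
        exact (hread a ha (by omega)).1
    · have h : a ≠ i * p + j := by rintro rfl; exact hae rfl
      obtain ⟨h₁, h₂, h₃, h₄, h₅⟩ := hread a ha (by omega)
      rw [Function.update_of_ne h, Function.update_of_ne hae]
      exact ⟨h₁, h₂, by omega, h₄, h₅⟩

theorem reaches_readSet {i : ℕ} (hi : i < m) (h1 : s.regs 1 = p)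
    (h9 : s.regs 9 = addr i) (h10 : s.regs 10 = i)
    (haddr : addr (i + 1) = addr i + 1 + (L i).length)
    (hlen : s.mem 0 (addr i) = (L i).length)
    (hin : ∀ j < (L i).length, s.mem 0 (addr i + 1 + j) = (L i).getD j 0)
    (hread : ReadUpTo m p L (i * p) s) (haw : addr (i + 1) < 2 ^ w) (hpw : m * p < 2 ^ w)
    (hw : 1 < 2 ^ w) :
    Reaches w readSet τ (fun τ' s' => τ' ≤ τ + (p * 29 + 40) ∧ s'.regs 9 = addr (i + 1) ∧
      (∀ r < 9, s'.regs r = s.regs r) ∧ s'.regs 10 = i ∧ (∀ a < 3, s'.mem a = s.mem a) ∧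
      s'.mem 3 = Function.update (s.mem 3) i (truncLen p L i) ∧
      ReadUpTo m p L ((i + 1) * p) s') s := by
  have hw0 : 0 < w := by
    rcases Nat.eq_zero_or_pos w with h | h
    · simp [h] at hw
    · exact h
  apply Reaches.seq
  apply Reaches.assign
  rw [Expr.eval_load, Expr.eval_reg, h9, hlen]
  apply Reaches.seq
  have hlt := Expr.eval_less_ne_zero hw0 (s.setReg 12 (L i).length) (.reg 12) (.reg 1)
  simp only [Expr.eval_reg, State.setReg_regs] at hlt
  norm_num at hlt
  rw [h1] at hlt
  have hstore : Reaches w (.ite ((Expr.reg 12).less (.reg 1)) (.store 3 (.reg 10) (.reg 12))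
      (.store 3 (.reg 10) (.reg 1))) (τ + ((Expr.load 0 (.reg 9)).cost + 1))
      (fun τ' s' => τ' ≤ τ + 11 ∧
        s' = (s.setReg 12 (L i).length).setMem 3 i (truncLen p L i)) (s.setReg 12 (L i).length) := by
    apply Reaches.ite
    · intro h
      have h := hlt.1 h
      apply Reaches.store
      refine ⟨?_, ?_⟩
      · simp only [Expr.cost_reg, Expr.cost_load, Expr.cost_less]; omega
      · rw [truncLen, min_eq_left h.le]
        simp [Expr.eval_reg, h10]
    · intro h
      have h : p ≤ (L i).length := by by_contra hcon; exact hlt.2 (by omega) h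
      apply Reaches.store
      refine ⟨?_, ?_⟩
      · simp only [Expr.cost_reg, Expr.cost_load, Expr.cost_less]; omega
      · rw [truncLen, min_eq_right h]
        simp [Expr.eval_reg, h10, h1]
  refine hstore.mono ?_
  rintro τ₁ s₁ ⟨hτ₁, rfl⟩
  apply Reaches.seq
  have htl : truncLen p L i ≤ p := min_le_right _ _
  have htl' : truncLen p L i ≤ (L i).length := min_le_left _ _
  have hip : (i + 1) * p ≤ m * p := Nat.mul_le_mul_right _ hi
  rw [Nat.succ_mul] at hip
  set s₁ := (s.setReg 12 (L i).length).setMem 3 i (truncLen p L i) with hs₁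
  refine Reaches.loop (truncLen p L i) 20 (fun j s' => Frame 11 4 s₁ s' ∧
    s'.regs 12 = (L i).length ∧ ReadUpTo m p L (i * p + j) s') hw0 (by omega)
    ⟨(Frame.refl _ _ _).setReg _ _ (by omega), by simp [hs₁], ?_⟩ ?_ ?_ ?_
  · intro a ha hac
    simpa [hs₁] using hread a ha hac
  · rintro k s' ⟨hf, -⟩
    rw [Expr.eval_load, Expr.eval_reg, hf.regs 10 (by omega), hf.mem 3 (by omega)]
    simp [hs₁, h10]
  · rintro j hj s' τ' ⟨hf, h12, hread'⟩ h11
    refine (reaches_readElement (addr := addr) hi hj ?_ ?_ ?_ h11 ?_ hread' (by omega)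
      (by omega)).mono ?_
    · simp [hf.regs 1, hs₁, h1]
    · simp [hf.regs 9, hs₁, h9]
    · simp [hf.regs 10, hs₁, h10]
    · rw [hf.mem 0 (by omega), ← hin j (by omega)]
      simp [hs₁]
    · rintro τ'' s'' ⟨hτ, hf', hread''⟩
      refine ⟨hτ, (hf'.regs 11 (by omega)).trans h11,
        (hf.trans hf' (by omega) (by omega)).setReg _ _ (by omega), ?_, hread''⟩
      simp [hf'.regs 12, h12]
  · rintro τ₂ s₂ hτ₂ ⟨hf, h12, hread'⟩
    apply Reaches.assign
    simp only [Expr.cost_reg, Expr.cost_load, Expr.cost_add, Expr.cost_const] at hτ₂ ⊢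
    have hval : (Expr.reg 9 + .const 1 + .reg 12).eval w s₂ = addr (i + 1) := by
      simp only [Expr.eval_add, Expr.eval_reg, Expr.eval_const, h12, hf.regs 9 (by omega)]
      simp only [hs₁, State.setMem_regs, State.setReg_regs]
      norm_num
      rw [h9, ← haddr, Nat.mod_eq_of_lt haw]
    rw [hval]
    refine ⟨by omega, by simp, fun r hr => ?_, ?_, fun a ha => ?_, ?_, ?_⟩
    · have h₁ : r ≠ 9 := by omega
      have h₂ : r ≠ 12 := by omega
      simp [h₁, hf.regs r (by omega), hs₁, h₂]
    · simp [hf.regs 10, hs₁, h10]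
    · have h₁ : a ≠ 3 := by omega
      simp [hf.mem a (by omega), hs₁, h₁]
    · simp [hf.mem 3, hs₁]
    · intro a ha hac
      -- The positions from `i * p + truncLen p L i` up to `(i + 1) * p` are padding, not pairs.
      have hac' : a < i * p + truncLen p L i := by
        by_contra hcon
        have hdiv : a / p = i := by
          apply Nat.div_eq_of_lt_le <;> [omega; exact hac]
        have h₁ := ha.2
        have h₂ := Nat.div_add_mod a p
        rw [hdiv] at h₁ h₂
        rw [mul_comm] at h₂
        omega
      obtain ⟨h₁, h₂, h₃, h₄, h₅⟩ := hread' a ha hac'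
      rw [Nat.succ_mul]
      exact ⟨h₁, h₂, by rw [State.setReg_mem]; omega, h₄, h₅⟩

theorem reaches_readInput (h0 : s.regs 0 = m) (h1 : s.regs 1 = p) (haddr0 : addr 0 = 3)
    (haddr : ∀ i < m, addr (i + 1) = addr i + 1 + (L i).length)
    (hlen : ∀ i < m, s.mem 0 (addr i) = (L i).length)
    (hin : ∀ i < m, ∀ j < (L i).length, s.mem 0 (addr i + 1 + j) = (L i).getD j 0)
    (haw : ∀ i ≤ m, addr i < 2 ^ w) (hpw : m * p < 2 ^ w) (hm : m < 2 ^ w)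
    (hw : 1 < 2 ^ w) :
    Reaches w readInput τ (fun τ' s' => τ' ≤ τ + (m * (p * 29 + 48) + 10) ∧
      (∀ r < 9, s'.regs r = s.regs r) ∧ (∀ a < 3, s'.mem a = s.mem a) ∧
      (s'.mem 3 = fun i => if i < m then truncLen p L i else s.mem 3 i) ∧ ReadUpTo m p L (m * p) s') s := by
  have hw0 : 0 < w := by
    rcases Nat.eq_zero_or_pos w with h | h
    · simp [h] at hw
    · exact h
  apply Reaches.seq
  apply Reaches.assign
  have h3 : (Expr.const 3).eval w s = 3 := by
    rw [Expr.eval_const, Nat.mod_eq_of_lt]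
    have := haw 0 (by omega)
    omega
  rw [h3]
  refine Reaches.loop m (p * 29 + 40) (fun i s' => s'.regs 9 = addr i ∧
    (∀ r < 9, s'.regs r = s.regs r) ∧ (∀ a < 3, s'.mem a = s.mem a) ∧
    (s'.mem 3 = fun i' => if i' < i then truncLen p L i' else s.mem 3 i') ∧ ReadUpTo m p L (i * p) s') hw0 hm
    ⟨by simp [haddr0], fun r hr => ?_, by simp, by simp, fun a _ h => by simp at h⟩ ?_ ?_ ?_
  · have h₁ : r ≠ 9 := by omega
    have h₂ : r ≠ 10 := by omega
    simp [h₁, h₂]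
  · rintro k s' ⟨-, hr, -⟩
    rw [Expr.eval_reg, hr 0 (by omega), h0]
  · rintro i hi s' τ' ⟨h9, hr, hmem, hlen', hread⟩ h10
    refine (reaches_readSet (addr := addr) hi ((hr 1 (by omega)).trans h1) h9 h10 (haddr i hi)
      (by rw [hmem 0 (by omega), hlen i hi]) (fun j hj => by rw [hmem 0 (by omega), hin i hi j hj])
      hread (haw (i + 1) hi) hpw hw).mono ?_
    rintro τ'' s'' ⟨hτ, h9', hr', h10', hmem', h3', hread'⟩
    refine ⟨hτ, h10', by simpa using h9', fun r hr'' => ?_,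
      fun a ha => (hmem' a ha).trans (hmem a ha), ?_, hread'⟩
    · have h₂ : r ≠ 10 := by omega
      simp [h₂, hr' r hr'', hr r hr'']
    · rw [State.setReg_mem, h3', hlen']
      ext i'
      by_cases h : i' = i
      · simp [h]
      · have : i' < i + 1 ↔ i' < i := by omega
        simp [h, this]
  · rintro τ' s' hτ ⟨-, hr, hmem, hlen', hread⟩
    simp only [Expr.cost_reg, Expr.cost_const] at hτ
    have : m * (p * 29 + 40 + 1 + 7) = m * (p * 29 + 48) := rfl
    exact ⟨by omega, hr, hmem, hlen', hread⟩

end read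

end PartialCover

end WordRAM

/-! ### Configurations

A configuration consists of a set `J` of sets, a set `S` of `p` pairs of these sets with distinct
elements, and a labelling of `S` by `p` labels. -/

namespace WordRAM

namespace PartialCover

open Polynomial Finset

/-! ### Inclusion–exclusion modulo 2 over the labels -/

section labels

variable {p B : ℕ} {ρ wt : ℕ → ℕ}

/-- The weight of the pair `a` with label `l`; `ρ a` represents the element of the pair. -/
def pairCost (p B : ℕ) (ρ wt : ℕ → ℕ) (a l : ℕ) : ℕ :=
  B + wt (a * (p + 1) + p) + wt (ρ a * (p + 1) + l)

/-- The generating function of the surjective labellings of `S`. -/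
noncomputable def labelSum (p B : ℕ) (ρ wt : ℕ → ℕ) (S : Finset ℕ) : (ZMod 2)[X] :=
  ∑ f : S → Fin p with Function.Surjective f, X ^ ∑ a : S, pairCost p B ρ wt a (f a)

/-- The admissible `χ` form the interval above the image of `f`, of size `2 ^ (p - #image)`. This is
odd only if the image is everything, so modulo 2 inclusion–exclusion needs no signs. -/
theorem card_superset_image_eq {α : Type*} [Fintype α] (f : α → Fin p) :
    ((#{χ : Finset (Fin p) | ∀ a, f a ∈ χ} : ℕ) : ZMod 2) =
      if Function.Surjective f then 1 else 0 := by
  have h : ({χ : Finset (Fin p) | ∀ a, f a ∈ χ} : Finset (Finset (Fin p))) =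
      Icc (univ.image f) univ := by
    ext χ
    simp [Finset.subset_iff]
  rw [h, card_Icc_finset (subset_univ _), card_univ, Fintype.card_fin]
  split_ifs with hf
  · rw [image_univ_of_surjective hf]
    simp
  · have hlt : #(univ.image f) < p := by
      refine lt_of_le_of_ne ((card_le_univ _).trans (by simp)) fun hc => hf ?_
      have : univ.image f = univ := (card_eq_iff_eq_univ _).1 (by simpa using hc)
      intro l
      have hl := mem_univ l
      rw [← this] at hl
      simpa using hl
    rw [ZMod.natCast_eq_zero_iff]
    exact dvd_pow_self 2 (by omega)

/-- Expand each product into labellings with values in `χ` and exchange the sums; the parity of the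
number of suitable `χ` selects the surjective ones. -/
theorem sum_prod_labels (S : Finset ℕ) (c : ℕ → ℕ → ℕ) :
    ∑ χ : Finset (Fin p), ∏ a ∈ S, ∑ l ∈ χ, (X : (ZMod 2)[X]) ^ c a l =
      ∑ f : S → Fin p with Function.Surjective f, X ^ ∑ a : S, c a (f a) := by
  have h (χ : Finset (Fin p)) : ∏ a ∈ S, ∑ l ∈ χ, (X : (ZMod 2)[X]) ^ c a l =
      ∑ f : S → Fin p, if ∀ a, f a ∈ χ then X ^ ∑ a : S, c a (f a) else 0 := by
    rw [← prod_coe_sort, prod_univ_sum, ← sum_filter]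
    refine sum_congr ?_ fun f _ => prod_pow_eq_pow_sum _ _ _
    ext f
    simp
  simp only [h]
  rw [sum_comm, sum_filter]
  refine sum_congr rfl fun f _ => ?_
  rw [← sum_filter, sum_const, nsmul_eq_mul, ← Polynomial.C_eq_natCast, card_superset_image_eq]
  split_ifs <;> simp

theorem sum_range_two_pow_eq {M : Type*} [AddCommMonoid M] (g : Finset (Fin p) → M) :
    ∑ x ∈ range (2 ^ p), g {l | x / 2 ^ (l : ℕ) % 2 ≠ 0} = ∑ χ, g χ := by
  have hinj : Set.InjOn (fun x : ℕ => ({l | x / 2 ^ (l : ℕ) % 2 ≠ 0} : Finset (Fin p)))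
      (range (2 ^ p)) := by
    intro x hx y hy hxy
    simp only [coe_range, Set.mem_Iio] at hx hy
    refine Nat.eq_of_testBit_eq fun i => ?_
    rcases lt_or_ge i p with hi | hi
    · have := congrArg (fun χ : Finset (Fin p) => (⟨i, hi⟩ : Fin p) ∈ χ) hxy
      simp only [mem_filter, mem_univ, true_and, eq_iff_iff] at this
      rw [Nat.testBit_eq_decide_div_mod_eq, Nat.testBit_eq_decide_div_mod_eq, decide_eq_decide]
      omega
    · have h2 : 2 ^ p ≤ 2 ^ i := Nat.pow_le_pow_right (by omega) hi
      rw [Nat.testBit_lt_two_pow (hx.trans_le h2), Nat.testBit_lt_two_pow (hy.trans_le h2)]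
  refine sum_nbij _ (fun _ _ => mem_univ _) hinj ?_ fun _ _ => rfl
  exact surjOn_of_injOn_of_card_le _ (fun _ _ => mem_univ _) hinj (by simp)

/-- Let `a ≠ b` have the same representative. Exchanging their labels preserves the weight, because
the label enters only through a weight indexed by `ρ`, while the weights of the positions ignore
labels. A surjection between sets of size `p` is injective, so the exchange has no fixed point, and
the terms cancel in characteristic two. -/
theorem labelSum_eq_zero_of_not_injOn {S : Finset ℕ} (hS : #S = p)
    (h : ¬ Set.InjOn ρ S) : labelSum p B ρ wt S = 0 := by
  simp only [Set.InjOn, not_forall] at h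
  obtain ⟨a, ha, b, hb, hab, hne⟩ := h
  set a' : S := ⟨a, ha⟩ with ha'
  set b' : S := ⟨b, hb⟩ with hb'
  have hne' : a' ≠ b' := fun h => hne (congrArg Subtype.val h)
  have hρ (x : S) : ρ (Equiv.swap a' b' x) = ρ x := by
    by_cases h₁ : x = a'
    · rw [h₁, Equiv.swap_apply_left]; exact hab.symm
    · by_cases h₂ : x = b'
      · rw [h₂, Equiv.swap_apply_right]; exact hab
      · rw [Equiv.swap_apply_of_ne_of_ne h₁ h₂]
  have hsum (f : S → Fin p) : ∑ x : S, pairCost p B ρ wt x ((f ∘ Equiv.swap a' b') x) =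
      ∑ x : S, pairCost p B ρ wt x (f x) := by
    simp only [pairCost, sum_add_distrib]
    congr 1
    rw [← Equiv.sum_comp (Equiv.swap a' b') fun x : S => wt (ρ x * (p + 1) + f x)]
    simp [hρ]
  unfold labelSum
  refine sum_involution (fun f _ => f ∘ Equiv.swap a' b') ?_ ?_ ?_ ?_
  · intro f _
    rw [hsum]
    exact CharTwo.add_self_eq_zero _
  · intro f hf _ heq
    have hf : Function.Surjective f := by simpa using hf
    have hbij : Function.Bijective f :=
      (Fintype.bijective_iff_surjective_and_card f).2 ⟨hf, by simp [hS]⟩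
    have := congrFun heq a'
    rw [Function.comp_apply, Equiv.swap_apply_left] at this
    exact hne' (hbij.1 this).symm
  · intro f hf
    have hf : Function.Surjective f := by simpa using hf
    simpa using hf.comp (Equiv.swap a' b').surjective
  · intro f _
    ext x
    simp

/-- With fewer than `p` pairs there is no surjection; with more, the prices `B` alone push the
degree to `(p + 1) * B`. -/
theorem coeff_labelSum_of_card_ne {S : Finset ℕ} (hS : #S ≠ p) {v : ℕ} (hv : v < (p + 1) * B) :
    (labelSum p B ρ wt S).coeff v = 0 := by
  rw [labelSum, finsetSum_coeff]
  refine sum_eq_zero fun f hf => ?_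
  have hf : Function.Surjective f := by simpa using hf
  have hcard : p ≤ #S := by simpa using Fintype.card_le_of_surjective f hf
  rw [coeff_X_pow, if_neg]
  have : #S * B ≤ ∑ a : S, pairCost p B ρ wt a (f a) := by
    rw [← Fintype.card_coe S, ← smul_eq_mul, ← card_univ]
    refine card_nsmul_le_sum _ _ _ fun a _ => ?_
    unfold pairCost
    omega
  have h' : (p + 1) * B ≤ #S * B := Nat.mul_le_mul_right _ (by omega)
  omega

theorem coeff_X_pow_mul_labelSum (n v : ℕ) (S : Finset ℕ) :
    (X ^ n * labelSum p B ρ wt S).coeff v = ∑ f : S → Fin p with Function.Surjective f,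
      if n + ∑ a : S, pairCost p B ρ wt a (f a) = v then 1 else 0 := by
  rw [labelSum, mul_sum, finsetSum_coeff]
  refine sum_congr rfl fun f _ => ?_
  rw [← pow_add, coeff_X_pow]
  exact if_congr eq_comm rfl rfl

end labels

/-! ### Configurations as sets of weight indices -/

section incidence

variable {p : ℕ} {ρ : ℕ → ℕ}

/-- The set of the random weights that contribute to a configuration. -/
def incidence (p : ℕ) (ρ : ℕ → ℕ) (S : Finset ℕ) (f : S → Fin p) : Finset ℕ :=
  S.image (fun a => a * (p + 1) + p) ∪ univ.image fun a : S => ρ a * (p + 1) + f a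

theorem mul_add_inj {a b l l' : ℕ} (hl : l ≤ p) (hl' : l' ≤ p)
    (h : a * (p + 1) + l = b * (p + 1) + l') : a = b ∧ l = l' := by
  have h₁ := mul_add_div_mod (i := a) (Nat.lt_succ_of_le hl)
  have h₂ := mul_add_div_mod (i := b) (Nat.lt_succ_of_le hl')
  simp only [Nat.succ_eq_add_one] at h₁ h₂
  rw [h] at h₁
  exact ⟨h₁.1.symm.trans h₂.1, h₁.2.symm.trans h₂.2⟩

/-- Block `a` of `p + 1` indices reserves slot `p` for the position `a` and slots below `p` for
labels. Injectivity of `ρ` on `S` makes all indices distinct, so no weight is counted twice;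
isolation applies to sums over sets only. -/
theorem sum_incidence (wt : ℕ → ℕ) {S : Finset ℕ} (hS : Set.InjOn ρ S) (f : S → Fin p) :
    ∑ e ∈ incidence p ρ S f, wt e =
      ∑ a : S, (wt (a * (p + 1) + p) + wt (ρ a * (p + 1) + f a)) := by
  rw [incidence, sum_union, sum_image, sum_image, sum_add_distrib]
  · congr 1
    exact (sum_coe_sort S fun a => wt (a * (p + 1) + p)).symm
  · intro a _ b _ h
    exact Subtype.ext (hS a.2 b.2 (mul_add_inj (f a).2.le (f b).2.le h).1)
  · intro a _ b _ h
    exact (mul_add_inj le_rfl le_rfl h).1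
  · rw [disjoint_left]
    intro e he he'
    simp only [mem_image, mem_univ, true_and] at he he'
    obtain ⟨a, -, rfl⟩ := he
    obtain ⟨b, hb⟩ := he'
    have := (mul_add_inj (f b).2.le le_rfl hb).2
    exact (f b).2.ne this

theorem mem_incidence_iff {S : Finset ℕ} {f : S → Fin p} {a : ℕ} :
    a * (p + 1) + p ∈ incidence p ρ S f ↔ a ∈ S := by
  simp only [incidence, mem_union, mem_image, mem_univ, true_and]
  constructor
  · rintro (⟨b, hb, h⟩ | ⟨b, h⟩)
    · rwa [← (mul_add_inj le_rfl le_rfl h).1]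
    · exact absurd (mul_add_inj (f b).2.le le_rfl h).2 (f b).2.ne
  · exact fun h => Or.inl ⟨a, h, rfl⟩

/-- The slots `p` reveal `S`; then the label slots reveal `f`, as `ρ` separates the members of `S`.
-/
theorem incidence_injective {S S' : Finset ℕ} {f : S → Fin p} {f' : S' → Fin p}
    (hS : Set.InjOn ρ S) (h : incidence p ρ S f = incidence p ρ S' f') :
    (⟨S, f⟩ : (S : Finset ℕ) × (S → Fin p)) = ⟨S', f'⟩ := by
  obtain rfl : S = S' := by
    ext a
    rw [← mem_incidence_iff (ρ := ρ) (f := f), h, mem_incidence_iff]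
  congr 1
  ext a
  have : ρ a * (p + 1) + f a ∈ incidence p ρ S f := by
    simp only [incidence, mem_union, mem_image, mem_univ, true_and]
    exact Or.inr ⟨a, rfl⟩
  rw [h] at this
  simp only [incidence, mem_union, mem_image, mem_univ, true_and] at this
  rcases this with ⟨b, -, hb⟩ | ⟨b, hb⟩
  · exact absurd (mul_add_inj le_rfl (f a).2.le hb).2.symm (f a).2.ne
  · obtain ⟨h₁, h₂⟩ := mul_add_inj (f' b).2.le (f a).2.le hb
    rw [Subtype.ext (hS b.2 a.2 h₁)] at h₂
    exact h₂.symm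

end incidence

open Polynomial Finset

/-- The positions of the pairs of set `i`. -/
def pairsOf (p : ℕ) (len : ℕ → ℕ) (i : ℕ) : Finset ℕ := (range (len i)).image (i * p + ·)

theorem div_eq_of_mem_pairsOf {p : ℕ} {len : ℕ → ℕ} {i a : ℕ} (hlen : len i ≤ p)
    (ha : a ∈ pairsOf p len i) : a / p = i := by
  simp only [pairsOf, mem_image, mem_range] at ha
  obtain ⟨j, hj, rfl⟩ := ha
  exact (mul_add_div_mod (by omega)).1

/-- `S` consists of `p` pairs of the sets in `J` with distinct elements. -/
structure Admissible (p : ℕ) (len ρ : ℕ → ℕ) (J S : Finset ℕ) : Prop where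
  subset : S ⊆ J.biUnion (pairsOf p len)
  card_eq : #S = p
  injOn : Set.InjOn ρ S

/-- The sets of random weights that contribute to the configurations with `t` sets. -/
def family (m p : ℕ) (len ρ : ℕ → ℕ) (t : ℕ) : Set (Finset ℕ) :=
  {E | ∃ J ⊆ range m, #J = t ∧ ∃ S, Admissible p len ρ J S ∧
    ∃ f : S → Fin p, Function.Surjective f ∧ incidence p ρ S f = E}

/-- Exactly one member of `F` has minimum weight. -/
def Isolated (wt : ℕ → ℕ) (F : Set (Finset ℕ)) : Prop :=
  ∃ E ∈ F, ∀ E' ∈ F, E' ≠ E → ∑ e ∈ E, wt e < ∑ e ∈ E', wt e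

/-! ### Expansion of the polynomial into configurations -/

section expansion

variable {T : Table} {ρ : ℕ → ℕ}

/-- Different sets own disjoint ranges of positions, so the products over the chosen sets merge into
one product over the union. -/
theorem prod_setFactor (hlen : ∀ i < T.m, T.len i ≤ T.p) (χ : ℕ → ℕ) (K : Finset ℕ)
    (hK : K ⊆ range T.m) : ∏ i ∈ K, T.setFactor χ i = ∑ J ∈ K.powerset, X ^ (#J * T.M) *
      ∏ a ∈ J.biUnion (pairsOf T.p T.len), T.pairFactor χ a := by
  simp only [Table.setFactor]
  rw [prod_one_add]
  refine sum_congr rfl fun J hJ => ?_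
  rw [prod_mul_distrib, prod_const, ← pow_mul, mul_comm T.M, prod_biUnion]
  · congr 1
    refine prod_congr rfl fun i _ => ?_
    rw [pairsOf, prod_image]
    intro j _ j' _ h
    simpa using h
  · intro i hi i' hi' hne
    rw [Function.onFun, disjoint_left]
    intro a ha ha'
    have hi₁ := mem_range.1 (hK (mem_powerset.1 hJ hi))
    have hi₂ := mem_range.1 (hK (mem_powerset.1 hJ hi'))
    exact hne ((div_eq_of_mem_pairsOf (hlen i hi₁) ha).symm.trans
      (div_eq_of_mem_pairsOf (hlen i' hi₂) ha'))

/-- The sum of the products over all sets of labels counts surjective labellings. -/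
theorem total_eq (hlen : ∀ i < T.m, T.len i ≤ T.p)
    (hρ : ∀ i < T.m, ∀ a ∈ pairsOf T.p T.len i, T.rep (T.el a) = ρ a) (k : ℕ) :
    T.total k = ∑ J ∈ {i ∈ range T.m | i + 1 ≠ k}.powerset, ∑ S ∈
      (J.biUnion (pairsOf T.p T.len)).powerset, X ^ (#J * T.M) * labelSum T.p T.B ρ T.wt S := by
  have h₁ (χ : ℕ → ℕ) : T.product χ k = ∏ i ∈ range T.m with i + 1 ≠ k, T.setFactor χ i := by
    rw [Table.product, prod_filter]
    exact prod_congr rfl fun i _ => by split_ifs <;> simp_all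
  simp only [Table.total, h₁, prod_setFactor hlen _ _ (filter_subset _ _)]
  rw [sum_comm]
  refine sum_congr rfl fun J hJ => ?_
  simp only [Table.pairFactor, prod_one_add, mul_sum]
  rw [sum_comm]
  refine sum_congr rfl fun S hS => ?_
  rw [← mul_sum, labelSum, ← sum_prod_labels, ← sum_range_two_pow_eq]
  congr 1
  refine sum_congr rfl fun x _ => prod_congr rfl fun a ha => ?_
  rw [Finset.sum_range, sum_filter]
  refine sum_congr rfl fun l _ => ?_
  obtain ⟨i, hi, hai⟩ := mem_biUnion.1 (mem_powerset.1 hS ha)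
  have him : i < T.m := mem_range.1 (filter_subset _ _ (mem_powerset.1 hJ hi))
  rw [Table.cost, hρ i him a hai]
  rfl

-- Below the degree bound every inadmissible `S` contributes nothing: one of the wrong size by
-- `coeff_labelSum_of_card_ne`, one with a repeated element by cancellation.
open scoped Classical in
theorem coeff_total (hlen : ∀ i < T.m, T.len i ≤ T.p)
    (hρ : ∀ i < T.m, ∀ a ∈ pairsOf T.p T.len i, T.rep (T.el a) = ρ a) (k : ℕ) {v : ℕ}
    (hv : v < (T.p + 1) * T.B) :
    (T.total k).coeff v = ∑ J ∈ {i ∈ range T.m | i + 1 ≠ k}.powerset, ∑ S ∈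
      (J.biUnion (pairsOf T.p T.len)).powerset with Admissible T.p T.len ρ J S,
        ∑ f : S → Fin T.p with Function.Surjective f,
          if #J * T.M + ∑ a : S, pairCost T.p T.B ρ T.wt a (f a) = v then 1 else 0 := by
  rw [total_eq hlen hρ, finsetSum_coeff]
  refine sum_congr rfl fun J _ => ?_
  rw [finsetSum_coeff, sum_filter]
  refine sum_congr rfl fun S hS => ?_
  split_ifs with h
  · exact coeff_X_pow_mul_labelSum _ _ _
  · rw [coeff_X_pow_mul']
    split_ifs
    · by_cases hc : #S = T.p
      · rw [labelSum_eq_zero_of_not_injOn hc fun hinj => h ⟨mem_powerset.1 hS, hc, hinj⟩,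
          coeff_zero]
      · exact coeff_labelSum_of_card_ne hc (by omega)
    · rfl

end expansion

/-! ### Reading an optimal cover off the coefficients -/

section isolated

variable {T : Table} {ρ : ℕ → ℕ} {R t : ℕ}

theorem coeff_total_eq_zero (hlen : ∀ i < T.m, T.len i ≤ T.p)
    (hρ : ∀ i < T.m, ∀ a ∈ pairsOf T.p T.len i, T.rep (T.el a) = ρ a)
    (hno : ∀ J ⊆ range T.m, ∀ S, ¬ Admissible T.p T.len ρ J S) (k : ℕ) {v : ℕ}
    (hv : v < (T.p + 1) * T.B) : (T.total k).coeff v = 0 := by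
  classical
  rw [coeff_total hlen hρ k hv]
  refine sum_eq_zero fun J hJ => sum_eq_zero fun S hS => ?_
  exact absurd (mem_filter.1 hS).2
    (hno J ((mem_powerset.1 hJ).trans (filter_subset _ _)) S)

theorem sum_pairCost {p B : ℕ} {wt : ℕ → ℕ} {S : Finset ℕ} (hS : #S = p)
    (hinj : Set.InjOn ρ S) (f : S → Fin p) :
    ∑ a : S, pairCost p B ρ wt a (f a) = p * B + ∑ e ∈ incidence p ρ S f, wt e := by
  rw [sum_incidence wt hinj]
  simp only [pairCost, add_assoc]
  rw [sum_add_distrib, sum_const, card_univ, Fintype.card_coe, hS, smul_eq_mul]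

theorem sum_incidence_lt {p : ℕ} {wt : ℕ → ℕ} {S : Finset ℕ} (hS : #S = p)
    (hinj : Set.InjOn ρ S) (f : S → Fin p) (hwt : ∀ x, wt x < R) :
    ∑ e ∈ incidence p ρ S f, wt e < (2 * p + 1) * R := by
  rw [sum_incidence wt hinj]
  have h : ∑ a : S, (wt (a * (p + 1) + p) + wt (ρ a * (p + 1) + f a)) ≤
      #(univ : Finset S) • (2 * R) :=
    sum_le_card_nsmul _ _ _ fun a _ => by
      have h₁ := hwt (a * (p + 1) + p)
      have h₂ := hwt (ρ a * (p + 1) + f a)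
      omega
  rw [card_univ, Fintype.card_coe, hS, smul_eq_mul] at h
  have := hwt 0
  have h' : (2 * p + 1) * R = p * (2 * R) + R := by ring
  omega

/-- The sets that own the pairs of a configuration with the fewest sets. -/
theorem eq_image_of_admissible {m p : ℕ} {len : ℕ → ℕ} (hlen : ∀ i < m, len i ≤ p)
    (hmin : ∀ J ⊆ range m, ∀ S, Admissible p len ρ J S → t ≤ #J) {J S : Finset ℕ}
    (hJ : J ⊆ range m) (hJt : #J = t) (hS : Admissible p len ρ J S) :
    S.image (· / p) = J := by
  have hsub : S.image (· / p) ⊆ J := by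
    intro i hi
    obtain ⟨a, ha, rfl⟩ := mem_image.1 hi
    obtain ⟨i, hi, hai⟩ := mem_biUnion.1 (hS.subset ha)
    rwa [div_eq_of_mem_pairsOf (hlen i (mem_range.1 (hJ hi))) hai]
  refine eq_of_subset_of_card_le hsub ?_
  rw [hJt]
  refine hmin _ (hsub.trans hJ) S ⟨fun a ha => ?_, hS.card_eq, hS.injOn⟩
  obtain ⟨i, hi, hai⟩ := mem_biUnion.1 (hS.subset ha)
  refine mem_biUnion.2 ⟨i, mem_image.2 ⟨a, ha, ?_⟩, hai⟩
  exact div_eq_of_mem_pairsOf (hlen i (mem_range.1 (hJ hi))) hai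

/-- If the random weights isolate a configuration with the fewest sets, then the coefficients
tell which sets it uses. -/
theorem exists_isLeastDegree (hlen : ∀ i < T.m, T.len i ≤ T.p)
    (hρ : ∀ i < T.m, ∀ a ∈ pairsOf T.p T.len i, T.rep (T.el a) = ρ a)
    (hM : T.M = (2 * T.p + 1) * R) (hB : T.B = (T.m + 1) * T.M) (hD : T.D = (T.p + 1) * T.B)
    (hwt : ∀ x, T.wt x < R)
    (hmin : ∀ J ⊆ range T.m, ∀ S, Admissible T.p T.len ρ J S → t ≤ #J)
    (hiso : Isolated T.wt (family T.m T.p T.len ρ t)) :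
    ∃ J ⊆ range T.m, #J = t ∧ (∃ S, Admissible T.p T.len ρ J S) ∧
      ∃ v, IsLeastDegree T.D (T.total 0) v ∧
        ∀ i < T.m, (T.total (i + 1)).coeff v = 0 ↔ i ∈ J := by
  classical
  obtain ⟨E, ⟨J₀, hJ₀, hJt, S₀, hS₀, f₀, hf₀, rfl⟩, hE⟩ := hiso
  have hlt := sum_incidence_lt hS₀.card_eq hS₀.injOn f₀ hwt
  rw [← hM] at hlt
  set W := ∑ e ∈ incidence T.p ρ S₀ f₀, T.wt e with hW
  set v := t * T.M + (T.p * T.B + W) with hvdef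
  have htm : t ≤ T.m := by simpa [hJt] using card_le_card hJ₀
  have htM : t * T.M ≤ T.m * T.M := Nat.mul_le_mul_right _ htm
  have hv : v < (T.p + 1) * T.B := by
    have h₁ : (T.p + 1) * T.B = T.p * T.B + T.B := by ring
    have h₂ : T.B = T.m * T.M + T.M := by rw [hB]; ring
    omega
  -- No other configuration has degree at most `v`: an additional set costs `M > W`, and with `t`
  -- sets isolation determines the incidence set, hence `S` and `f`, hence `J` as the set of owners.
  have hmain {J S : Finset ℕ} (hJ : J ⊆ range T.m) (hS : Admissible T.p T.len ρ J S)
      (f : S → Fin T.p) (hf : Function.Surjective f)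
      (hle : #J * T.M + ∑ a : S, pairCost T.p T.B ρ T.wt a (f a) ≤ v) :
      J = J₀ ∧ (⟨S, f⟩ : (S : Finset ℕ) × (S → Fin T.p)) = ⟨S₀, f₀⟩ := by
    rw [sum_pairCost hS.card_eq hS.injOn] at hle
    have htJ := hmin J hJ S hS
    obtain hJt' : #J = t := by
      by_contra hne
      have : (t + 1) * T.M ≤ #J * T.M := Nat.mul_le_mul_right _ (by omega)
      rw [Nat.succ_mul] at this
      omega
    rw [hJt'] at hle
    have heq : incidence T.p ρ S f = incidence T.p ρ S₀ f₀ := by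
      by_contra hne
      have := hE _ ⟨J, hJ, hJt', S, hS, f, hf, rfl⟩ hne
      omega
    have hSf := incidence_injective hS.injOn heq
    refine ⟨?_, hSf⟩
    rw [← eq_image_of_admissible hlen hmin hJ hJt' hS,
      ← eq_image_of_admissible hlen hmin hJ₀ hJt hS₀,
      show S = S₀ from congrArg Sigma.fst hSf]
  have hexp : #J₀ * T.M + ∑ a : S₀, pairCost T.p T.B ρ T.wt a (f₀ a) = v := by
    rw [sum_pairCost hS₀.card_eq hS₀.injOn, hJt]
  have hsub (k : ℕ) {J : Finset ℕ} (hJ : J ∈ {i ∈ range T.m | i + 1 ≠ k}.powerset) :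
      J ⊆ range T.m := (mem_powerset.1 hJ).trans (filter_subset _ _)
  have hzero (k : ℕ) (u : ℕ) (hu : u ≤ v) (h : u < v ∨ ¬ ∀ i ∈ J₀, i + 1 ≠ k) :
      (T.total k).coeff u = 0 := by
    rw [coeff_total hlen hρ k (by omega)]
    refine sum_eq_zero fun J hJ => sum_eq_zero fun S hS => sum_eq_zero fun f hf => ?_
    refine if_neg fun heq => ?_
    obtain ⟨h₁, h₂⟩ := hmain (hsub k hJ) (mem_filter.1 hS).2 f (by simpa using hf) (by omega)
    rcases h with h | h
    · subst h₁
      obtain rfl : S = S₀ := congrArg Sigma.fst h₂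
      obtain rfl : f = f₀ := eq_of_heq (Sigma.mk.inj h₂).2
      omega
    · exact h fun i hi => (mem_filter.1 (mem_powerset.1 hJ (h₁ ▸ hi))).2
  have hone (k : ℕ) (h : ∀ i ∈ J₀, i + 1 ≠ k) : (T.total k).coeff v = 1 := by
    rw [coeff_total hlen hρ k hv, sum_eq_single J₀, sum_eq_single S₀, sum_eq_single f₀,
      if_pos hexp]
    · intro f hf hne
      refine if_neg fun heq => hne ?_
      exact eq_of_heq (Sigma.mk.inj (hmain hJ₀ hS₀ f (by simpa using hf) heq.le).2).2
    · intro hcon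
      exact absurd (by simpa using hf₀) hcon
    · intro S hS hne
      refine sum_eq_zero fun f hf => if_neg fun heq => hne ?_
      exact congrArg Sigma.fst
        (hmain hJ₀ (mem_filter.1 hS).2 f (by simpa using hf) heq.le).2
    · intro hcon
      exact absurd (mem_filter.2 ⟨mem_powerset.2 hS₀.subset, hS₀⟩) hcon
    · intro J hJ hne
      refine sum_eq_zero fun S hS => sum_eq_zero fun f hf => if_neg fun heq => hne ?_
      exact (hmain (hsub k hJ) (mem_filter.1 hS).2 f (by simpa using hf) heq.le).1
    · intro hcon
      exact absurd (mem_powerset.2 fun i hi => mem_filter.2 ⟨hJ₀ hi, h i hi⟩) hcon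
  refine ⟨J₀, hJ₀, hJt, ⟨S₀, hS₀⟩, v, ⟨hD ▸ hv, ?_, fun u hu => ?_⟩, fun i hi => ⟨fun h => ?_,
    fun h => ?_⟩⟩
  · rw [hone 0 (by simp)]
    exact one_ne_zero
  · exact hzero 0 u hu.le (Or.inl hu)
  · by_contra hiJ
    rw [hone (i + 1) fun i' hi' h' => hiJ (by simpa [← Nat.succ_inj.1 h'] using hi')] at h
    exact one_ne_zero h
  · refine hzero (i + 1) v le_rfl (Or.inr ?_)
    push Not
    exact ⟨i, h, rfl⟩

end isolated

end PartialCover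

end WordRAM

/-! ### Isolation -/

namespace WordRAM

namespace PartialCover

open Finset

/-! ### Coin blocks and the isolation lemma -/

section coins

theorem coinValue_congr {c c' : ℕ → Bool} {o b : ℕ} (h : ∀ t < b, c (o + t) = c' (o + t)) :
    coinValue c o b = coinValue c' o b := by
  induction b with
  | zero => rfl
  | succ b ih =>
    rw [coinValue, coinValue, ih fun t ht => h t (by omega), h b (by omega)]

theorem eq_of_coinValue_eq {c c' : ℕ → Bool} {o b : ℕ} (h : coinValue c o b = coinValue c' o b) :
    ∀ t < b, c (o + t) = c' (o + t) := by
  induction b with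
  | zero => simp
  | succ b ih =>
    rw [coinValue, coinValue] at h
    have h₁ := Bool.toNat_le (c (o + b))
    have h₂ := Bool.toNat_le (c' (o + b))
    intro t ht
    rcases Nat.lt_succ_iff_lt_or_eq.1 ht with ht | rfl
    · exact ih (by omega) t ht
    · have h₃ : (c (o + t)).toNat = (c' (o + t)).toNat := by omega
      revert h₃
      cases c (o + t) <;> cases c' (o + t) <;> simp

/-- The random weights: `G` numbers of `b` bits each. -/
def weights (G b : ℕ) (c : ℕ → Bool) (k : ℕ) : ℕ := if k < G then coinValue c (k * b) b else 0

theorem weights_lt (G b : ℕ) (c : ℕ → Bool) (k : ℕ) : weights G b c k < 2 ^ b := by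
  unfold weights
  split_ifs
  · exact coinValue_lt _ _ _
  · positivity

/-- Extend a finite sequence of coins. -/
def extendCoins {N : ℕ} (z : Fin N → Bool) (i : ℕ) : Bool :=
  if h : i < N then z ⟨i, h⟩ else false

variable {G b : ℕ}

theorem weights_congr {c c' : ℕ → Bool} (h : ∀ i < G * b, c i = c' i) :
    weights G b c = weights G b c' := by
  ext k
  unfold weights
  split_ifs with hk
  · refine coinValue_congr fun t ht => h _ ?_
    have : (k + 1) * b ≤ G * b := Nat.mul_le_mul_right _ hk
    rw [Nat.succ_mul] at this
    omega
  · rfl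

/-- The coin tosses start with the finite sequence `z`. -/
theorem fairCoins_prefix {N : ℕ} (z : Fin N → Bool) :
    fairCoins {c | ∀ i : Fin N, c i = z i} = (2⁻¹ : ENNReal) ^ N := by
  have h : {c : ℕ → Bool | ∀ i : Fin N, c i = z i} =
      Set.pi (range N) fun i => {extendCoins z i} := by
    ext c
    simp only [Set.mem_ofPred_eq, Set.mem_pi, coe_range, Set.mem_Iio, Set.mem_singleton_iff]
    constructor
    · intro h i hi
      simpa [extendCoins, hi] using h ⟨i, hi⟩
    · intro h i
      simpa [extendCoins] using h i i.2
  rw [h, fairCoins, Measure.infinitePi_pi]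
  · simp
  · intro i _
    exact measurableSet_singleton _

/-- The event is the disjoint union of cylinders fixing the first `N` coins, each of probability
`2⁻¹ ^ N`. This reduces the isolation lemma to counting. -/
theorem card_div_le_fairCoins {N : ℕ} (A : Finset (Fin N → Bool)) :
    (#A : ENNReal) * 2⁻¹ ^ N ≤ fairCoins {c | (fun i : Fin N => c i) ∈ A} := by
  have hmeas (z : Fin N → Bool) : MeasurableSet {c : ℕ → Bool | ∀ i : Fin N, c i = z i} := by
    simp only [Set.ofPred_forall]
    refine MeasurableSet.iInter fun i => ?_
    exact measurableSet_eq_fun (measurable_pi_apply (i : ℕ)) measurable_const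
  have hunion : {c : ℕ → Bool | (fun i : Fin N => c i) ∈ A} =
      ⋃ z ∈ A, {c : ℕ → Bool | ∀ i : Fin N, c i = z i} := by
    ext c
    simp only [Set.mem_ofPred_eq, Set.mem_iUnion, exists_prop]
    constructor
    · exact fun h => ⟨_, h, fun _ => rfl⟩
    · rintro ⟨z, hz, h⟩
      rwa [show (fun i : Fin N => c i) = z from funext h]
  rw [hunion, measure_biUnion_finset _ fun z _ => hmeas z]
  · simp only [fairCoins_prefix]
    rw [sum_const, nsmul_eq_mul]
  · intro z _ z' _ hne
    rw [Function.onFun, Set.disjoint_left]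
    intro c hc hc'
    exact hne (funext fun i => (hc i).symm.trans (hc' i))

/-- Two members of `F` have minimum weight, and they are distinguished by `e`. -/
def TieAt (wt : ℕ → ℕ) (F : Set (Finset ℕ)) (e : ℕ) : Prop :=
  ∃ E ∈ F, ∃ E' ∈ F, e ∈ E ∧ e ∉ E' ∧
    ∀ E'' ∈ F, ∑ x ∈ E, wt x ≤ ∑ x ∈ E'', wt x ∧ ∑ x ∈ E', wt x ≤ ∑ x ∈ E'', wt x

/-- A minimum exists because weights are natural numbers. Without isolation there is a second
minimizer, and the two differ at some index, which lies in exactly one of them. -/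
theorem exists_tieAt {wt : ℕ → ℕ} {F : Set (Finset ℕ)} (hF : F.Nonempty)
    (h : ¬ Isolated wt F) : ∃ e, TieAt wt F e ∧ ∃ E ∈ F, e ∈ E := by
  obtain ⟨E, hE, hmin⟩ : ∃ E ∈ F, ∀ E' ∈ F, ∑ x ∈ E, wt x ≤ ∑ x ∈ E', wt x :=
    ⟨_, Function.argminOn_mem _ F hF, fun E' hE' => Function.argminOn_le (fun E => ∑ x ∈ E, wt x)
      F hE'⟩
  have : ∃ E' ∈ F, E' ≠ E ∧ ∑ x ∈ E', wt x ≤ ∑ x ∈ E, wt x := by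
    by_contra hcon
    push Not at hcon
    exact h ⟨E, hE, hcon⟩
  obtain ⟨E', hE', hne, hle⟩ := this
  have hmin' : ∀ E'' ∈ F, ∑ x ∈ E', wt x ≤ ∑ x ∈ E'', wt x :=
    fun E'' hE'' => hle.trans (hmin E'' hE'')
  have hex : ∃ e, (e ∈ E ∧ e ∉ E') ∨ (e ∈ E' ∧ e ∉ E) := by
    by_contra hcon
    push Not at hcon
    exact hne (ext fun e => ⟨(hcon e).2, (hcon e).1⟩)
  obtain ⟨e, ⟨h₁, h₂⟩ | ⟨h₁, h₂⟩⟩ := hex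
  · exact ⟨e, ⟨E, hE, E', hE', h₁, h₂, fun E'' h'' => ⟨hmin E'' h'', hmin' E'' h''⟩⟩, E, hE, h₁⟩
  · exact ⟨e, ⟨E', hE', E, hE, h₁, h₂, fun E'' h'' => ⟨hmin' E'' h'', hmin E'' h''⟩⟩, E', hE', h₁⟩

/-- At a tie, the weight of `e` is the minimum over members avoiding `e` minus the minimum, over
members containing `e`, of the weight without `e`. Both depend on the other weights only; by
symmetry the lemma yields equality. -/
theorem le_of_tieAt {wt wt' : ℕ → ℕ} {F : Set (Finset ℕ)} {e : ℕ} (h : TieAt wt F e)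
    (h' : TieAt wt' F e) (hagree : ∀ x, x ≠ e → wt x = wt' x) : wt' e ≤ wt e := by
  obtain ⟨E, hE, E', hE', heE, heE', hmin⟩ := h
  obtain ⟨K, hK, K', hK', heK, heK', hmin'⟩ := h'
  have h₁ : ∑ x ∈ K, wt x + wt' e = ∑ x ∈ K, wt' x + wt e := by
    rw [← add_sum_erase _ _ heK, ← add_sum_erase _ wt' heK,
      sum_congr rfl fun x hx => hagree x (ne_of_mem_erase hx)]
    ring
  have h₂ : ∑ x ∈ E', wt x = ∑ x ∈ E', wt' x :=
    sum_congr rfl fun x hx => hagree x fun h => heE' (h ▸ hx)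
  have h₃ := (hmin' E' hE').1
  have h₄ := (hmin E' hE').1
  have h₅ := (hmin E hE).2
  have h₆ := (hmin K hK).1
  omega

theorem weights_of_ne {c c' : ℕ → Bool} {e : ℕ} (h : ∀ i, i / b ≠ e → c i = c' i) {x : ℕ}
    (hx : x ≠ e) : weights G b c x = weights G b c' x := by
  unfold weights
  split_ifs
  · refine coinValue_congr fun t ht => h _ ?_
    rwa [(mul_add_div_mod ht).1]
  · rfl

/-- A tie at `e` fixes the block of `e` in terms of the other coins. Hence replacing this block by
an arbitrary one is an injection from ties times blocks into all coin sequences. -/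
theorem card_tieAt_mul_le (F : Set (Finset ℕ)) {e : ℕ} (he : e < G)
    [DecidablePred fun z : Fin (G * b) → Bool => TieAt (weights G b (extendCoins z)) F e] :
    #{z : Fin (G * b) → Bool | TieAt (weights G b (extendCoins z)) F e} * 2 ^ b ≤
      2 ^ (G * b) := by
  set A : Finset (Fin (G * b) → Bool) :=
    {z : Fin (G * b) → Bool | TieAt (weights G b (extendCoins z)) F e} with hA
  have hblock {t : ℕ} (ht : t < b) : e * b + t < G * b := by
    have : (e + 1) * b ≤ G * b := Nat.mul_le_mul_right _ he
    rw [Nat.succ_mul] at this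
    omega
  have hpos (i : Fin (G * b)) : 0 < b := by
    by_contra h
    obtain rfl : b = 0 := by omega
    exact i.elim0
  let φ : (Fin (G * b) → Bool) × (Fin b → Bool) → (Fin (G * b) → Bool) := fun q i =>
    if (i : ℕ) / b = e then q.2 ⟨i % b, Nat.mod_lt _ (hpos i)⟩ else q.1 i
  have hφ : Set.InjOn φ (A ×ˢ (univ : Finset (Fin b → Bool)) :) := by
    rintro ⟨z, y⟩ hz ⟨z', y'⟩ hz' heq
    simp only [coe_product, Set.mem_prod, mem_coe, hA, mem_filter, mem_univ, true_and,
      and_true] at hz hz'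
    have hoff (i : ℕ) (hi : i / b ≠ e) : extendCoins z i = extendCoins z' i := by
      unfold extendCoins
      split_ifs with h
      · simpa [φ, hi] using congrFun heq ⟨i, h⟩
      · rfl
    have hw : weights G b (extendCoins z) e = weights G b (extendCoins z') e :=
      le_antisymm (le_of_tieAt hz' hz fun x hx => (weights_of_ne hoff hx).symm)
        (le_of_tieAt hz hz' fun x hx => weights_of_ne hoff hx)
    rw [weights, weights, if_pos he, if_pos he] at hw
    have hon := eq_of_coinValue_eq hw
    refine Prod.ext (funext fun i => ?_) (funext fun t => ?_)
    · have : extendCoins z i = extendCoins z' i := by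
        by_cases hi : (i : ℕ) / b = e
        · have := hon (i % b) (Nat.mod_lt _ (hpos i))
          rwa [← hi, Nat.div_add_mod'] at this
        · exact hoff i hi
      simpa [extendCoins] using this
    · have h₁ := mul_add_div_mod (i := e) t.2
      have := congrFun heq ⟨e * b + t, hblock t.2⟩
      simpa [φ, h₁.1, h₁.2] using this
  have := card_le_card_of_injOn (t := univ) φ (fun _ _ => mem_univ _) hφ
  simpa [card_product] using this

/-- The isolation lemma for weights determined by coin tosses. -/
theorem two_thirds_le_isolated {F : Set (Finset ℕ)} (hF : F.Nonempty)
    (hFG : ∀ E ∈ F, E ⊆ range G) (hb : 3 * G ≤ 2 ^ b) :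
    2 / 3 ≤ fairCoins {c | Isolated (weights G b c) F} := by
  classical
  set N := G * b with hN
  set bad : Finset (Fin N → Bool) := {z | ¬ Isolated (weights G b (extendCoins z)) F} with hbad
  set good : Finset (Fin N → Bool) := {z | Isolated (weights G b (extendCoins z)) F} with hgood
  have hsum : #good + #bad = 2 ^ N := by
    rw [hgood, hbad, card_filter_add_card_filter_not]
    simp
  have hbad' : 3 * #bad ≤ 2 ^ N := by
    have h₁ : bad ⊆ (range G).biUnion fun e =>
        {z : Fin N → Bool | TieAt (weights G b (extendCoins z)) F e} := by
      intro z hz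
      obtain ⟨e, h, E, hE, heE⟩ := exists_tieAt hF (mem_filter.1 hz).2
      exact mem_biUnion.2 ⟨e, hFG E hE heE, by simpa using h⟩
    -- Union bound over the `G` indices at which a tie can occur.
    have h₂ : #bad * 2 ^ b ≤ G * 2 ^ N := by
      refine (Nat.mul_le_mul_right _ ((card_le_card h₁).trans card_biUnion_le)).trans ?_
      rw [sum_mul]
      refine (sum_le_card_nsmul _ _ (2 ^ N) fun e he =>
        card_tieAt_mul_le F (mem_range.1 he)).trans ?_
      simp
    refine Nat.le_of_mul_le_mul_right (c := 2 ^ b) ?_ (by positivity)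
    calc 3 * #bad * 2 ^ b = 3 * (#bad * 2 ^ b) := by ring
      _ ≤ 3 * (G * 2 ^ N) := by omega
      _ = 3 * G * 2 ^ N := by ring
      _ ≤ 2 ^ b * 2 ^ N := Nat.mul_le_mul_right _ hb
      _ = 2 ^ N * 2 ^ b := by ring
  have hsub : {c : ℕ → Bool | (fun i : Fin N => c i) ∈ good} ⊆
      {c | Isolated (weights G b c) F} := by
    intro c hc
    have := (mem_filter.1 (Set.mem_ofPred_eq ▸ hc : (fun i : Fin N => c i) ∈ good)).2
    rwa [weights_congr (c' := c) fun i hi => by simp [extendCoins, hN, hi]] at this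
  refine le_trans ?_ ((card_div_le_fairCoins good).trans (measure_mono hsub))
  have h3 : 2 * 2 ^ N ≤ 3 * #good := by omega
  have h3' : (2 : ENNReal) * 2 ^ N ≤ 3 * #good := by exact_mod_cast h3
  refine ENNReal.div_le_of_le_mul ?_
  calc (2 : ENNReal) = 2 * (2 * 2⁻¹) ^ N := by
        rw [ENNReal.mul_inv_cancel (by simp) (by simp), one_pow, mul_one]
    _ = 2 * 2 ^ N * 2⁻¹ ^ N := by rw [mul_pow, mul_assoc]
    _ ≤ 3 * #good * 2⁻¹ ^ N := by gcongr
    _ = #good * 2⁻¹ ^ N * 3 := by ring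

end coins

end PartialCover

end WordRAM

/-! ### Instances -/

namespace WordRAM

namespace PartialCover

open Finset

theorem sum_length_flatMap_range (g : ℕ → List ℕ) (m : ℕ) :
    ((List.range m).flatMap g).length = ∑ i ∈ range m, (g i).length := by
  induction m with
  | zero => simp
  | succ m ih => rw [List.range_succ, List.flatMap_append, List.length_append, ih,
      sum_range_succ]; simp

theorem getD_flatMap_range (g : ℕ → List ℕ) {m i j : ℕ} (hi : i < m) (hj : j < (g i).length) :
    ((List.range m).flatMap g).getD (∑ i' ∈ range i, (g i').length + j) 0 = (g i).getD j 0 := by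
  induction m with
  | zero => omega
  | succ m ih =>
    rw [List.range_succ, List.flatMap_append]
    rcases Nat.lt_succ_iff_lt_or_eq.1 hi with him | rfl
    · rw [List.getD_append, ih him]
      rw [sum_length_flatMap_range]
      have : ∑ i' ∈ range (i + 1), (g i').length ≤ ∑ i' ∈ range m, (g i').length :=
        sum_le_sum_of_subset (range_mono him)
      rw [sum_range_succ] at this
      omega
    · rw [List.getD_append_right _ _ _ _ (by rw [sum_length_flatMap_range]; omega),
        sum_length_flatMap_range]
      simp

/-- The elements of the `i`-th set of an instance. -/
def setList (I : PartialCoverInstance) (i : ℕ) : List ℕ :=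
  if h : i < I.m then ((I.sets ⟨i, h⟩).sort (· ≤ ·)).map fun u : Fin I.n => (u : ℕ) else []

/-- The cell of the input that holds the cardinality of the `i`-th set. -/
def setAddr (I : PartialCoverInstance) (i : ℕ) : ℕ :=
  3 + ∑ i' ∈ range i, ((setList I i').length + 1)

/-! ### The layout of the encoded input -/

section input

variable (I : PartialCoverInstance)

theorem setList_of_lt {i : ℕ} (h : i < I.m) : setList I i =
    ((I.sets ⟨i, h⟩).sort (· ≤ ·)).map fun u : Fin I.n => (u : ℕ) := dif_pos h

theorem length_setList (i : Fin I.m) : (setList I i).length = (I.sets i).card := by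
  simp [setList_of_lt I i.2]

theorem mem_setList {i : Fin I.m} {u : ℕ} : u ∈ setList I i ↔ ∃ x ∈ I.sets i, (x : ℕ) = u := by
  simp [setList_of_lt I i.2]

theorem nodup_setList (i : ℕ) : (setList I i).Nodup := by
  unfold setList
  split_ifs
  · exact (sort_nodup _ _).map Fin.val_injective
  · exact List.nodup_nil

theorem length_setList_le (i : ℕ) : (setList I i).length ≤ I.n := by
  by_cases h : i < I.m
  · rw [show i = ((⟨i, h⟩ : Fin I.m) : ℕ) from rfl, length_setList]
    simpa using card_le_univ (I.sets ⟨i, h⟩)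
  · simp [setList, h]

theorem encode_eq : I.encode = [I.n, I.m, I.p] ++
    (List.range I.m).flatMap fun i => (setList I i).length :: setList I i := by
  unfold PartialCoverInstance.encode
  congr 1
  rw [← List.map_coe_finRange_eq_range, List.flatMap_map]
  congr 1
  ext1 i
  rw [length_setList, setList_of_lt I i.2]

theorem setAddr_succ (i : ℕ) : setAddr I (i + 1) = setAddr I i + 1 + (setList I i).length := by
  rw [setAddr, setAddr, sum_range_succ]
  ring

theorem setAddr_le (i : ℕ) : setAddr I i ≤ 3 + i * (I.n + 1) := by
  unfold setAddr
  have : ∑ i' ∈ range i, ((setList I i').length + 1) ≤ #(range i) • (I.n + 1) :=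
    sum_le_card_nsmul _ _ _ fun i' _ => Nat.succ_le_succ (length_setList_le I i')
  simpa using this

theorem encode_getD {i j : ℕ} (hi : i < I.m) (hj : j < (setList I i).length + 1) :
    I.encode.getD (setAddr I i + j) 0 = ((setList I i).length :: setList I i).getD j 0 := by
  rw [encode_eq, setAddr, List.getD_append_right _ _ _ _ (by simp; omega)]
  have := getD_flatMap_range (fun i => (setList I i).length :: setList I i) hi (j := j)
    (by simpa using hj)
  simp only [List.length_cons, List.length_nil] at this ⊢
  rw [← this]
  congr 1
  omega

theorem encode_getD_length {i : ℕ} (hi : i < I.m) :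
    I.encode.getD (setAddr I i) 0 = (setList I i).length := by
  simpa using encode_getD I hi (j := 0) (by omega)

theorem encode_getD_element {i j : ℕ} (hi : i < I.m) (hj : j < (setList I i).length) :
    I.encode.getD (setAddr I i + 1 + j) 0 = (setList I i).getD j 0 := by
  have := encode_getD I hi (j := j + 1) (by omega)
  rw [List.getD_cons_succ] at this
  rw [← this]
  congr 1
  omega

end input

open Finset

/-! ### Elements represented by positions -/

section representative

variable {m p : ℕ} {L : ℕ → List ℕ}

open scoped Classical in
/-- The last position with the same entry as position `a`. -/
noncomputable def lastPosition (m p : ℕ) (L : ℕ → List ℕ) (a : ℕ) : ℕ :=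
  Nat.findGreatest (fun x => IsPair m p L x ∧ entry p L x = entry p L a) (m * p)

theorem lastPosition_spec {a : ℕ} (ha : IsPair m p L a) : IsPair m p L (lastPosition m p L a) ∧
    entry p L (lastPosition m p L a) = entry p L a := by
  classical
  exact Nat.findGreatest_spec (P := fun x => IsPair m p L x ∧ entry p L x = entry p L a)
    ha.lt.le ⟨ha, rfl⟩

theorem lastPosition_eq {a x : ℕ} (hx : IsPair m p L x) (hxa : entry p L x = entry p L a)
    (hmax : ∀ y, IsPair m p L y → entry p L y = entry p L a → y ≤ x) :
    lastPosition m p L a = x := by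
  classical
  have h := Nat.findGreatest_spec (P := fun x => IsPair m p L x ∧ entry p L x = entry p L a)
    hx.lt.le ⟨hx, hxa⟩
  exact le_antisymm (hmax _ h.1 h.2) (Nat.le_findGreatest hx.lt.le ⟨hx, hxa⟩)

/-- Injectivity of the representatives thus means distinctness of the covered elements. -/
theorem lastPosition_eq_iff {a a' : ℕ} (ha : IsPair m p L a) (ha' : IsPair m p L a') :
    lastPosition m p L a = lastPosition m p L a' ↔ entry p L a = entry p L a' := by
  constructor
  · intro h
    rw [← (lastPosition_spec ha).2, h, (lastPosition_spec ha').2]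
  · intro h
    unfold lastPosition
    rw [h]

theorem mem_pairsOf_iff {i a : ℕ} (hi : i < m) :
    a ∈ pairsOf p (truncLen p L) i ↔ IsPair m p L a ∧ a / p = i := by
  simp only [pairsOf, mem_image, mem_range]
  constructor
  · rintro ⟨j, hj, rfl⟩
    exact ⟨isPair_mul_add hi hj, (mul_add_div_mod (lt_of_lt_truncLen hj)).1⟩
  · rintro ⟨ha, rfl⟩
    exact ⟨a % p, ha.2, Nat.div_add_mod' a p⟩

theorem isPair_of_mem_biUnion {J : Finset ℕ} (hJ : J ⊆ range m) {a : ℕ}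
    (ha : a ∈ J.biUnion (pairsOf p (truncLen p L))) : IsPair m p L a := by
  obtain ⟨i, hi, hai⟩ := mem_biUnion.1 ha
  exact ((mem_pairsOf_iff (mem_range.1 (hJ hi))).1 hai).1

/-- As elements are represented by positions, the number of weights involves only `m` and `p`, not
`n`. -/
theorem family_subset {t : ℕ} {E : Finset ℕ}
    (hE : E ∈ family m p (truncLen p L) (lastPosition m p L) t) :
    E ⊆ range (m * p * (p + 1)) := by
  obtain ⟨J, hJ, -, S, hS, f, -, rfl⟩ := hE
  have hlt {a l : ℕ} (ha : IsPair m p L a) (hl : l ≤ p) :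
      a * (p + 1) + l < m * p * (p + 1) := by
    have : (a + 1) * (p + 1) ≤ m * p * (p + 1) := Nat.mul_le_mul_right _ ha.lt
    rw [Nat.succ_mul] at this
    omega
  intro e he
  simp only [incidence, mem_union, mem_image, mem_univ, true_and] at he
  rw [mem_range]
  rcases he with ⟨a, ha, rfl⟩ | ⟨a, rfl⟩
  · exact hlt (isPair_of_mem_biUnion hJ (hS.subset ha)) le_rfl
  · exact hlt (lastPosition_spec (isPair_of_mem_biUnion hJ (hS.subset a.2))).1 (f a).2.le

theorem family_nonempty {len ρ : ℕ → ℕ} {J S : Finset ℕ} (hJ : J ⊆ range m)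
    (hS : Admissible p len ρ J S) : (family m p len ρ #J).Nonempty := by
  let f := S.equivFinOfCardEq hS.card_eq
  exact ⟨_, J, hJ, rfl, S, hS, f, f.surjective, rfl⟩

/-- Sets with `p` entries in total contain an admissible set of pairs. -/
theorem exists_admissible {J : Finset ℕ} (hJ : J ⊆ range m)
    (h : p ≤ #((J.biUnion (pairsOf p (truncLen p L))).image (entry p L))) :
    ∃ S, Admissible p (truncLen p L) (lastPosition m p L) J S := by
  obtain ⟨V, hV, hVp⟩ := exists_subset_card_eq h
  -- For each of the `p` elements of `V`, choose one position that carries it.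
  obtain ⟨S, hS, hinj, himg⟩ := exists_subset_injOn_image_eq_of_surjOn
    (s := ((J.biUnion (pairsOf p (truncLen p L)) : Finset ℕ) : Set ℕ)) (f := entry p L) V (by
      intro v hv
      simpa using hV hv)
  have hS' : S ⊆ J.biUnion (pairsOf p (truncLen p L)) := by exact_mod_cast hS
  refine ⟨S, hS', ?_, fun a ha b hb hab => hinj ha hb ?_⟩
  · rw [← hVp, ← himg, card_image_of_injOn hinj]
  · exact (lastPosition_eq_iff (isPair_of_mem_biUnion hJ (hS' ha))
      (isPair_of_mem_biUnion hJ (hS' hb))).1 hab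

end representative

/-! ### Partial covers and admissible sets of pairs -/

section cover

variable {I : PartialCoverInstance}

/-- Admissible sets of pairs of an instance. -/
abbrev CoverAdmissible (I : PartialCoverInstance) (J S : Finset ℕ) : Prop :=
  Admissible I.p (truncLen I.p (setList I)) (lastPosition I.m I.p (setList I)) J S

theorem entry_mem {i : Fin I.m} {a : ℕ} (ha : a ∈ pairsOf I.p (truncLen I.p (setList I)) i) :
    ∃ x ∈ I.sets i, (x : ℕ) = entry I.p (setList I) a := by
  rw [← mem_setList]
  simp only [pairsOf, mem_image, mem_range] at ha
  obtain ⟨j, hj, rfl⟩ := ha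
  have hj' : j < (setList I i).length := hj.trans_le (min_le_left _ _)
  rw [entry_mul_add (lt_of_lt_truncLen hj), List.getD_eq_getElem _ _ hj']
  exact List.getElem_mem _

theorem isPartialCover_of_admissible {J : Finset (Fin I.m)} {S : Finset ℕ}
    (hS : CoverAdmissible I (J.map Fin.valEmbedding) S) : I.IsPartialCover J := by
  have hJ : J.map Fin.valEmbedding ⊆ range I.m := by
    intro i hi
    obtain ⟨i, -, rfl⟩ := mem_map.1 hi
    exact mem_range.2 i.2
  have hsub : S.image (entry I.p (setList I)) ⊆ (J.biUnion I.sets).map Fin.valEmbedding := by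
    intro u hu
    obtain ⟨a, ha, rfl⟩ := mem_image.1 hu
    obtain ⟨i, hi, hai⟩ := mem_biUnion.1 (hS.subset ha)
    obtain ⟨i, hiJ, rfl⟩ := mem_map.1 hi
    obtain ⟨x, hx, hxa⟩ := entry_mem hai
    exact mem_map.2 ⟨x, mem_biUnion.2 ⟨i, hiJ, hx⟩, hxa⟩
  have hcard := card_le_card hsub
  rw [card_map, card_image_of_injOn, hS.card_eq] at hcard
  · exact hcard
  · intro a ha b hb hab
    exact hS.injOn ha hb ((lastPosition_eq_iff (isPair_of_mem_biUnion hJ (hS.subset ha))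
      (isPair_of_mem_biUnion hJ (hS.subset hb))).2 hab)

theorem image_entry_pairsOf (i : Fin I.m) :
    (pairsOf I.p (truncLen I.p (setList I)) i).image (entry I.p (setList I)) =
      ((setList I i).take I.p).toFinset := by
  ext u
  simp only [pairsOf, mem_image, mem_range, exists_exists_and_eq_and, List.mem_toFinset,
    List.mem_take_iff_getElem, truncLen]
  constructor
  · rintro ⟨j, hj, rfl⟩
    have hj' : j < (setList I i).length := hj.trans_le (min_le_left _ _)
    refine ⟨j, by omega, ?_⟩
    rw [entry_mul_add (by omega), List.getD_eq_getElem _ _ hj']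
  · rintro ⟨j, hj, rfl⟩
    refine ⟨j, by omega, ?_⟩
    rw [entry_mul_add (by omega), List.getD_eq_getElem]

/-- If some set of `J` has at least `p` elements, it suffices alone, even truncated; otherwise
truncation changes none of the sets of `J`. -/
theorem exists_admissible_of_isPartialCover {J : Finset (Fin I.m)} (h : I.IsPartialCover J) :
    ∃ J' ⊆ range I.m, #J' ≤ #J ∧ ∃ S, CoverAdmissible I J' S := by
  by_cases hbig : ∃ i ∈ J, I.p ≤ #(I.sets i)
  · obtain ⟨i, hi, hip⟩ := hbig
    have hsub : ({(i : ℕ)} : Finset ℕ) ⊆ range I.m := by simp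
    refine ⟨{(i : ℕ)}, hsub, ?_, exists_admissible hsub ?_⟩
    · rw [card_singleton]
      exact card_pos.2 ⟨i, hi⟩
    · rw [singleton_biUnion, image_entry_pairsOf,
        List.toFinset_card_of_nodup ((nodup_setList I i).sublist (List.take_sublist _ _)),
        List.length_take, length_setList]
      exact le_min le_rfl hip
  · push Not at hbig
    have hsub : J.map Fin.valEmbedding ⊆ range I.m := by
      intro i hi
      obtain ⟨i, -, rfl⟩ := mem_map.1 hi
      exact mem_range.2 i.2
    refine ⟨J.map Fin.valEmbedding, hsub, by simp, exists_admissible hsub ?_⟩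
    refine le_trans h ?_
    rw [← card_map Fin.valEmbedding]
    refine card_le_card fun u hu => ?_
    obtain ⟨x, hx, rfl⟩ := mem_map.1 hu
    obtain ⟨i, hi, hxi⟩ := mem_biUnion.1 hx
    have hmem : (x : ℕ) ∈ ((setList I i).take I.p).toFinset := by
      rw [List.mem_toFinset, List.take_of_length_le, mem_setList]
      · exact ⟨x, hxi, rfl⟩
      · rw [length_setList]
        exact (hbig i hi).le
    rw [← image_entry_pairsOf, mem_image] at hmem
    obtain ⟨a, ha, hax⟩ := hmem
    exact mem_image.2 ⟨a, mem_biUnion.2 ⟨i, mem_map.2 ⟨i, hi, rfl⟩, ha⟩, hax⟩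

/-- Configurations with the fewest sets are optimal partial covers. -/
theorem isOptimal_of_admissible {J : Finset ℕ} {t : ℕ} (hJt : #J = t)
    (hJ : J ⊆ range I.m)
    (hmin : ∀ J ⊆ range I.m, ∀ S, CoverAdmissible I J S → t ≤ #J)
    (hS : ∃ S, CoverAdmissible I J S) :
    I.IsOptimal (univ.filter fun i : Fin I.m => (i : ℕ) ∈ J) := by
  have hmap : (univ.filter fun i : Fin I.m => (i : ℕ) ∈ J).map Fin.valEmbedding = J := by
    ext i
    simp only [mem_map, mem_filter, mem_univ, true_and, Fin.valEmbedding_apply]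
    exact ⟨fun ⟨i', h, h'⟩ => h' ▸ h, fun h => ⟨⟨i, mem_range.1 (hJ h)⟩, h, rfl⟩⟩
  refine ⟨?_, fun J' hJ' => ?_⟩
  · obtain ⟨S, hS⟩ := hS
    rw [← hmap] at hS
    exact isPartialCover_of_admissible hS
  · obtain ⟨J'', hsub, hle, S', hS'⟩ := exists_admissible_of_isPartialCover hJ'
    rw [← card_map Fin.valEmbedding, hmap, hJt]
    exact (hmin J'' hsub S' hS').trans hle

end cover

open Finset

/-- The number of random weights of an instance. -/
def weightCount (I : PartialCoverInstance) : ℕ := I.m * I.p * (I.p + 1)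

/-- The number of bits of a random weight of an instance. -/
def weightBits (I : PartialCoverInstance) : ℕ := Nat.clog 2 (3 * weightCount I)

theorem three_mul_weightCount_le (I : PartialCoverInstance) :
    3 * weightCount I ≤ 2 ^ weightBits I := Nat.le_pow_clog (by omega) _

theorem two_pow_weightBits_le (I : PartialCoverInstance) :
    2 ^ weightBits I ≤ 6 * weightCount I + 1 := by
  unfold weightBits
  rcases Nat.lt_or_ge 1 (3 * weightCount I) with h | h
  · have h₁ := Nat.pow_pred_clog_lt_self (b := 2) (by omega) h
    have h₂ := Nat.clog_pos (b := 2) (by omega) h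
    obtain ⟨k, hk⟩ : ∃ k, Nat.clog 2 (3 * weightCount I) = k + 1 := ⟨_, (Nat.succ_pred_eq_of_pos
      h₂).symm⟩
    rw [hk] at h₁ ⊢
    rw [Nat.pred_succ] at h₁
    rw [pow_succ]
    omega
  · rw [Nat.clog_of_right_le_one h]
    simp

/-- The table belongs to an instance and a sequence of coin tosses. -/
structure Table.Describes (T : Table) (I : PartialCoverInstance) (coins : ℕ → Bool) : Prop where
  m_eq : T.m = I.m
  p_eq : T.p = I.p
  M_eq : T.M = (2 * I.p + 1) * 2 ^ weightBits I
  B_eq : T.B = (I.m + 1) * T.M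
  D_eq : T.D = (I.p + 1) * T.B
  wt_eq : T.wt = weights (weightCount I) (weightBits I) coins
  len_eq : T.len = truncLen I.p (setList I)
  rep_eq : ∀ a, IsPair I.m I.p (setList I) a →
    T.rep (T.el a) = lastPosition I.m I.p (setList I) a

/-- The words are long enough for all quantities that the algorithm computes. -/
structure LongWords (I : PartialCoverInstance) (w : ℕ) : Prop where
  w_pos : 0 < w
  const_lt : 3 < 2 ^ w
  m_lt : I.m + 1 < 2 ^ w
  p_lt : 2 * I.p + 1 < 2 ^ w
  mp_lt : I.m * I.p < 2 ^ w
  addr_lt : ∀ i ≤ I.m, setAddr I i < 2 ^ w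
  count_lt : 3 * weightCount I < 2 ^ w
  range_lt : 2 ^ weightBits I < 2 ^ w
  M_lt : (2 * I.p + 1) * 2 ^ weightBits I < 2 ^ w
  B_lt : (I.m + 1) * ((2 * I.p + 1) * 2 ^ weightBits I) + 2 * 2 ^ weightBits I < 2 ^ w
  D_lt : (I.p + 1) * ((I.m + 1) * ((2 * I.p + 1) * 2 ^ weightBits I)) < 2 ^ w

/-- With `N = n + m + p + 2`, the largest quantity is `D ≤ 14 * N ^ 6`; everything stays below `100
* N ^ 6 < N ^ 20 ≤ 2 ^ w`, the constant being absorbed since `N ≥ 2`. -/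
theorem longWords_of_le {I : PartialCoverInstance} {w : ℕ}
    (h : 20 * Nat.clog 2 (I.n + I.m + I.p + 2) ≤ w) : LongWords I w := by
  obtain ⟨N, hN⟩ : ∃ N, N = I.n + I.m + I.p + 2 := ⟨_, rfl⟩
  rw [← hN] at h
  have hN2 : 2 ≤ N := by omega
  have hNw : 100 * N ^ 6 < 2 ^ w := by
    calc 100 * N ^ 6 < 2 ^ 14 * N ^ 6 := by
          have : 0 < N ^ 6 := by positivity
          omega
      _ ≤ N ^ 14 * N ^ 6 := Nat.mul_le_mul_right _ (Nat.pow_le_pow_left hN2 14)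
      _ = N ^ 20 := (pow_add N 14 6).symm
      _ ≤ (2 ^ Nat.clog 2 N) ^ 20 := Nat.pow_le_pow_left (Nat.le_pow_clog (by omega) _) 20
      _ = 2 ^ (20 * Nat.clog 2 N) := by rw [← pow_mul, mul_comm]
      _ ≤ 2 ^ w := Nat.pow_le_pow_right (by omega) h
  have hpow {i j : ℕ} (hij : i ≤ j) : N ^ i ≤ N ^ j := Nat.pow_le_pow_right (by omega) hij
  have h1 : N ≤ N ^ 6 := by simpa using hpow (show 1 ≤ 6 by omega)
  have h2 := hpow (show 2 ≤ 6 by omega)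
  have h3 := hpow (show 3 ≤ 6 by omega)
  have h4 := hpow (show 4 ≤ 6 by omega)
  have h5 := hpow (show 5 ≤ 6 by omega)
  have hG : weightCount I ≤ N ^ 3 := by
    calc I.m * I.p * (I.p + 1) ≤ N * N * N := by gcongr <;> omega
      _ = N ^ 3 := by ring
  have hone : 1 ≤ N ^ 3 := Nat.one_le_pow _ _ (by omega)
  have hR : 2 ^ weightBits I ≤ 7 * N ^ 3 := by
    have := two_pow_weightBits_le I
    omega
  have hM : (2 * I.p + 1) * 2 ^ weightBits I ≤ 14 * N ^ 4 := by
    calc (2 * I.p + 1) * 2 ^ weightBits I ≤ (2 * N) * (7 * N ^ 3) := by gcongr; omega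
      _ = 14 * N ^ 4 := by ring
  have hB : (I.m + 1) * ((2 * I.p + 1) * 2 ^ weightBits I) ≤ 14 * N ^ 5 := by
    calc (I.m + 1) * ((2 * I.p + 1) * 2 ^ weightBits I) ≤ N * (14 * N ^ 4) := by gcongr; omega
      _ = 14 * N ^ 5 := by ring
  have hD : (I.p + 1) * ((I.m + 1) * ((2 * I.p + 1) * 2 ^ weightBits I)) ≤ 14 * N ^ 6 := by
    calc (I.p + 1) * ((I.m + 1) * ((2 * I.p + 1) * 2 ^ weightBits I)) ≤ N * (14 * N ^ 5) := by
          gcongr; omega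
      _ = 14 * N ^ 6 := by ring
  have hmp : I.m * I.p ≤ N ^ 2 := by
    calc I.m * I.p ≤ N * N := by gcongr <;> omega
      _ = N ^ 2 := by ring
  have haddr (i : ℕ) (hi : i ≤ I.m) : setAddr I i ≤ 3 + N ^ 2 := by
    refine (setAddr_le I i).trans (Nat.add_le_add_left ?_ _)
    calc i * (I.n + 1) ≤ N * N := by gcongr <;> omega
      _ = N ^ 2 := by ring
  refine ⟨?_, by omega, by omega, by omega, by omega, fun i hi => ?_, by omega, by omega, by omega,
    by omega, by omega⟩
  · rcases Nat.eq_zero_or_pos w with h | h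
    · rw [h, pow_zero] at hNw
      omega
    · exact h
  · have := haddr i hi
    omega

/-- A bound for the time of the preparations. -/
def setupTime (I : PartialCoverInstance) : ℕ :=
  weightCount I * (weightBits I * 15 + 25) + weightBits I * 16 + I.m * (I.p * 29 + 48) + 100

theorem reaches_setPrices {I : PartialCoverInstance} {w τ : ℕ} {s : State} (hw : LongWords I w)
    (h0 : s.regs 0 = I.m) (h1 : s.regs 1 = I.p) (h2 : s.regs 2 = 2 ^ weightBits I) :
    Reaches w setPrices τ (fun τ' s' => τ' ≤ τ + 30 ∧
      (∀ r, r ≠ 3 → r ≠ 4 → r ≠ 5 → s'.regs r = s.regs r) ∧ s'.mem = s.mem ∧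
      s'.regs 3 = (2 * I.p + 1) * 2 ^ weightBits I ∧ s'.regs 4 = (I.m + 1) * s'.regs 3 ∧
      s'.regs 5 = (I.p + 1) * s'.regs 4) s := by
  have hc := hw.const_lt
  have hp := hw.p_lt
  have hm1 : 1 % 2 ^ w = 1 := Nat.mod_eq_of_lt (by omega)
  have hm2 : 2 % 2 ^ w = 2 := Nat.mod_eq_of_lt (by omega)
  have hBw := hw.B_lt
  apply Reaches.seq
  apply Reaches.assign
  have h₁ : ((Expr.const 2 * .reg 1 + .const 1) * .reg 2).eval w s =
      (2 * I.p + 1) * 2 ^ weightBits I := by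
    simp only [Expr.eval_mul, Expr.eval_add, Expr.eval_const, Expr.eval_reg, h1, h2, hm1, hm2]
    rw [Nat.mod_eq_of_lt (a := 2 * I.p) (by omega), Nat.mod_eq_of_lt hp, Nat.mod_eq_of_lt hw.M_lt]
  rw [h₁]
  apply Reaches.seq
  apply Reaches.assign
  have h₂ : ((Expr.reg 0 + .const 1) * .reg 3).eval w
      (s.setReg 3 ((2 * I.p + 1) * 2 ^ weightBits I)) =
      (I.m + 1) * ((2 * I.p + 1) * 2 ^ weightBits I) := by
    simp only [Expr.eval_mul, Expr.eval_add, Expr.eval_const, Expr.eval_reg, hm1,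
      State.setReg_regs, if_true, show (0 : ℕ) ≠ 3 by omega, if_false, h0]
    rw [Nat.mod_eq_of_lt hw.m_lt, Nat.mod_eq_of_lt (by omega)]
  rw [h₂]
  apply Reaches.assign
  have h₃ : ((Expr.reg 1 + .const 1) * .reg 4).eval w
      ((s.setReg 3 ((2 * I.p + 1) * 2 ^ weightBits I)).setReg 4
        ((I.m + 1) * ((2 * I.p + 1) * 2 ^ weightBits I))) =
      (I.p + 1) * ((I.m + 1) * ((2 * I.p + 1) * 2 ^ weightBits I)) := by
    simp only [Expr.eval_mul, Expr.eval_add, Expr.eval_const, Expr.eval_reg, hm1,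
      State.setReg_regs, if_true, show (1 : ℕ) ≠ 3 by omega, show (1 : ℕ) ≠ 4 by omega,
      if_false, h1]
    rw [Nat.mod_eq_of_lt (a := I.p + 1) (by omega), Nat.mod_eq_of_lt hw.D_lt]
  rw [h₃]
  simp only [Expr.cost_mul, Expr.cost_add, Expr.cost_reg, Expr.cost_const]
  refine ⟨by omega, fun r h₃ h₄ h₅ => by simp [h₃, h₄, h₅], rfl, ?_⟩
  simp

theorem reaches_setup {I : PartialCoverInstance} {w τ : ℕ} (hw : LongWords I w)
    (coins : ℕ → Bool) :
    Reaches w setup τ (fun τ' s' => τ' ≤ τ + setupTime I ∧ s'.regs 6 = 0 ∧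
      ∃ T : Table, T.Stored s' ∧ T.Fits w ∧ T.Describes I coins) (State.init I.encode coins) := by
  have hc := hw.const_lt
  have hp := hw.p_lt
  have henc := encode_eq I
  have hin1 : I.encode.getD 1 0 = I.m := by rw [henc]; rfl
  have hin2 : I.encode.getD 2 0 = I.p := by rw [henc]; rfl
  apply Reaches.seq
  apply Reaches.assign
  apply Reaches.seq
  apply Reaches.assign
  simp only [Expr.eval_load, Expr.eval_const, State.setReg_mem]
  rw [Nat.mod_eq_of_lt (a := 1) (by omega), Nat.mod_eq_of_lt (a := 2) (by omega)]
  have hmem0 (i : ℕ) : (State.init I.encode coins).mem 0 i = I.encode.getD i 0 := rfl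
  rw [hmem0, hmem0, hin1, hin2]
  set s₀ := ((State.init I.encode coins).setReg 0 I.m).setReg 1 I.p with hs₀
  apply Reaches.seq
  refine (reaches_drawWeights (s := s₀) (m := I.m) (p := I.p) (coins := coins) (by simp [hs₀])
    (by simp [hs₀]) rfl rfl hw.count_lt hw.range_lt (by omega) hc rfl rfl).mono ?_
  rintro τ₁ s₁ ⟨hτ₁, hr₁, h2₁, hm₁, hwt₁⟩
  have h0₁ : s₁.regs 0 = I.m := (hr₁ 0 (by omega) (by omega)).trans (by simp [hs₀])
  have h1₁ : s₁.regs 1 = I.p := (hr₁ 1 (by omega) (by omega)).trans (by simp [hs₀])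
  have h6₁ : s₁.regs 6 = 0 := (hr₁ 6 (by omega) (by omega)).trans (by simp [hs₀, State.init])
  have hin₁ (i : ℕ) : s₁.mem 0 i = I.encode.getD i 0 := by rw [hm₁ 0 (by omega)]; rfl
  have hmw := hw.m_lt
  apply Reaches.seq
  refine (reaches_readInput (m := I.m) (p := I.p) (L := setList I) (addr := setAddr I) h0₁ h1₁
    (by simp [setAddr]) (fun i _ => setAddr_succ I i)
    (fun i hi => by rw [hin₁, encode_getD_length I hi])
    (fun i hi j hj => by rw [hin₁, encode_getD_element I hi hj]) hw.addr_lt hw.mp_lt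
    (by omega) (by omega)).mono ?_
  rintro τ₂ s₂ ⟨hτ₂, hr₂, hm₂, hlen₂, hread₂⟩
  refine (reaches_setPrices hw ((hr₂ 0 (by omega)).trans h0₁) ((hr₂ 1 (by omega)).trans h1₁)
    ((hr₂ 2 (by omega)).trans h2₁)).mono ?_
  rintro τ₃ s₃ ⟨hτ₃, hr₃, hm₃, h3, h4, h5⟩
  have hlen : s₃.mem 3 = truncLen I.p (setList I) := by
    rw [hm₃, hlen₂]
    ext i
    split_ifs with hi
    · rfl
    · rw [hm₁ 3 (by omega)]
      simp [hs₀, State.init, truncLen, setList, hi]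
  have hwt : s₃.mem 2 = weights (weightCount I) (weightBits I) coins := by
    rw [hm₃, hm₂ 2 (by omega), hwt₁]
    rfl
  -- After all positions have been read, the last copied position of an element is its last position
  -- overall.
  have hrep (a : ℕ) (ha : IsPair I.m I.p (setList I) a) :
      s₃.mem 5 (s₃.mem 4 a) = lastPosition I.m I.p (setList I) a := by
    obtain ⟨h₁, h₂, -, h₃, -⟩ := hread₂ a ha ha.lt
    rw [hm₃, h₁]
    refine (lastPosition_eq h₂ h₃ fun y hy hya => ?_).symm
    rw [← hya]
    exact (hread₂ y hy hy.lt).2.2.2.2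
  have hidx {a : ℕ} (ha : IsPair I.m I.p (setList I) a) : a * (I.p + 1) + I.p < 2 ^ w := by
    have h₁ : (a + 1) * (I.p + 1) ≤ I.m * I.p * (I.p + 1) := Nat.mul_le_mul_right _ ha.lt
    have h₂ := hw.count_lt
    rw [Nat.succ_mul] at h₁
    unfold weightCount at h₂
    omega
  have hBlt := hw.B_lt
  have hDlt := hw.D_lt
  rw [← h3, ← h4] at hBlt hDlt
  have hBpos : 0 < s₃.regs 4 := by
    rw [h4, h3]
    positivity
  refine ⟨?_, ?_, ⟨I.m, I.p, s₃.regs 3, s₃.regs 4, s₃.regs 5, s₃.mem 2, s₃.mem 3, s₃.mem 4,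
    s₃.mem 5⟩, ?_, ?_, ?_⟩
  · simp only [Expr.cost_load, Expr.cost_const] at hτ₁
    have h' : setupTime I = I.m * I.p * (I.p + 1) * (Nat.clog 2 (3 * (I.m * I.p * (I.p + 1))) * 15
      + 25) + Nat.clog 2 (3 * (I.m * I.p * (I.p + 1))) * 16 + I.m * (I.p * 29 + 48) + 100 := rfl
    omega
  · rw [hr₃ 6 (by omega) (by omega) (by omega), hr₂ 6 (by omega), h6₁]
  · exact ⟨by rw [hr₃ 0 (by omega) (by omega) (by omega), hr₂ 0 (by omega), h0₁],
      by rw [hr₃ 1 (by omega) (by omega) (by omega), hr₂ 1 (by omega), h1₁],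
      rfl, rfl, rfl, rfl, rfl, rfl, rfl⟩
  · refine ⟨hw.w_pos, hBpos, ?_, ?_, hmw, by simp only; omega, fun i _ => ?_, fun x y => ?_,
      fun i hi j hj => ?_, fun i hi j hj => ?_⟩
    · simp only [h5]
      positivity
    · simp only [h5]
      exact hDlt
    · simp only [hlen]
      exact min_le_right _ _
    · simp only [hwt]
      have h₁ := weights_lt (weightCount I) (weightBits I) coins x
      have h₂ := weights_lt (weightCount I) (weightBits I) coins y
      omega
    · simp only [hlen] at hj
      exact hidx (isPair_mul_add hi hj)
    · simp only [hlen] at hj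
      have hpair := isPair_mul_add hi hj
      simp only [hrep _ hpair]
      exact hidx (lastPosition_spec hpair).1
  · exact ⟨rfl, rfl, h3, h4, h5, hwt, hlen, hrep⟩

end PartialCover

end WordRAM

/-! ### Running time and correctness -/

namespace WordRAM

namespace PartialCover

open Finset

theorem weightCount_le (I : PartialCoverInstance) :
    weightCount I ≤ (I.m + 1) * (I.p + 1) ^ 2 := by
  calc I.m * I.p * (I.p + 1) ≤ (I.m + 1) * (I.p + 1) * (I.p + 1) := by gcongr <;> omega
    _ = (I.m + 1) * (I.p + 1) ^ 2 := by ring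

theorem two_pow_weightBits_le_mul (I : PartialCoverInstance) :
    2 ^ weightBits I ≤ 7 * ((I.m + 1) * (I.p + 1) ^ 2) := by
  have h₁ := two_pow_weightBits_le I
  have h₂ := weightCount_le I
  have h₃ : 0 < (I.m + 1) * (I.p + 1) ^ 2 := by positivity
  omega

theorem setupTime_le (I : PartialCoverInstance) :
    setupTime I ≤ 419 * ((I.m + 1) * (I.p + 1) ^ 2) ^ 2 := by
  have hG := weightCount_le I
  have hb := (Nat.lt_two_pow_self (n := weightBits I)).le.trans (two_pow_weightBits_le_mul I)
  have hm : I.m * (I.p * 29 + 48) ≤ 77 * ((I.m + 1) * (I.p + 1) ^ 2) := by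
    calc I.m * (I.p * 29 + 48) ≤ (I.m + 1) * (77 * (I.p + 1) ^ 2) := by
          gcongr
          · omega
          · nlinarith
      _ = 77 * ((I.m + 1) * (I.p + 1) ^ 2) := by ring
  have hH : 1 ≤ (I.m + 1) * (I.p + 1) ^ 2 := Nat.succ_le_of_lt (by positivity)
  set H := (I.m + 1) * (I.p + 1) ^ 2 with hHdef
  have h₁ : weightCount I * (weightBits I * 15 + 25) ≤ H * (7 * H * 15 + 25) := by gcongr
  unfold setupTime
  nlinarith

theorem runsTime_le {T : Table} (hD : 0 < T.D) :
    runsTime T ≤ 402 * (2 ^ T.p * ((T.m + 1) ^ 2 * (T.D * (T.p + 1) ^ 2))) := by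
  have hq : 1 ≤ (T.p + 1) ^ 2 := Nat.one_le_pow _ _ (by omega)
  have hpq : T.p + 1 ≤ (T.p + 1) ^ 2 := Nat.le_self_pow (by omega) _
  -- Up to constants, `Y` bounds the time for one set, `Z` below the time for one product, and `V`
  -- the time for one sum over all sets of labels.
  obtain ⟨Y, hY⟩ : ∃ Y, Y = T.D * (T.p + 1) ^ 2 := ⟨_, rfl⟩
  have hDY : T.D ≤ Y := hY ▸ Nat.le_mul_of_pos_right _ (by omega)
  have hpY : T.p + 1 ≤ Y := hpq.trans (hY ▸ Nat.le_mul_of_pos_left _ hD)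
  have h₁ : mulSetTime T ≤ 178 * Y := by
    have h : T.p * (T.D * (T.p * 33 + 20) + 49) ≤ 102 * Y := by
      calc T.p * (T.D * (T.p * 33 + 20) + 49) ≤
            (T.p + 1) * (T.D * (53 * (T.p + 1)) + 49 * (T.D * (T.p + 1))) := by
            have : 0 < T.D * (T.p + 1) := by positivity
            gcongr <;> omega
        _ = 102 * Y := by rw [hY]; ring
    unfold mulSetTime
    omega
  obtain ⟨Z, hZ⟩ : ∃ Z, Z = (T.m + 1) * Y := ⟨_, rfl⟩
  have hYZ : Y ≤ Z := hZ ▸ Nat.le_mul_of_pos_left _ (by omega)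
  have h₂ : addProductTime T ≤ 274 * Z := by
    have h : T.m * (mulSetTime T + 8) ≤ 186 * Z := by
      calc T.m * (mulSetTime T + 8) ≤ (T.m + 1) * (186 * Y) := by gcongr <;> omega
        _ = 186 * Z := by rw [hZ]; ring
    unfold addProductTime
    omega
  obtain ⟨V, hV⟩ : ∃ V, V = 2 ^ T.p * Z := ⟨_, rfl⟩
  have hZV : Z ≤ V := hV ▸ Nat.le_mul_of_pos_left _ (by positivity)
  have h₃ : sumProductsTime T ≤ 320 * V := by
    have h : 2 ^ T.p * (addProductTime T + 4) ≤ 278 * V := by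
      calc 2 ^ T.p * (addProductTime T + 4) ≤ 2 ^ T.p * (278 * Z) := by gcongr; omega
        _ = 278 * V := by rw [hV]; ring
    unfold sumProductsTime
    omega
  have h₄ : (T.m + 1) * (sumProductsTime T + T.D * 30 + 40) ≤ 390 * ((T.m + 1) * V) := by
    calc (T.m + 1) * (sumProductsTime T + T.D * 30 + 40) ≤ (T.m + 1) * (390 * V) := by
          gcongr; omega
      _ = 390 * ((T.m + 1) * V) := by ring
  have h₅ : V ≤ (T.m + 1) * V := Nat.le_mul_of_pos_left _ (by omega)
  calc runsTime T ≤ 402 * ((T.m + 1) * V) := by unfold runsTime; omega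
    _ = _ := by rw [hV, hZ, hY]; ring

theorem time_le {I : PartialCoverInstance} {T : Table} {coins : ℕ → Bool} (hD : 0 < T.D)
    (h : T.Describes I coins) :
    setupTime I + runsTime T ≤ 6100 * (2 ^ I.p * ((I.m + 1) ^ 4 * (I.p + 1) ^ 6)) := by
  have hDle : T.D ≤ 14 * ((I.m + 1) ^ 2 * (I.p + 1) ^ 4) := by
    rw [h.D_eq, h.B_eq, h.M_eq]
    calc (I.p + 1) * ((I.m + 1) * ((2 * I.p + 1) * 2 ^ weightBits I)) ≤
          (I.p + 1) * ((I.m + 1) * ((2 * (I.p + 1)) * (7 * ((I.m + 1) * (I.p + 1) ^ 2)))) := by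
          gcongr
          · omega
          · exact two_pow_weightBits_le_mul I
      _ = 14 * ((I.m + 1) ^ 2 * (I.p + 1) ^ 4) := by ring
  have h₁ := runsTime_le hD
  rw [h.m_eq, h.p_eq] at h₁
  have h₂ : 2 ^ I.p * ((I.m + 1) ^ 2 * (T.D * (I.p + 1) ^ 2)) ≤
      14 * (2 ^ I.p * ((I.m + 1) ^ 4 * (I.p + 1) ^ 6)) := by
    calc 2 ^ I.p * ((I.m + 1) ^ 2 * (T.D * (I.p + 1) ^ 2)) ≤ 2 ^ I.p * ((I.m + 1) ^ 2 *
          ((14 * ((I.m + 1) ^ 2 * (I.p + 1) ^ 4)) * (I.p + 1) ^ 2)) := by gcongr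
      _ = _ := by ring
  have h₃ := setupTime_le I
  have h₄ : ((I.m + 1) * (I.p + 1) ^ 2) ^ 2 ≤ 2 ^ I.p * ((I.m + 1) ^ 4 * (I.p + 1) ^ 6) := by
    calc ((I.m + 1) * (I.p + 1) ^ 2) ^ 2 = 1 * ((I.m + 1) ^ 2 * (I.p + 1) ^ 4) := by ring
      _ ≤ 2 ^ I.p * ((I.m + 1) ^ 4 * (I.p + 1) ^ 6) := by
        gcongr
        · exact Nat.one_le_two_pow
        · omega
        · omega
        · omega
        · omega
  omega

/-- The random weights isolate a configuration with the fewest sets. -/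
def GoodCoins (I : PartialCoverInstance) (coins : ℕ → Bool) : Prop :=
  ∀ J ⊆ range I.m, (∃ S, CoverAdmissible I J S) →
    (∀ J' ⊆ range I.m, ∀ S, CoverAdmissible I J' S → #J ≤ #J') →
      Isolated (weights (weightCount I) (weightBits I) coins)
        (family I.m I.p (truncLen I.p (setList I)) (lastPosition I.m I.p (setList I)) #J)

theorem exists_fewest {I : PartialCoverInstance}
    (h : ∃ J ⊆ range I.m, ∃ S, CoverAdmissible I J S) :
    ∃ J ⊆ range I.m, (∃ S, CoverAdmissible I J S) ∧
      ∀ J' ⊆ range I.m, ∀ S, CoverAdmissible I J' S → #J ≤ #J' := by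
  classical
  obtain ⟨J₁, hJ₁, hS₁⟩ := h
  obtain ⟨J, hJ, hmin⟩ := exists_min_image
    {J ∈ (range I.m).powerset | ∃ S, CoverAdmissible I J S} card
    ⟨J₁, mem_filter.2 ⟨mem_powerset.2 hJ₁, hS₁⟩⟩
  obtain ⟨h₁, h₂⟩ := mem_filter.1 hJ
  exact ⟨J, mem_powerset.1 h₁, h₂, fun J' hJ' S hS =>
    hmin J' (mem_filter.2 ⟨mem_powerset.2 hJ', S, hS⟩)⟩

theorem two_thirds_le_goodCoins (I : PartialCoverInstance) :
    2 / 3 ≤ fairCoins {coins | GoodCoins I coins} := by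
  by_cases h : ∃ J ⊆ range I.m, ∃ S, CoverAdmissible I J S
  · obtain ⟨J, hJ, ⟨S, hS⟩, hmin⟩ := exists_fewest h
    refine (two_thirds_le_isolated (family_nonempty hJ hS) (fun E hE => family_subset hE)
      (three_mul_weightCount_le I)).trans (measure_mono fun coins hc J' hJ' ⟨S', hS'⟩ hmin' => ?_)
    rw [le_antisymm (hmin' J hJ S hS) (hmin J' hJ' S' hS')]
    exact hc
  -- Without a cover all coins are good; the one-member family `{∅}` supplies the bound.
  · refine (two_thirds_le_isolated (G := 0) (b := 0) (F := {∅}) (Set.singleton_nonempty _)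
      (by simp) (by simp)).trans (measure_mono fun coins _ J hJ hS => ?_)
    exact absurd ⟨J, hJ, hS⟩ h

/-- The time bound holds for all coins; only correctness depends on isolation. An infeasible
instance is always recognized, since then all coefficients below `D` vanish. -/
theorem reaches_program {I : PartialCoverInstance} {w : ℕ} (hw : LongWords I w)
    (coins : ℕ → Bool) :
    Reaches w program 0 (fun τ s => τ ≤ 6100 * (2 ^ I.p * ((I.m + 1) ^ 4 * (I.p + 1) ^ 6)) ∧
      (GoodCoins I coins → I.IsAnswer s.output)) (State.init I.encode coins) := by
  apply Reaches.seq
  refine (reaches_setup hw coins).mono ?_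
  rintro τ₁ s₁ ⟨hτ₁, h6, T, hst, hfit, hdes⟩
  refine (reaches_runs hfit (by have := hw.const_lt; omega) hst h6).mono ?_
  rintro τ₂ s₂ ⟨hτ₂, hnone, hleast⟩
  refine ⟨?_, fun hgood => ?_⟩
  · have := time_le hfit.D_pos hdes
    omega
  have hρ : ∀ i < T.m, ∀ a ∈ pairsOf T.p T.len i,
      T.rep (T.el a) = lastPosition I.m I.p (setList I) a := by
    intro i hi a ha
    rw [hdes.p_eq, hdes.len_eq] at ha
    exact hdes.rep_eq a ((mem_pairsOf_iff (hdes.m_eq ▸ hi)).1 ha).1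
  have hDeq : T.D = (T.p + 1) * T.B := by rw [hdes.D_eq, hdes.p_eq]
  by_cases hex : ∃ J ⊆ range I.m, ∃ S, CoverAdmissible I J S
  · obtain ⟨J, hJ, hS, hmin⟩ := exists_fewest hex
    have hiso := hgood J hJ hS hmin
    obtain ⟨J₀, hJ₀, hcard, hS₀, v, hv, hJv⟩ := exists_isLeastDegree (T := T)
      (R := 2 ^ weightBits I) (t := #J)
      (ρ := lastPosition I.m I.p (setList I)) hfit.len_le hρ (by rw [hdes.M_eq, hdes.p_eq])
      (by rw [hdes.B_eq, hdes.m_eq]) hDeq (fun x => by rw [hdes.wt_eq]; exact weights_lt _ _ _ _)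
      (by rw [hdes.m_eq, hdes.p_eq, hdes.len_eq]; exact hmin)
      (by rw [hdes.m_eq, hdes.p_eq, hdes.len_eq, hdes.wt_eq]; exact hiso)
    rw [hdes.p_eq, hdes.len_eq] at hS₀
    rw [hdes.m_eq] at hJ₀ hJv hleast
    have hopt := isOptimal_of_admissible hcard hJ₀ hmin hS₀
    obtain ⟨h0, hout⟩ := hleast v hv
    refine ⟨fun _ => ⟨h0, ?_⟩, fun hcon => absurd ⟨_, hopt.1⟩ hcon⟩
    convert hopt using 4 with i
    exact (hout i i.2).trans (hJv i i.2)
  · have hno : ¬ ∃ J, I.IsPartialCover J := by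
      rintro ⟨J, hJ⟩
      obtain ⟨J', hJ', -, hS⟩ := exists_admissible_of_isPartialCover hJ
      exact hex ⟨J', hJ', hS⟩
    refine ⟨fun h => absurd h hno, fun _ => hnone fun v hv => ?_⟩
    refine coeff_total_eq_zero hfit.len_le hρ ?_ 0 (hDeq ▸ hv)
    intro J hJ S hS
    rw [hdes.m_eq] at hJ
    rw [hdes.p_eq, hdes.len_eq] at hS
    exact hex ⟨J, hJ, S, hS⟩

/-- Polynomial factors are absorbed by a slightly larger base. -/
theorem exists_mul_pow_le (ε : ℝ) (hε : 0 < ε) (k : ℕ) :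
    ∃ K : ℝ, 0 < K ∧ ∀ p : ℕ, (2 : ℝ) ^ p * ((p : ℝ) + 1) ^ k ≤ K * (2 + ε) ^ p := by
  have hr : |2 / (2 + ε)| < 1 := by
    rw [abs_of_pos (by positivity), div_lt_one (by positivity)]
    linarith
  -- The sequence `n ^ k * (2 / (2 + ε)) ^ n` tends to zero and is therefore bounded. It is used at
  -- `n = p + 1`, which costs one factor `2 / (2 + ε)` in the constant.
  have ht := tendsto_pow_const_mul_const_pow_of_abs_lt_one k hr
  obtain ⟨K, hK⟩ := ht.bddAbove_range
  have hr0 : (0 : ℝ) < 2 / (2 + ε) := by positivity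
  have hK0 : 0 < K := by
    have : (fun n : ℕ => (n : ℝ) ^ k * (2 / (2 + ε)) ^ n) 1 ≤ K := hK ⟨1, rfl⟩
    refine lt_of_lt_of_le ?_ this
    simp only [Nat.cast_one, one_pow, one_mul, pow_one]
    exact hr0
  refine ⟨K / (2 / (2 + ε)), by positivity, fun p => ?_⟩
  have h : (fun n : ℕ => (n : ℝ) ^ k * (2 / (2 + ε)) ^ n) (p + 1) ≤ K := hK ⟨p + 1, rfl⟩
  simp only [Nat.cast_add, Nat.cast_one, pow_succ] at h
  rw [div_mul_eq_mul_div, le_div_iff₀ hr0]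
  have h2 : (2 : ℝ) ^ p = (2 / (2 + ε)) ^ p * (2 + ε) ^ p := by
    rw [← mul_pow, div_mul_cancel₀ _ (by positivity)]
  calc (2 : ℝ) ^ p * ((p : ℝ) + 1) ^ k * (2 / (2 + ε)) =
        ((p : ℝ) + 1) ^ k * ((2 / (2 + ε)) ^ p * (2 / (2 + ε))) * (2 + ε) ^ p := by
        rw [h2]; ring
    _ ≤ K * (2 + ε) ^ p := by gcongr

end PartialCover

end WordRAM

theorem theorem2 :
    ∃ C : ℝ, 0 < C ∧ ∀ ε : ℝ, 0 < ε →
      ∃ (P : WordRAM.Program) (K : ℝ) (c : ℕ),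
        ∀ (I : PartialCoverInstance) (w : ℕ), c * Nat.clog 2 (I.n + I.m + I.p + 2) ≤ w →
          (∀ coins : ℕ → Bool, ∃ (t : ℕ) (s : WordRAM.State),
            WordRAM.Exec w P (WordRAM.State.init I.encode coins) t s ∧
              (t : ℝ) ≤ K * (2 + ε) ^ I.p * (max (I.m : ℝ) 1) ^ (C / min ε 1)) ∧
          2 / 3 ≤ WordRAM.fairCoins {coins | ∃ (t : ℕ) (s : WordRAM.State),
            WordRAM.Exec w P (WordRAM.State.init I.encode coins) t s ∧ I.IsAnswer s.output} := by
  -- The exponent of `m` is `4` for every `ε`; dividing by `min ε 1 ≤ 1` only weakens the bound.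
  refine ⟨4, by norm_num, fun ε hε => ?_⟩
  obtain ⟨K, hK, hpoly⟩ := WordRAM.PartialCover.exists_mul_pow_le ε hε 6
  -- The factor 16 comes from `(m + 1) ^ 4 ≤ (2 * max m 1) ^ 4`. The program itself does not depend
  -- on `ε`; only the constant `K` does.
  refine ⟨WordRAM.PartialCover.program, 6100 * 16 * K, 20, fun I w hw => ?_⟩
  have hlong := WordRAM.PartialCover.longWords_of_le hw
  refine ⟨fun coins => ?_, ?_⟩
  · obtain ⟨t, s, hexec, ht, -⟩ := WordRAM.PartialCover.reaches_program hlong coins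
    refine ⟨t, s, hexec, ?_⟩
    rw [zero_add] at ht
    have ht' : (t : ℝ) ≤ 6100 * (2 ^ I.p * (((I.m : ℝ) + 1) ^ 4 * ((I.p : ℝ) + 1) ^ 6)) := by
      exact_mod_cast ht
    have hmax : (1 : ℝ) ≤ max (I.m : ℝ) 1 := le_max_right _ _
    have hm : ((I.m : ℝ) + 1) ^ 4 ≤ 16 * max (I.m : ℝ) 1 ^ (4 / min ε 1) := by
      calc ((I.m : ℝ) + 1) ^ 4 ≤ (2 * max (I.m : ℝ) 1) ^ 4 := by
            have := le_max_left (I.m : ℝ) 1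
            gcongr
            linarith
        _ = 16 * max (I.m : ℝ) 1 ^ (4 : ℝ) := by
            rw [mul_pow, ← Real.rpow_natCast _ 4]
            norm_num
        _ ≤ 16 * max (I.m : ℝ) 1 ^ (4 / min ε 1) := by
            gcongr
            rw [le_div_iff₀ (lt_min hε one_pos)]
            have := min_le_right ε 1
            linarith
    calc (t : ℝ) ≤ 6100 * (2 ^ I.p * (((I.m : ℝ) + 1) ^ 4 * ((I.p : ℝ) + 1) ^ 6)) := ht'
      _ = 6100 * (2 ^ I.p * ((I.p : ℝ) + 1) ^ 6) * ((I.m : ℝ) + 1) ^ 4 := by ring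
      _ ≤ 6100 * (K * (2 + ε) ^ I.p) * (16 * max (I.m : ℝ) 1 ^ (4 / min ε 1)) := by
          have := hpoly I.p
          gcongr
      _ = 6100 * 16 * K * (2 + ε) ^ I.p * max (I.m : ℝ) 1 ^ (4 / min ε 1) := by ring
  · refine (WordRAM.PartialCover.two_thirds_le_goodCoins I).trans
      (MeasureTheory.measure_mono fun coins hc => ?_)
    obtain ⟨t, s, hexec, -, hans⟩ := WordRAM.PartialCover.reaches_program hlong coins
    exact ⟨t, s, hexec, hans hc⟩
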